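/- Let $2^\omega$ be Cantor space, whose elements are called reals; for a finite binary string $\sigma$ let $[\sigma]\subseteq 2^\omega$ be the cylinder of all reals extending $\sigma$, and for a set $U$ of strings let $[U]=\bigcup_{\sigma\in U}[\sigma]$. "Measure" means Borel probability measure on $2^\omega$. Metrize the space of measures by $$d(\mu,\nu)=\sum_{n\ge 1}2^{-n}\cdot\frac12\sum_{|\sigma|=n}\bigl|\mu([\sigma])-\nu([\sigma])\bigr| .$$ *Representations.* A representation of a measure $\mu$ is a real $p$ that codes, through an effective bijective coding of the bit positions, for each $n\ge 0$ a list $\sigma_{n,0},\dots,\sigma_{n,4^{n+2}-1}$ of strings of length $n+2$ (unused bits of $p$ being $0$), such that the finitely supported rational measures $\nu_n=4^{-(n+2)}\sum_{i<4^{n+2}}\delta_{\sigma_{n,i}{}^\frown 0^\omega}$ satisfy $d(\nu_n,\nu_m)\le 2^{-n}$ for all $n\le m$ and $d(\nu_n,\mu)\to 0$. (The set of all representations is a $\Pi^0_1$ subset of $2^\omega$, and every measure has a representation.) *Randomness.* For a representation $p$ of $\mu$, a $p$-Martin-Löf test is a sequence $(U_n)_{n\in\mathbb N}$ of sets of finite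 binary strings that is uniformly recursively enumerable in $p$ and satisfies $\sum_{\sigma\in U_n}\mu([\sigma])\le 2^{-n}$ for every $n$. A real $x$ is $\mu$-random if, for some representation $p$ of $\mu$, $x\notin\bigcap_n [U_n]$ for every $p$-Martin-Löf test $(U_n)$. A real $x$ is a $\mu$-atom if $\mu(\{x\})>0$. **Theorem.** For every real $x\in 2^\omega$ the following are equivalent: 1. there is a probability measure $\mu$ on $2^\omega$ such that $x$ is not a $\mu$-atom and $x$ is $\mu$-random; 2. $x$ is not recursive. -/

import Mathlib

open MeasureTheory Filter Topology
open scoped ENNReal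

noncomputable section

/-- Cantor space; its elements are called reals. It carries the product (Borel) σ-algebra. -/
abbrev Cantor : Type := ℕ → Bool

namespace Cantor

/-- The initial segment of `x` of length `n`. -/
def restrict (x : Cantor) (n : ℕ) : List Bool := (List.range n).map x

/-- The cylinder of all reals that extend the finite string `σ`. -/
def cyl (σ : List Bool) : Set Cantor := {x | x.restrict σ.length = σ}

/-- The open set induced by a set of strings. -/
def openOf (U : Set (List Bool)) : Set Cantor := ⋃ σ ∈ U, cyl σ

/-- The real `σ⌢0^ω`. -/
def padZero (σ : List Bool) : Cantor := fun k => σ.getD k false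

/-- `x` viewed as an oracle for relative computation. -/
def oracle (x : Cantor) : Set (ℕ →. ℕ) := {fun n => Part.some (x n).toNat}

/-- The predicate `A` is recursively enumerable in `x`: it is the domain of a
partial function that is recursive in `x`. -/
def REIn {α : Type*} [Primcodable α] (x : Cantor) (A : α → Prop) : Prop :=
  ∃ f : α →. Unit, RecursiveIn x.oracle f ∧ ∀ a, A a ↔ (f a).Dom

/-- `d_n(μ, ν) = (1/2) ∑_{|σ| = n} |μ[σ] - ν[σ]|`. -/
def levelDist (n : ℕ) (μ ν : Measure Cantor) : ℝ :=
  (1 / 2) * ∑ σ : Fin n → Bool, |μ.real (cyl (List.ofFn σ)) - ν.real (cyl (List.ofFn σ))|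

/-- The metric `d(μ, ν) = ∑_{n ≥ 1} 2^{-n} d_n(μ, ν)` on the probability measures on Cantor
space, which is compatible with the weak topology. -/
def measDist (μ ν : Measure Cantor) : ℝ :=
  ∑' n : ℕ, (1 / 2 : ℝ) ^ (n + 1) * levelDist (n + 1) μ ν

/-- The `i`-th string, of length `n + 2`, in the `n`-th block of the code `p`. -/
def blockString (p : Cantor) (n i : ℕ) : List Bool :=
  (List.range (n + 2)).map fun j => p (Nat.pair n (Nat.pair i j))

/-- The `n`-th approximation coded by `p`: the rational combination
`4^{-(n+2)} ∑_{i < 4^{n+2}} δ_{σ_i⌢0^ω}` of Dirac measures, where `σ_i` is the `i`-th string in the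
`n`-th block (strings may be repeated, so that the weights of the distinct strings are arbitrary
multiples of `4^{-(n+2)}` that add up to one). -/
def approx (p : Cantor) (n : ℕ) : Measure Cantor :=
  ((4 : ℝ≥0∞) ^ (n + 2))⁻¹ •
    ∑ i ∈ Finset.range (4 ^ (n + 2)), Measure.dirac (padZero (blockString p n i))

/-- The `Π⁰₁` subset of Cantor space that consists of the codes of measures: every bit that belongs
to no block is `0`, and the coded approximations form a fast Cauchy sequence. -/
def codes : Set Cantor :=
  {p | (∀ n i j, 4 ^ (n + 2) ≤ i ∨ n + 2 ≤ j → p (Nat.pair n (Nat.pair i j)) = false) ∧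
    ∀ n m, n ≤ m → measDist (approx p n) (approx p m) ≤ (1 / 2 : ℝ) ^ n}

/-- `p` is a representation of `μ`: it is a code whose approximations converge to `μ`. -/
def Represents (p : Cantor) (μ : ProbabilityMeasure Cantor) : Prop :=
  p ∈ codes ∧ Tendsto (fun n => measDist (approx p n) (μ : Measure Cantor)) atTop (𝓝 0)

/-- `U` is a Martin-Löf test for the measure `μ` with representation `p`: it is uniformly
recursively enumerable in `p`, and `∑_{σ ∈ U_n} μ[σ] ≤ 2^{-n}` for every `n`. -/
def IsTest (p : Cantor) (μ : ProbabilityMeasure Cantor) (U : ℕ → Set (List Bool)) : Prop :=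
  REIn p (fun a : ℕ × List Bool => a.2 ∈ U a.1) ∧
    ∀ n, ∑' σ : U n, (μ : Measure Cantor) (cyl σ) ≤ (2 : ℝ≥0∞)⁻¹ ^ n

/-- `x` is random for `μ`: for some representation `p` of `μ`, no Martin-Löf test for `μ` that is
enumerable in `p` covers `x`. -/
def IsRandom (μ : ProbabilityMeasure Cantor) (x : Cantor) : Prop :=
  ∃ p, Represents p μ ∧ ∀ U, IsTest p μ U → x ∉ ⋂ n, openOf (U n)

/-- `x` is an atom of `μ`. -/
def IsAtom (μ : ProbabilityMeasure Cantor) (x : Cantor) : Prop :=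
  0 < (μ : Measure Cantor) {x}

end Cantor

end

noncomputable section

/-! ### Mod 2 chains of vertex lists -/

namespace Chain

variable {E : Type*}

/-- Mod 2 chains of ordered simplices, a simplex being given by the list of its vertices. -/
abbrev Ch (E : Type*) := List E →₀ ZMod 2

/-- The chain consisting of one simplex. -/
abbrev simplex (l : List E) : Ch E := Finsupp.single l 1

/-- The linear map determined by its values on simplices. -/
def ext {M : Type*} [AddCommGroup M] [Module (ZMod 2) M] (f : List E → M) : Ch E →ₗ[ZMod 2] M :=
  Finsupp.linearCombination (ZMod 2) f

@[simp] lemma ext_single {M : Type*} [AddCommGroup M] [Module (ZMod 2) M] (f : List E → M)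
    (l : List E) : ext f (simplex l) = f l := by
  simp [ext]

/-- Chains all of whose simplices satisfy `P`. -/
def supp (P : List E → Prop) : Submodule (ZMod 2) (Ch E) :=
  Finsupp.supported (ZMod 2) (ZMod 2) {l | P l}

lemma single_mem_supp {P : List E → Prop} {l : List E} (h : P l) : simplex l ∈ supp P :=
  Finsupp.single_mem_supported _ _ h

lemma supp_eq_span (P : List E → Prop) :
    supp P = Submodule.span (ZMod 2) (simplex '' {l | P l}) :=
  Finsupp.supported_eq_span_single _ _

lemma supp_induction {P : List E → Prop} {M : Type*} [AddCommGroup M] [Module (ZMod 2) M]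
    (f : Ch E →ₗ[ZMod 2] M) (N : Submodule (ZMod 2) M) (h : ∀ l, P l → f (simplex l) ∈ N)
    {c : Ch E} (hc : c ∈ supp P) : f c ∈ N := by
  rw [supp_eq_span] at hc
  have : Submodule.span (ZMod 2) (simplex '' {l | P l}) ≤ N.comap f := by
    rw [Submodule.span_le]
    rintro _ ⟨l, hl, rfl⟩
    exact h l hl
  exact this hc

lemma supp_mono {P Q : List E → Prop} (h : ∀ l, P l → Q l) : supp P ≤ supp Q :=
  Finsupp.supported_mono h

lemma eqOn_supp {P : List E → Prop} {M : Type*} [AddCommGroup M] [Module (ZMod 2) M]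
    (f g : Ch E →ₗ[ZMod 2] M) (h : ∀ l, P l → f (simplex l) = g (simplex l))
    {c : Ch E} (hc : c ∈ supp P) : f c = g c := by
  have := supp_induction (f - g) ⊥ (fun l hl => by simp [h l hl]) hc
  simpa [sub_eq_zero] using this

/-- The cone with apex `v`. -/
def cone (v : E) : Ch E →ₗ[ZMod 2] Ch E := ext fun l => simplex (v :: l)

/-- The augmented boundary of a simplex. -/
def bdL : List E → Ch E
  | [] => 0
  | v :: l => simplex l + cone v (bdL l)

/-- The augmented boundary map. -/
def bd : Ch E →ₗ[ZMod 2] Ch E := ext bdL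

@[simp] lemma cone_single (v : E) (l : List E) : cone v (simplex l) = simplex (v :: l) := by
  simp [cone]

@[simp] lemma bd_single (l : List E) : bd (simplex l) = bdL l := by simp [bd]

lemma bd_cone (v : E) (c : Ch E) : bd (cone v c) = c + cone v (bd c) := by
  have hc : c ∈ supp (fun _ : List E => True) := by simp [supp]
  refine eqOn_supp (bd ∘ₗ cone v) (LinearMap.id + cone v ∘ₗ bd) (fun l _ => ?_) hc
  simp [bdL]

lemma add_self_eq_zero (c : Ch E) : c + c = 0 := by
  ext l
  exact CharTwo.add_self_eq_zero (c l)

lemma bd_bdL (l : List E) : bd (bdL l) = 0 := by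
  induction l with
  | nil => simp [bdL]
  | cons v l ih =>
    simp only [bdL, map_add, bd_single, bd_cone, ih, map_zero, add_zero]
    exact add_self_eq_zero _

/-- A face of `l` obtained by removing one vertex. -/
lemma bdL_mem_supp (l : List E) :
    bdL l ∈ supp (fun l' => List.Sublist l' l ∧ l'.length + 1 = l.length) := by
  induction l with
  | nil => simp [bdL]
  | cons v l ih =>
    refine Submodule.add_mem _ (single_mem_supp ⟨List.sublist_cons_self v l, rfl⟩) ?_
    refine supp_induction (cone v) _ (fun l' hl' => ?_) ih
    rw [cone_single]
    exact single_mem_supp ⟨hl'.1.cons_cons v, by simp [hl'.2]⟩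

/-- The number mod 2 of simplices of a chain, weighted by a function of the multiset of labels. -/
def count (ℓ : E → ℕ) (g : Multiset ℕ → ZMod 2) : Ch E →ₗ[ZMod 2] ZMod 2 :=
  ext fun l => g (l.map ℓ : List ℕ)

@[simp] lemma count_single (ℓ : E → ℕ) (g : Multiset ℕ → ZMod 2) (l : List E) :
    count ℓ g (simplex l) = g (l.map ℓ : List ℕ) := by
  simp [count]

lemma count_cone (ℓ : E → ℕ) (g : Multiset ℕ → ZMod 2) (v : E) (c : Ch E) :
    count ℓ g (cone v c) = count ℓ (fun s => g (ℓ v ::ₘ s)) c := by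
  have hc : c ∈ supp (fun _ : List E => True) := by simp [supp]
  refine eqOn_supp (count ℓ g ∘ₗ cone v) _ (fun l _ => ?_) hc
  simp

lemma count_bdL (ℓ : E → ℕ) (g : Multiset ℕ → ZMod 2) (l : List E) :
    count ℓ g (bdL l) =
      (((l.map ℓ : List ℕ) : Multiset ℕ).map
        fun a => g (((l.map ℓ : List ℕ) : Multiset ℕ).erase a)).sum := by
  induction l generalizing g with
  | nil => simp [bdL]
  | cons v l ih =>
    simp only [bdL, map_add, count_single, count_cone, ih]
    set s : Multiset ℕ := ((l.map ℓ : List ℕ) : Multiset ℕ) with hs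
    have : (((v :: l).map ℓ : List ℕ) : Multiset ℕ) = ℓ v ::ₘ s := by simp [hs]
    rw [this, Multiset.map_cons, Multiset.sum_cons, Multiset.erase_cons_head]
    congr 2
    refine Multiset.map_congr rfl fun a ha => ?_
    rw [Multiset.erase_cons_tail_of_mem ha]

/-- The indicator of the label multiset `{0, …, m - 1}`. -/
def fullLabels (m : ℕ) (s : Multiset ℕ) : ZMod 2 := if s = Multiset.range m then 1 else 0

lemma sum_map_ite_eq_count (a : ℕ) (s : Multiset ℕ) :
    (s.map fun b => if b = a then (1 : ZMod 2) else 0).sum = (s.count a : ℕ) := by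
  induction s using Multiset.induction with
  | empty => simp
  | cons b s ih =>
    rw [Multiset.map_cons, Multiset.sum_cons, ih, Multiset.count_cons]
    by_cases hb : b = a
    · subst hb; simp [add_comm]
    · simp [hb, Ne.symm hb]

lemma sum_fullLabels_erase (m : ℕ) (s : Multiset ℕ) (hs : ∀ a ∈ s, a < m + 1) :
    (s.map fun a => fullLabels m (s.erase a)).sum = fullLabels (m + 1) s := by
  by_cases h : ∃ a ∈ s, s.erase a = Multiset.range m
  · obtain ⟨a, ha, hr⟩ := h
    have hsa : s = a ::ₘ Multiset.range m := by rw [← hr, Multiset.cons_erase ha]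
    have key : ∀ b ∈ s, fullLabels m (s.erase b) = if b = a then 1 else 0 := by
      intro b hb
      unfold fullLabels
      congr 1
      apply propext
      constructor
      · intro h
        have : b ::ₘ Multiset.range m = a ::ₘ Multiset.range m := by
          rw [← hsa, ← h, Multiset.cons_erase hb]
        exact (Multiset.cons_inj_left _).1 this
      · rintro rfl; exact hr
    rw [Multiset.map_congr rfl key]
    have : (s.map fun b => if b = a then (1 : ZMod 2) else 0).sum = (s.count a : ℕ) := by
      exact sum_map_ite_eq_count a s
    rw [this, hsa, Multiset.count_cons_self]
    have ha' := hs a ha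
    rcases Nat.lt_succ_iff_lt_or_eq.1 ha' with h1 | rfl
    · have : Multiset.count a (Multiset.range m) = 1 :=
        Multiset.count_eq_one_of_mem (Multiset.nodup_range m) (Multiset.mem_range.2 h1)
      rw [this]
      have : fullLabels (m + 1) (a ::ₘ Multiset.range m) = 0 := by
        unfold fullLabels
        rw [if_neg]
        intro h
        rw [Multiset.range_succ, Multiset.cons_inj_left] at h
        omega
      rw [this]; rfl
    · have : Multiset.count a (Multiset.range a) = 0 := by simp
      rw [this]
      simp [fullLabels, Multiset.range_succ]
  · push Not at h
    rw [Multiset.map_congr rfl (f := fun a => fullLabels m (s.erase a))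
      (g := fun _ => (0 : ZMod 2)) (fun a ha => if_neg (h a ha))]
    simp only [Multiset.map_const', Multiset.sum_replicate, smul_zero]
    unfold fullLabels
    rw [if_neg]
    rintro rfl
    refine h m (by simp) ?_
    simp [Multiset.range_succ]

lemma count_fullLabels_bdL (ℓ : E → ℕ) (m : ℕ) (l : List E) (hl : ∀ v ∈ l, ℓ v < m + 1) :
    count ℓ (fullLabels m) (bdL l) = count ℓ (fullLabels (m + 1)) (simplex l) := by
  rw [count_bdL, sum_fullLabels_erase, count_single]
  simpa using hl

lemma count_fullLabels_bd (ℓ : E → ℕ) (m : ℕ) {c : Ch E}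
    (hc : c ∈ supp fun l => ∀ v ∈ l, ℓ v < m + 1) :
    count ℓ (fullLabels m) (bd c) = count ℓ (fullLabels (m + 1)) c :=
  eqOn_supp (count ℓ (fullLabels m) ∘ₗ bd) _ (fun l hl => by
    simpa using count_fullLabels_bdL ℓ m l hl) hc

/-! ### Barycentric subdivision -/

variable [NormedAddCommGroup E] [NormedSpace ℝ E]

/-- The barycenter of a list of points. -/
def bary (l : List E) : E := (l.length : ℝ)⁻¹ • l.sum

/-- Barycentric subdivision of simplices with `n` vertices. -/
def sdAux : ℕ → Ch E →ₗ[ZMod 2] Ch E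
  | 0 => LinearMap.id
  | n + 1 => ext fun l => cone (bary l) (sdAux n (bdL l))

/-- Barycentric subdivision. -/
def sd : Ch E →ₗ[ZMod 2] Ch E := ext fun l => sdAux l.length (simplex l)

lemma sd_eq_sdAux {n : ℕ} {c : Ch E} (hc : c ∈ supp fun l => l.length = n) :
    sd c = sdAux n c :=
  eqOn_supp _ _ (fun l hl => by subst hl; simp [sd]) hc

lemma sd_nil : sd (simplex ([] : List E)) = simplex [] := by simp [sd, sdAux]

lemma sd_single {l : List E} (hl : l ≠ []) :
    sd (simplex l) = cone (bary l) (sd (bdL l)) := by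
  obtain ⟨v, l, rfl⟩ := List.exists_cons_of_ne_nil hl
  rw [sd_eq_sdAux (n := l.length) (supp_mono (fun l' h => by simpa using h.2) (bdL_mem_supp _))]
  simp [sd, sdAux]

lemma bd_sd_single (l : List E) (hl : l ≠ []) : bd (sd (simplex l)) = sd (bdL l) := by
  generalize hn : l.length = n
  induction n generalizing l with
  | zero => exact absurd (List.length_eq_zero_iff.1 hn) hl
  | succ n ih =>
    rw [sd_single hl, bd_cone]
    rcases n with _ | n
    · obtain ⟨v, rfl⟩ := List.length_eq_one_iff.1 hn
      have : bd (simplex ([] : List E)) = 0 := by rw [bd_single]; rfl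
      simp only [bdL, map_zero, add_zero, sd_nil]
      rw [this, map_zero, add_zero]
    · have key : ∀ l' : List E, List.Sublist l' l ∧ l'.length + 1 = l.length →
          (bd ∘ₗ sd) (simplex l') = (sd ∘ₗ bd) (simplex l') := by
        intro l' hl'
        have hl'' : l'.length = n + 1 := by omega
        rw [LinearMap.comp_apply, LinearMap.comp_apply, bd_single]
        exact ih l' (by rintro rfl; simp at hl'') hl''
      have h2 := eqOn_supp (bd ∘ₗ sd) (sd ∘ₗ bd) key (bdL_mem_supp l)
      rw [LinearMap.comp_apply, LinearMap.comp_apply, bd_bdL, map_zero] at h2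
      rw [h2, map_zero, add_zero]

lemma bd_sd {c : Ch E} (hc : c ∈ supp fun l => l ≠ []) : bd (sd c) = sd (bd c) := by
  have key : ∀ l : List E, l ≠ [] → (bd ∘ₗ sd) (simplex l) = (sd ∘ₗ bd) (simplex l) := by
    intro l hl
    rw [LinearMap.comp_apply, LinearMap.comp_apply, bd_single]
    exact bd_sd_single l hl
  have h := eqOn_supp (bd ∘ₗ sd) (sd ∘ₗ bd) key hc
  rwa [LinearMap.comp_apply, LinearMap.comp_apply] at h

lemma bary_mem_convexHull {l : List E} (hl : l ≠ []) : bary l ∈ convexHull ℝ {v | v ∈ l} := by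
  have hpos : (0 : ℝ) < l.length := by
    exact_mod_cast List.length_pos_iff.2 hl
  have : bary l = ∑ i : Fin l.length, (l.length : ℝ)⁻¹ • l.get i := by
    rw [← Finset.smul_sum, bary]
    congr 1
    rw [← List.sum_ofFn]
    simp
  rw [this]
  refine (convex_convexHull ℝ _).sum_mem (fun _ _ => by positivity) ?_
    (fun i _ => subset_convexHull ℝ _ (List.get_mem l i))
  simp [hpos.ne']

/-- The list `l` has mesh at most `D`. -/
def Mesh (D : ℝ) (l : List E) : Prop := ∀ v ∈ l, ∀ w ∈ l, ‖v - w‖ ≤ D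

lemma norm_sum_map_sub_le {l : List E} {w : E} {D : ℝ} (h : ∀ v ∈ l, ‖v - w‖ ≤ D) :
    ‖l.sum - (l.length : ℝ) • w‖ ≤ l.length * D := by
  induction l with
  | nil => simp
  | cons v l ih =>
    have h1 := h v (by simp)
    have h2 := ih fun u hu => h u (by simp [hu])
    have : (v :: l).sum - ((v :: l).length : ℝ) • w = (v - w) + (l.sum - (l.length : ℝ) • w) := by
      simp [add_smul]; abel
    rw [this]
    refine (norm_add_le _ _).trans ?_
    simp; linarith

lemma norm_bary_sub_le {l : List E} {D : ℝ} (hD : Mesh D l) {w : E} (hw : w ∈ l) :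
    ‖bary l - w‖ ≤ (1 - (l.length : ℝ)⁻¹) * D := by
  obtain ⟨s, t, rfl⟩ := List.append_of_mem hw
  set l := s ++ w :: t with hl
  have hpos : (0 : ℝ) < l.length := by
    exact_mod_cast List.length_pos_of_mem hw
  have h0 : ‖(s ++ t).sum - ((s ++ t).length : ℝ) • w‖ ≤ (s ++ t).length * D := by
    refine norm_sum_map_sub_le fun v hv => hD v ?_ w hw
    simp only [hl, List.mem_append, List.mem_cons] at hv ⊢
    tauto
  have hlen : ((s ++ t).length : ℝ) = l.length - 1 := by
    simp [hl]; ring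
  have : bary l - w = (l.length : ℝ)⁻¹ • ((s ++ t).sum - ((s ++ t).length : ℝ) • w) := by
    rw [hlen, bary, smul_sub, smul_smul, mul_sub, inv_mul_cancel₀ hpos.ne', sub_smul, one_smul,
      mul_one]
    have : l.sum = (s ++ t).sum + w := by simp [hl]; abel
    rw [this, smul_add]; abel
  rw [this, norm_smul, Real.norm_of_nonneg (by positivity)]
  calc (l.length : ℝ)⁻¹ * ‖(s ++ t).sum - ((s ++ t).length : ℝ) • w‖
      ≤ (l.length : ℝ)⁻¹ * ((s ++ t).length * D) := by gcongr
    _ = (1 - (l.length : ℝ)⁻¹) * D := by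
      rw [hlen]; field_simp

lemma sd_single_mem_supp {K : ℕ} {D : ℝ} (l : List E) (hK : l.length ≤ K) (hD : Mesh D l) :
    sd (simplex l) ∈ supp fun l' => l'.length = l.length ∧
      (∀ v ∈ l', v ∈ convexHull ℝ {v | v ∈ l}) ∧ Mesh ((1 - (K : ℝ)⁻¹) * D) l' := by
  generalize hn : l.length = n
  induction n generalizing l with
  | zero =>
    rw [List.length_eq_zero_iff.1 hn, sd_nil]
    exact single_mem_supp ⟨rfl, by simp, by simp [Mesh]⟩
  | succ n ih =>
    have hl : l ≠ [] := by rintro rfl; simp at hn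
    rw [sd_single hl]
    have h1 : sd (bdL l) ∈ supp fun l' => l'.length = n ∧
      (∀ v ∈ l', v ∈ convexHull ℝ {v | v ∈ l}) ∧ Mesh ((1 - (K : ℝ)⁻¹) * D) l' := by
      refine supp_induction sd _ (fun l' hl' => ?_) (bdL_mem_supp l)
      have hm : Mesh D l' := fun v hv w hw => hD v (hl'.1.subset hv) w (hl'.1.subset hw)
      have := ih l' (by omega) hm (by omega)
      refine supp_mono ?_ this
      rintro l'' ⟨a, b, c⟩
      exact ⟨a, fun v hv => convexHull_mono (fun u hu => hl'.1.subset hu) (b v hv), c⟩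
    refine supp_induction (cone (bary l)) _ (fun l' hl' => ?_) h1
    rw [cone_single]
    obtain ⟨a, b, c⟩ := hl'
    have hD0 : 0 ≤ D := by
      obtain ⟨v, hv⟩ := List.exists_mem_of_ne_nil l hl
      exact (norm_nonneg _).trans (hD v hv v hv)
    have hlpos : (0 : ℝ) < l.length := by exact_mod_cast List.length_pos_iff.2 hl
    have hKl : (l.length : ℝ) ≤ K := by exact_mod_cast hK
    have hball : ∀ v ∈ l', ‖bary l - v‖ ≤ (1 - (K : ℝ)⁻¹) * D := by
      intro v hv
      have hsub : convexHull ℝ {v | v ∈ l} ⊆ Metric.closedBall (bary l) ((1 - (K : ℝ)⁻¹) * D) := by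
        refine convexHull_min (fun w hw => ?_) (convex_closedBall _ _)
        rw [Metric.mem_closedBall, dist_comm, dist_eq_norm]
        refine (norm_bary_sub_le hD hw).trans ?_
        gcongr
      have := hsub (b v hv)
      rwa [Metric.mem_closedBall, dist_comm, dist_eq_norm] at this
    have hnn : 0 ≤ (1 - (K : ℝ)⁻¹) * D := by
      refine mul_nonneg ?_ hD0
      have : (1 : ℝ) ≤ K := by
        have : 1 ≤ K := by omega
        exact_mod_cast this
      have := inv_le_one_of_one_le₀ this
      linarith
    refine single_mem_supp ⟨by simp [a], ?_, ?_⟩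
    · intro v hv
      rcases List.mem_cons.1 hv with rfl | hv
      · exact bary_mem_convexHull hl
      · exact b v hv
    · intro v hv w hw
      rcases List.mem_cons.1 hv with rfl | hv <;> rcases List.mem_cons.1 hw with rfl | hw
      · simpa using hnn
      · exact hball w hw
      · rw [norm_sub_rev]; exact hball v hv
      · exact c v hv w hw

/-- The `k`-fold barycentric subdivision. -/
def sdPow : ℕ → Ch E →ₗ[ZMod 2] Ch E
  | 0 => LinearMap.id
  | k + 1 => sd ∘ₗ sdPow k

lemma sdPow_nil (k : ℕ) : sdPow k (simplex ([] : List E)) = simplex [] := by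
  induction k with
  | zero => rfl
  | succ k ih => rw [sdPow, LinearMap.comp_apply, ih, sd_nil]

lemma sdPow_single_mem_supp {K : ℕ} {D : ℝ} (k : ℕ) (l : List E) (hK : l.length ≤ K)
    (hD : Mesh D l) :
    sdPow k (simplex l) ∈ supp fun l' => l'.length = l.length ∧
      (∀ v ∈ l', v ∈ convexHull ℝ {v | v ∈ l}) ∧ Mesh ((1 - (K : ℝ)⁻¹) ^ k * D) l' := by
  induction k with
  | zero =>
    exact single_mem_supp ⟨rfl, fun v hv => subset_convexHull ℝ _ hv, by simpa using hD⟩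
  | succ k ih =>
    rw [sdPow, LinearMap.comp_apply]
    refine supp_induction sd _ (fun l' hl' => ?_) ih
    obtain ⟨a, b, c⟩ := hl'
    refine supp_mono ?_ (sd_single_mem_supp l' (a ▸ hK) c)
    rintro l'' ⟨a', b', c'⟩
    refine ⟨a'.trans a, fun v hv => ?_, ?_⟩
    · exact convexHull_min b (convex_convexHull ℝ _) (b' v hv)
    · rwa [pow_succ', mul_assoc]

lemma exists_mesh {E : Type*} [NormedAddCommGroup E] (l : List E) : ∃ D, Mesh D l := by
  refine ⟨2 * (l.map fun v => ‖v‖).sum, fun v hv w hw => ?_⟩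
  have h : ∀ u ∈ l, ‖u‖ ≤ (l.map fun v => ‖v‖).sum := fun u hu =>
    List.single_le_sum (by simp) _ (List.mem_map_of_mem hu)
  linarith [norm_sub_le v w, h v hv, h w hw]

lemma sdPow_single_mem_supp' (k : ℕ) (l : List E) :
    sdPow k (simplex l) ∈ supp fun l' => l'.length = l.length ∧
      (∀ v ∈ l', v ∈ convexHull ℝ {v | v ∈ l}) := by
  obtain ⟨D, hD⟩ := exists_mesh l
  exact supp_mono (fun l' h => ⟨h.1, h.2.1⟩) (sdPow_single_mem_supp k l le_rfl hD)

lemma bd_sdPow_single (k : ℕ) {l : List E} (hl : l ≠ []) :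
    bd (sdPow k (simplex l)) = sdPow k (bdL l) := by
  induction k with
  | zero => simp [sdPow]
  | succ k ih =>
    rw [sdPow, LinearMap.comp_apply, LinearMap.comp_apply, bd_sd, ih]
    refine supp_mono ?_ (sdPow_single_mem_supp' k l)
    rintro l' ⟨h, -⟩ rfl
    exact hl (List.length_eq_zero_iff.1 h.symm)

end Chain

/-! ### The Knaster–Kuratowski–Mazurkiewicz lemma -/

namespace KKM

open Chain

variable {n m : ℕ}

/-- The `i`-th vertex of the standard simplex. -/
def vert (n i : ℕ) : Fin n → ℝ := fun j => if (j : ℕ) = i then 1 else 0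

/-- The list of the first `m` vertices, in descending order. -/
def verts (n : ℕ) : ℕ → List (Fin n → ℝ)
  | 0 => []
  | m + 1 => vert n m :: verts n m

lemma mem_verts {v : Fin n → ℝ} : v ∈ verts n m ↔ ∃ i < m, v = vert n i := by
  induction m with
  | zero => simp [verts]
  | succ m ih =>
    simp only [verts, List.mem_cons, ih, Nat.lt_succ_iff_lt_or_eq]
    aesop

lemma verts_length (m : ℕ) : (verts n m).length = m := by
  induction m with
  | zero => rfl
  | succ m ih => simp [verts, ih]

/-- The face of the standard simplex spanned by the vertices in `I`. -/
def face (n : ℕ) (I : Set ℕ) : Set (Fin n → ℝ) :=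
  {a | a ∈ stdSimplex ℝ (Fin n) ∧ ∀ j : Fin n, (j : ℕ) ∉ I → a j = 0}

lemma convex_face (I : Set ℕ) : Convex ℝ (face n I) := by
  intro a ha b hb s t hs ht hst
  refine ⟨convex_stdSimplex ℝ _ ha.1 hb.1 hs ht hst, fun j hj => ?_⟩
  simp [ha.2 j hj, hb.2 j hj]

lemma vert_mem_face {I : Set ℕ} {i : ℕ} (hi : i ∈ I) (hin : i < n) : vert n i ∈ face n I := by
  refine ⟨⟨fun j => by unfold vert; split_ifs <;> simp, ?_⟩, fun j hj => ?_⟩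
  · rw [Finset.sum_eq_single (⟨i, hin⟩ : Fin n)]
    · simp [vert]
    · intro j _ hj
      simp only [vert]
      rw [if_neg]
      rintro rfl
      exact hj rfl
    · simp
  · simp only [vert]
    rw [if_neg]
    rintro rfl
    exact hj hi

/-- Every facet of `verts n m` misses a vertex. -/
lemma bdL_verts_mem_supp (hn : m ≤ n) :
    bdL (verts n m) ∈ supp fun l => ∃ i < m, ∀ v ∈ l, ∃ j < m, j ≠ i ∧ v = vert n j := by
  induction m with
  | zero => simp [verts, bdL]
  | succ m ih =>
    refine Submodule.add_mem _ (single_mem_supp ⟨m, by omega, fun v hv => ?_⟩) ?_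
    · obtain ⟨i, hi, rfl⟩ := mem_verts.1 hv
      exact ⟨i, by omega, by omega, rfl⟩
    · refine supp_induction (cone _) _ (fun l hl => ?_) (ih (by omega))
      rw [cone_single]
      obtain ⟨i, hi, h⟩ := hl
      refine single_mem_supp ⟨i, by omega, fun v hv => ?_⟩
      rcases List.mem_cons.1 hv with rfl | hv
      · exact ⟨m, by omega, by omega, rfl⟩
      · obtain ⟨j, hj, hji, rfl⟩ := h v hv
        exact ⟨j, by omega, hji, rfl⟩

/-- Sperner's lemma for the iterated barycentric subdivision. -/
lemma count_sdPow_verts (ℓ : (Fin n → ℝ) → ℕ)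
    (hℓ : ∀ I : Set ℕ, ∀ a ∈ face n I, ℓ a ∈ I) (k : ℕ) (hm : m ≤ n) :
    count ℓ (fullLabels m) (sdPow k (simplex (verts n m))) = 1 := by
  induction m with
  | zero => simp [verts, sdPow_nil, fullLabels]
  | succ m ih =>
    have hhull : ∀ (l : List (Fin n → ℝ)) (I : Set ℕ),
        (∀ v ∈ l, ∃ j ∈ I, j < n ∧ v = vert n j) →
        sdPow k (simplex l) ∈ supp fun l' => ∀ v ∈ l', ℓ v ∈ I := by
      intro l I h
      refine supp_mono (fun l' hl' v hv => hℓ I v ?_) (sdPow_single_mem_supp' k l)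
      refine convexHull_min (fun w hw => ?_) (convex_face I) (hl'.2 v hv)
      obtain ⟨j, hj, hjn, rfl⟩ := h w hw
      exact vert_mem_face hj hjn
    rw [← count_fullLabels_bd, bd_sdPow_single k (by simp [verts])]
    · rw [verts, bdL, map_add, map_add, ih (by omega)]
      have : count ℓ (fullLabels m) (sdPow k (cone (vert n m) (bdL (verts n m)))) = 0 := by
        have key := supp_induction (count ℓ (fullLabels m) ∘ₗ sdPow k ∘ₗ cone (vert n m)) ⊥
          (fun l hl => ?_) (bdL_verts_mem_supp (n := n) (m := m) (by omega))
        · simpa using key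
        obtain ⟨i, hi, h⟩ := hl
        rw [LinearMap.comp_apply, LinearMap.comp_apply, cone_single]
        refine supp_induction (count ℓ (fullLabels m)) ⊥ (fun l' hl' => ?_)
          (hhull _ {i}ᶜ fun v hv => ?_)
        · rw [count_single, Submodule.mem_bot, fullLabels, if_neg]
          intro hr
          have : i ∈ (((l'.map ℓ : List ℕ)) : Multiset ℕ) := by rw [hr]; simpa using hi
          simp only [Multiset.mem_coe, List.mem_map] at this
          obtain ⟨v, hv, rfl⟩ := this
          exact hl' v hv rfl
        · rcases List.mem_cons.1 hv with rfl | hv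
          · exact ⟨m, by simp; omega, by omega, rfl⟩
          · obtain ⟨j, hj, hji, rfl⟩ := h v hv
            exact ⟨j, by simpa using hji, by omega, rfl⟩
      rw [this, add_zero]
    · refine supp_mono (fun l h => h) (hhull _ {j | j < m + 1} fun v hv => ?_)
      obtain ⟨j, hj, rfl⟩ := mem_verts.1 hv
      exact ⟨j, hj, by omega, rfl⟩

lemma exists_small_full (ℓ : (Fin n → ℝ) → ℕ)
    (hℓ : ∀ I : Set ℕ, ∀ a ∈ face n I, ℓ a ∈ I) {ε : ℝ} (hε : 0 < ε) :
    ∃ v : Fin n → (Fin n → ℝ), (∀ i, v i ∈ stdSimplex ℝ (Fin n)) ∧ (∀ i, ℓ (v i) = i) ∧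
      ∀ i j, ‖v i - v j‖ ≤ ε := by
  rcases Nat.eq_zero_or_pos n with rfl | hn
  · exact ⟨fun i => i.elim0, fun i => i.elim0, fun i => i.elim0, fun i => i.elim0⟩
  obtain ⟨D, hD⟩ := exists_mesh (verts n n)
  have hr0 : (0 : ℝ) ≤ 1 - (n : ℝ)⁻¹ := by
    have : (1 : ℝ) ≤ n := by exact_mod_cast hn
    linarith [inv_le_one_of_one_le₀ this]
  have hr1 : 1 - (n : ℝ)⁻¹ < 1 := by
    have : (0 : ℝ) < n := by exact_mod_cast hn
    linarith [inv_pos.2 this]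
  have hlim : Filter.Tendsto (fun k => (1 - (n : ℝ)⁻¹) ^ k * D) Filter.atTop (nhds 0) := by
    simpa using (tendsto_pow_atTop_nhds_zero_of_lt_one hr0 hr1).mul_const D
  obtain ⟨k, hk⟩ := (hlim.eventually (gt_mem_nhds hε)).exists
  have h1 := count_sdPow_verts ℓ hℓ k le_rfl
  have h2 := sdPow_single_mem_supp k (verts n n) (verts_length n).le hD
  have : ∃ l : List (Fin n → ℝ), (∀ v ∈ l, v ∈ convexHull ℝ {v | v ∈ verts n n}) ∧
      Mesh ((1 - (n : ℝ)⁻¹) ^ k * D) l ∧ ((l.map ℓ : List ℕ) : Multiset ℕ) = Multiset.range n := by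
    by_contra! hcon
    have := supp_induction (count ℓ (fullLabels n)) ⊥ (fun l hl => ?_) h2
    · rw [h1] at this
      simp at this
    · rw [count_single, Submodule.mem_bot, fullLabels, if_neg (hcon l hl.2.1 hl.2.2)]
  obtain ⟨l, hl1, hl2, hl3⟩ := this
  have : ∀ i : Fin n, ∃ v ∈ l, ℓ v = i := by
    intro i
    have : (i : ℕ) ∈ ((l.map ℓ : List ℕ) : Multiset ℕ) := by rw [hl3]; simp
    simpa using this
  choose v hv hvi using this
  refine ⟨v, fun i => ?_, hvi, fun i j => (hl2 _ (hv i) _ (hv j)).trans hk.le⟩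
  have : convexHull ℝ {v | v ∈ verts n n} ⊆ face n Set.univ := by
    refine convexHull_min (fun w hw => ?_) (convex_face _)
    obtain ⟨j, hj, rfl⟩ := mem_verts.1 hw
    exact vert_mem_face trivial hj
  exact (this (hl1 _ (hv i))).1

/-- The Knaster–Kuratowski–Mazurkiewicz lemma: if closed sets `F i` are such that every point `a`
of the standard simplex lies in some `F i` with `a i > 0`, they have a common point. -/
theorem exists_common_point (hn : 0 < n) (F : Fin n → Set (Fin n → ℝ)) (hF : ∀ i, IsClosed (F i))
    (hcov : ∀ a ∈ stdSimplex ℝ (Fin n), ∃ i, 0 < a i ∧ a ∈ F i) :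
    ∃ a ∈ stdSimplex ℝ (Fin n), ∀ i, a ∈ F i := by
  classical
  have : Nonempty (Fin n) := ⟨⟨0, hn⟩⟩
  choose! lab hlab using hcov
  set ℓ : (Fin n → ℝ) → ℕ := fun a => if a ∈ stdSimplex ℝ (Fin n) then lab a else 0 with hℓdef
  have hℓ : ∀ I : Set ℕ, ∀ a ∈ face n I, ℓ a ∈ I := by
    intro I a ha
    simp only [hℓdef, if_pos ha.1]
    by_contra h
    exact (hlab a ha.1).1.ne' (ha.2 _ h)
  have hmem : ∀ ε : ℝ, 0 < ε → ∃ v : Fin n → (Fin n → ℝ),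
      (∀ i, v i ∈ stdSimplex ℝ (Fin n)) ∧ (∀ i, v i ∈ F i) ∧ ∀ i j, ‖v i - v j‖ ≤ ε := by
    intro ε hε
    obtain ⟨v, h1, h2, h3⟩ := exists_small_full ℓ hℓ hε
    refine ⟨v, h1, fun i => ?_, h3⟩
    have := h2 i
    simp only [hℓdef, if_pos (h1 i)] at this
    have h4 := (hlab _ (h1 i)).2
    rwa [Fin.ext this] at h4
  set f : (Fin n → ℝ) → ℝ := fun a => ∑ i, Metric.infDist a (F i) with hf
  have hfc : Continuous f := by
    refine continuous_finsetSum _ fun i _ => Metric.continuous_infDist_pt _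
  have hne : (stdSimplex ℝ (Fin n)).Nonempty := by
    obtain ⟨v, h1, -⟩ := hmem 1 one_pos
    exact ⟨v ⟨0, hn⟩, h1 _⟩
  obtain ⟨a, ha, hmin⟩ := (isCompact_stdSimplex ℝ (Fin n)).exists_isMinOn hne hfc.continuousOn
  refine ⟨a, ha, ?_⟩
  have hfa : f a ≤ 0 := by
    refine le_of_forall_pos_le_add fun ε hε => ?_
    have hn' : (0 : ℝ) < n := by exact_mod_cast hn
    obtain ⟨v, h1, h2, h3⟩ := hmem (ε / n) (by positivity)
    calc f a ≤ f (v ⟨0, hn⟩) := hmin (h1 _)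
      _ ≤ ∑ i : Fin n, ε / n := Finset.sum_le_sum fun i _ => by
        refine (Metric.infDist_le_dist_of_mem (h2 i)).trans ?_
        rw [dist_eq_norm]
        exact h3 _ _
      _ = 0 + ε := by simp; field_simp
  have hz : ∀ i, Metric.infDist a (F i) = 0 := by
    intro i
    refine le_antisymm ?_ Metric.infDist_nonneg
    refine le_trans ?_ hfa
    exact Finset.single_le_sum (f := fun i => Metric.infDist a (F i))
      (fun i _ => Metric.infDist_nonneg) (Finset.mem_univ i)
  intro i
  obtain ⟨v, -, h2, -⟩ := hmem 1 one_pos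
  exact ((hF i).mem_iff_infDist_zero ⟨_, h2 i⟩).2 (hz i)

end KKM

namespace Cantor

/-! ### Initial segments and compactness -/

@[simp] lemma length_restrict (x : Cantor) (n : ℕ) : (x.restrict n).length = n := by
  simp [restrict]

lemma restrict_succ (x : Cantor) (n : ℕ) : x.restrict (n + 1) = x.restrict n ++ [x n] := by
  simp [restrict, List.range_succ]

lemma take_restrict (x : Cantor) {m n : ℕ} (h : m ≤ n) : (x.restrict n).take m = x.restrict m := by
  simp [restrict, ← List.map_take, List.take_range, h]

lemma restrict_prefix (x : Cantor) {m n : ℕ} (h : m ≤ n) : x.restrict m <+: x.restrict n := by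
  rw [← take_restrict x h]; exact List.take_prefix _ _

lemma restrict_getElem? (x : Cantor) {n i : ℕ} (h : i < n) : (x.restrict n)[i]? = some (x i) := by
  simp [restrict, h]

lemma restrict_getD (x : Cantor) {n i : ℕ} (h : i < n) : (x.restrict n).getD i false = x i := by
  simp [restrict, h]

lemma restrict_eq_iff {x y : Cantor} {n : ℕ} : x.restrict n = y.restrict n ↔ ∀ i < n, x i = y i := by
  simp [restrict]

lemma restrict_eq_iff_getD {x : Cantor} {σ : List Bool} :
    x.restrict σ.length = σ ↔ ∀ i < σ.length, x i = σ.getD i false := by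
  constructor
  · intro h i hi
    rw [← restrict_getD x hi, h]
  · intro h
    refine List.ext_getElem (by simp) fun i h1 h2 => ?_
    have := h i h2
    simp only [restrict, List.getElem_map, List.getElem_range, this]
    simp [h2]

lemma padZero_restrict (σ : List Bool) : (padZero σ).restrict σ.length = σ :=
  restrict_eq_iff_getD.2 fun _ _ => rfl

lemma restrict_mem_cyl (x : Cantor) (n : ℕ) : x ∈ cyl (x.restrict n) := by
  simp [cyl]

lemma prefix_of_mem_cyl {x : Cantor} {σ : List Bool} {n : ℕ} (h : x ∈ cyl σ) (hn : σ.length ≤ n) :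
    σ <+: x.restrict n := by
  rw [← (show x.restrict σ.length = σ from h)]
  exact restrict_prefix x hn

lemma mem_cyl_of_prefix {x : Cantor} {σ : List Bool} {n : ℕ} (h : σ <+: x.restrict n) :
    x ∈ cyl σ := by
  have hl : σ.length ≤ n := by simpa using h.length_le
  have := List.prefix_iff_eq_take.1 h
  rw [take_restrict x hl] at this
  exact this.symm

lemma isClopen_cyl (σ : List Bool) : IsClopen (cyl σ) := by
  have : cyl σ = ⋂ i ∈ Finset.range σ.length, {x : Cantor | x i = σ.getD i false} := by
    ext x; simp [cyl, restrict_eq_iff_getD]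
  rw [this]
  refine isClopen_biInter_finset fun i _ => ?_
  exact (isClopen_discrete {σ.getD i false}).preimage (continuous_apply i)

lemma isClopen_restrict (s : ℕ) (G : List Bool → Prop) : IsClopen {p : Cantor | G (p.restrict s)} := by
  let e : Cantor → (Fin s → Bool) := fun p i => p i
  have he : Continuous e := continuous_pi fun i => continuous_apply _
  have : {p : Cantor | G (p.restrict s)} = e ⁻¹' {v | G (List.ofFn v)} := by
    ext p
    have : p.restrict s = List.ofFn (e p) := by
      refine List.ext_getElem (by simp) fun i h1 h2 => ?_
      simp [restrict, e]
    simp [this]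
  rw [this]
  exact (isClopen_discrete _).preimage he

lemma isClosed_forall_restrict (G : List Bool → Prop) : IsClosed {p : Cantor | ∀ s, G (p.restrict s)} := by
  rw [Set.ofPred_forall]
  exact isClosed_iInter fun s => (isClopen_restrict s G).1

/-- Compactness of Cantor space: a bar is uniformly bounded. -/
lemma exists_uniform_bound {G : ℕ → Cantor → Prop} (hG : ∀ s, IsOpen {p | G s p})
    (h : ∀ p, ∃ s, G s p) : ∃ n, ∀ p, ∃ s ≤ n, G s p := by
  obtain ⟨t, ht⟩ := isCompact_univ.elim_finite_subcover (fun s => {p : Cantor | G s p}) hG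
    (fun p _ => Set.mem_iUnion.2 (h p))
  refine ⟨t.sup id, fun p => ?_⟩
  obtain ⟨s, hs, hp⟩ := Set.mem_iUnion₂.1 (ht (Set.mem_univ p))
  exact ⟨s, Finset.le_sup (f := id) hs, hp⟩

lemma exists_uniform_restrict {G : List Bool → Prop} (h : ∀ p : Cantor, ∃ s, G (p.restrict s)) :
    ∃ n, ∀ p : Cantor, ∃ s ≤ n, G (p.restrict s) :=
  exists_uniform_bound (G := fun s p => G (p.restrict s)) (fun s => (isClopen_restrict s G).2) h

/-- The list of all binary strings of length `n`. -/
def allStrings : ℕ → List (List Bool)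
  | 0 => [[]]
  | n + 1 => (allStrings n).flatMap fun σ => [σ ++ [false], σ ++ [true]]

lemma mem_allStrings {n : ℕ} {σ : List Bool} : σ ∈ allStrings n ↔ σ.length = n := by
  induction n generalizing σ with
  | zero => simp [allStrings]
  | succ n ih =>
    simp only [allStrings, List.mem_flatMap, ih, List.mem_cons, List.not_mem_nil, or_false]
    constructor
    · rintro ⟨τ, rfl, rfl | rfl⟩ <;> simp
    · intro h
      have hne : σ ≠ [] := by rintro rfl; simp at h
      refine ⟨σ.dropLast, by simp [h], ?_⟩
      rcases hb : σ.getLast hne with _ | _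
      · left; rw [← hb, List.dropLast_append_getLast]
      · right; rw [← hb, List.dropLast_append_getLast]

lemma primrec_allStrings : Primrec allStrings := by
  have : Primrec (fun n : ℕ => (Nat.rec [[]] (fun _ L => L.flatMap fun σ : List Bool =>
      [σ ++ [false], σ ++ [true]]) n : List (List Bool))) := by
    refine Primrec.nat_rec₁ _ ?_
    refine Primrec.list_flatMap Primrec.snd ?_
    refine Primrec.list_cons.comp (Primrec.list_concat.comp Primrec.snd (Primrec.const false))
      (Primrec.list_cons.comp (Primrec.list_concat.comp Primrec.snd (Primrec.const true))
        (Primrec.const []))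
  refine this.of_eq fun n => ?_
  induction n with
  | zero => rfl
  | succ n ih => simp only [allStrings]; rw [← ih]

end Cantor

/-! ### Primitive recursive predicates and recursive enumerability -/

section Sig

variable {α β : Type*} [Primcodable α] [Primcodable β]

lemma PrimrecPred.ball {R : α × β → Prop} {L : α → List β} (hR : PrimrecPred R) (hL : Primrec L) :
    PrimrecPred fun a => ∀ b ∈ L a, R (a, b) := by
  have : PrimrecRel fun (b : β) (a : α) => R (a, b) := hR.comp (Primrec.pair Primrec.snd Primrec.fst)
  exact this.forall_mem_list.comp hL Primrec.id

lemma PrimrecPred.bex {R : α × β → Prop} {L : α → List β} (hR : PrimrecPred R) (hL : Primrec L) :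
    PrimrecPred fun a => ∃ b ∈ L a, R (a, b) := by
  have : PrimrecRel fun (b : β) (a : α) => R (a, b) := hR.comp (Primrec.pair Primrec.snd Primrec.fst)
  exact this.exists_mem_list.comp hL Primrec.id

lemma PrimrecPred.ball_lt {R : α × ℕ → Prop} {f : α → ℕ} (hR : PrimrecPred R) (hf : Primrec f) :
    PrimrecPred fun a => ∀ b < f a, R (a, b) :=
  (hR.ball (Primrec.list_range.comp hf)).of_eq fun a => by simp

lemma PrimrecPred.bex_lt {R : α × ℕ → Prop} {f : α → ℕ} (hR : PrimrecPred R) (hf : Primrec f) :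
    PrimrecPred fun a => ∃ b < f a, R (a, b) :=
  (hR.bex (Primrec.list_range.comp hf)).of_eq fun a => by simp

/-- `A` is the projection of a primitive recursive predicate. -/
def Sig (A : α → Prop) : Prop :=
  ∃ h : α × ℕ → Prop, PrimrecPred h ∧ ∀ a, A a ↔ ∃ k, h (a, k)

lemma Sig.of_eq {A B : α → Prop} (hA : Sig A) (h : ∀ a, A a ↔ B a) : Sig B :=
  (funext fun a => propext (h a) : A = B) ▸ hA

lemma PrimrecPred.sig {A : α → Prop} (hA : PrimrecPred A) : Sig A :=
  ⟨fun a => A a.1, hA.comp Primrec.fst, fun a => by simp⟩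

lemma Sig.comp {A : β → Prop} (hA : Sig A) {f : α → β} (hf : Primrec f) : Sig fun a => A (f a) := by
  obtain ⟨h, hh, H⟩ := hA
  exact ⟨fun a => h (f a.1, a.2), hh.comp ((hf.comp Primrec.fst).pair Primrec.snd),
    fun a => H (f a)⟩

lemma Sig.ex {A : α × β → Prop} (hA : Sig A) : Sig fun a => ∃ b, A (a, b) := by
  obtain ⟨h, hh, H⟩ := hA
  refine ⟨fun a => ∃ b ∈ (Encodable.decode (α := β) a.2.unpair.1).toList, h ((a.1, b), a.2.unpair.2),
    ?_, fun a => ?_⟩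
  · refine PrimrecPred.bex (R := fun c : (α × ℕ) × β => h ((c.1.1, c.2), c.1.2.unpair.2)) ?_ ?_
    · refine hh.comp ?_
      refine ((Primrec.fst.comp Primrec.fst).pair Primrec.snd).pair ?_
      exact Primrec.snd.comp (Primrec.unpair.comp (Primrec.snd.comp Primrec.fst))
    · exact Primrec.optionToList.comp
        (Primrec.decode.comp (Primrec.fst.comp (Primrec.unpair.comp Primrec.snd)))
  · simp only [H]
    constructor
    · rintro ⟨b, k, hk⟩
      exact ⟨Nat.pair (Encodable.encode b) k, b, by simp, by simpa using hk⟩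
    · rintro ⟨k, b, -, hk⟩
      exact ⟨b, _, hk⟩

lemma Sig.and {A B : α → Prop} (hA : Sig A) (hB : Sig B) : Sig fun a => A a ∧ B a := by
  obtain ⟨h, hh, H⟩ := hA
  obtain ⟨h', hh', H'⟩ := hB
  refine ⟨fun a => h (a.1, a.2.unpair.1) ∧ h' (a.1, a.2.unpair.2), ?_, fun a => ?_⟩
  · refine PrimrecPred.and (hh.comp ?_) (hh'.comp ?_)
    · exact Primrec.fst.pair (Primrec.fst.comp (Primrec.unpair.comp Primrec.snd))
    · exact Primrec.fst.pair (Primrec.snd.comp (Primrec.unpair.comp Primrec.snd))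
  · simp only [H, H']
    constructor
    · rintro ⟨⟨k, hk⟩, l, hl⟩
      exact ⟨Nat.pair k l, by simpa using hk, by simpa using hl⟩
    · rintro ⟨k, h1, h2⟩
      exact ⟨⟨_, h1⟩, _, h2⟩

lemma Sig.or {A B : α → Prop} (hA : Sig A) (hB : Sig B) : Sig fun a => A a ∨ B a := by
  obtain ⟨h, hh, H⟩ := hA
  obtain ⟨h', hh', H'⟩ := hB
  exact ⟨fun a => h a ∨ h' a, hh.or hh', fun a => by simp only [H, H', exists_or]⟩

lemma Sig.ball {A : α × β → Prop} {L : α → List β} (hA : Sig A) (hL : Primrec L) :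
    Sig fun a => ∀ b ∈ L a, A (a, b) := by
  obtain ⟨h, hh, H⟩ := hA
  refine ⟨fun a => ∀ b ∈ L a.1, ∃ k < a.2, h ((a.1, b), k), ?_, fun a => ?_⟩
  · refine PrimrecPred.ball (R := fun c : (α × ℕ) × β => ∃ k < c.1.2, h ((c.1.1, c.2), k)) ?_
      (hL.comp Primrec.fst)
    refine PrimrecPred.bex_lt (R := fun c : ((α × ℕ) × β) × ℕ => h ((c.1.1.1, c.1.2), c.2)) ?_
      (Primrec.snd.comp Primrec.fst)
    refine hh.comp ?_
    exact ((Primrec.fst.comp (Primrec.fst.comp Primrec.fst)).pair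
      (Primrec.snd.comp Primrec.fst)).pair Primrec.snd
  · simp only [H]
    constructor
    · intro hL
      choose! k hk using hL
      refine ⟨((L a).map k).sum + 1, fun b hb => ⟨k b, ?_, hk b hb⟩⟩
      exact Nat.lt_succ_of_le (List.single_le_sum (by simp) _ (List.mem_map_of_mem hb))
    · rintro ⟨K, hK⟩ b hb
      obtain ⟨k, -, hk⟩ := hK b hb
      exact ⟨k, hk⟩

/-- Effective compactness of Cantor space. -/
lemma Sig.forall_cantor {A : α × List Bool → Prop} (hA : Sig A) :
    Sig fun a => ∀ p : Cantor, ∃ s, A (a, p.restrict s) := by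
  have h1 : Sig fun c : (α × ℕ) × List Bool => ∃ s : ℕ, A (c.1.1, c.2.take s) := by
    refine Sig.ex (A := fun c : ((α × ℕ) × List Bool) × ℕ => A (c.1.1.1, c.1.2.take c.2))
      (hA.comp ?_)
    exact (Primrec.fst.comp (Primrec.fst.comp Primrec.fst)).pair
      (Primrec.list_take.comp Primrec.snd (Primrec.snd.comp Primrec.fst))
  have h2 := (h1.ball (L := fun c : α × ℕ => Cantor.allStrings c.2)
    (Cantor.primrec_allStrings.comp Primrec.snd)).ex
  refine h2.of_eq fun a => ?_
  constructor
  · rintro ⟨n, hn⟩ p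
    obtain ⟨s, hs⟩ := hn (p.restrict n) (Cantor.mem_allStrings.2 (by simp))
    rcases le_total s n with h | h
    · exact ⟨s, by simpa [Cantor.take_restrict p h] using hs⟩
    · exact ⟨n, by simpa [List.take_of_length_le, h] using hs⟩
  · intro h
    obtain ⟨n, hn⟩ := Cantor.exists_uniform_restrict (G := fun ρ => A (a, ρ)) h
    refine ⟨n, fun ρ hρ => ?_⟩
    obtain ⟨s, hs, hA⟩ := hn (Cantor.padZero ρ)
    refine ⟨s, ?_⟩
    have hl : ρ.length = n := Cantor.mem_allStrings.1 hρ
    have : ρ = (Cantor.padZero ρ).restrict n := by rw [← hl, Cantor.padZero_restrict]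
    simp only
    rw [this, Cantor.take_restrict _ hs]
    exact hA

open Nat.Partrec (Code)

/-- Halting of the program `c` on input `n` within `k` steps. -/
lemma primrecPred_evaln :
    PrimrecPred fun a : (ℕ × Code) × ℕ => (Code.evaln a.1.1 a.1.2 a.2).isSome = true :=
  Primrec.eq.comp (Primrec.option_isSome.comp Code.primrec_evaln) (Primrec.const true)

lemma exists_code_of_partrec {γ : Type*} [Primcodable γ] {f : α →. γ} (hf : Partrec f) :
    ∃ c : Code, ∀ a, (f a).Dom ↔ ∃ k, (Code.evaln k c (Encodable.encode a)).isSome = true := by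
  obtain ⟨c, hc⟩ := Code.exists_code.1 hf
  refine ⟨c, fun a => ?_⟩
  have h1 : (f a).Dom ↔ (Code.eval c (Encodable.encode a)).Dom := by
    rw [hc]; simp
  rw [h1, Part.dom_iff_mem]
  simp only [Code.evaln_complete, Option.isSome_iff_exists, Option.mem_def]
  exact exists_comm

lemma REPred.sig {A : α → Prop} (hA : REPred A) : Sig A := by
  obtain ⟨c, hc⟩ := exists_code_of_partrec hA
  refine ⟨fun a => (Code.evaln a.2 c (Encodable.encode a.1)).isSome = true, ?_, fun a => ?_⟩
  · refine primrecPred_evaln.comp (f := fun a : α × ℕ => ((a.2, c), Encodable.encode a.1)) ?_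
    exact (Primrec.snd.pair (Primrec.const c)).pair (Primrec.encode.comp Primrec.fst)
  · rw [← hc]; simp [Part.assert]

/-- A function into `Bool` with recursively enumerable graph is computable. -/
lemma Sig.computable {x : ℕ → Bool} (hx : Sig fun a : ℕ × Bool => x a.1 = a.2) : Computable x := by
  classical
  obtain ⟨h, hh, H⟩ := hx
  have hd : Primrec fun k : ℕ => decide (k.unpair.1 = 1) :=
    (Primrec.eq.comp (Primrec.fst.comp Primrec.unpair) (Primrec.const 1)).decide
  have hP : ComputablePred fun c : ℕ × ℕ =>
      h ((c.1, decide (c.2.unpair.1 = 1)), c.2.unpair.2) := by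
    refine PrimrecPred.computablePred (hh.comp ?_)
    exact (Primrec.fst.pair (hd.comp Primrec.snd)).pair
      (Primrec.snd.comp (Primrec.unpair.comp Primrec.snd))
  have hex : ∀ n, ∃ k : ℕ, h ((n, decide (k.unpair.1 = 1)), k.unpair.2) := by
    intro n
    obtain ⟨k, hk⟩ := (H (n, x n)).1 rfl
    refine ⟨Nat.pair (if x n then 1 else 0) k, ?_⟩
    cases hxn : x n <;> simpa [hxn] using hk
  have hf := Computable.find (P := fun n k => h ((n, decide (k.unpair.1 = 1)), k.unpair.2)) hP hex
  refine (hd.to_comp.comp hf).of_eq fun n => ?_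
  exact ((H (n, _)).2 ⟨_, Nat.find_spec (hex n)⟩).symm

lemma sig_restrict_of_computable {x : Cantor} (hx : Computable x) :
    Sig fun σ : List Bool => x.restrict σ.length = σ := by
  have h1 : Sig fun a : ℕ × Bool => x a.1 = a.2 := by
    refine (ComputablePred.to_re ?_).sig
    refine ComputablePred.computable_iff.2
      ⟨fun a => x a.1 == a.2, ?_, funext fun a => by simp⟩
    exact Primrec.beq.to_comp.comp (hx.comp Computable.fst) Computable.snd
  have h2 : Sig fun c : List Bool × ℕ => x c.2 = c.1.getD c.2 false :=
    h1.comp (f := fun c : List Bool × ℕ => (c.2, c.1.getD c.2 false))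
      (Primrec.snd.pair ((Primrec.list_getD false).comp Primrec.fst Primrec.snd))
  refine (h2.ball (L := fun σ : List Bool => List.range σ.length)
    (Primrec.list_range.comp Primrec.list_length)).of_eq fun σ => ?_
  rw [Cantor.restrict_eq_iff_getD]
  simp

end Sig

namespace Cantor

/-! ### Oracle computations and their use -/

/-- `F` computes `f` from finite initial segments of `p`. -/
structure UseOf (p : Cantor) (f : ℕ →. ℕ) (F : List Bool × ℕ →. ℕ) : Prop where
  partrec : Partrec F
  mono : ∀ ⦃σ τ : List Bool⦄ ⦃a b⦄, σ <+: τ → b ∈ F (σ, a) → b ∈ F (τ, a)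
  iff : ∀ a b, b ∈ f a ↔ ∃ s, b ∈ F (p.restrict s, a)

lemma UseOf.lift {p f F} (h : UseOf p f F) {s t a b} (hst : s ≤ t)
    (hb : b ∈ F (p.restrict s, a)) : b ∈ F (p.restrict t, a) :=
  h.mono (restrict_prefix p hst) hb

lemma UseOf.of_partrec (p : Cantor) {f : ℕ →. ℕ} (hf : Nat.Partrec f) :
    UseOf p f fun c => f c.2 where
  partrec := (Partrec.nat_iff.2 hf).comp Computable.snd
  mono _ _ _ _ _ h := h
  iff a b := by simp

lemma UseOf.oracle (p : Cantor) : UseOf p (fun n => Part.some (p n).toNat)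
    fun c => ((c.1[c.2]?).map Bool.toNat : Option ℕ) where
  partrec := by
    refine Computable.ofOption (Primrec.to_comp ?_)
    refine Primrec.option_map (Primrec.list_getElem?.comp Primrec.fst Primrec.snd) ?_
    exact (Primrec.dom_finite Bool.toNat).comp Primrec.snd
  mono σ τ a b h hb := by
    simp only [Part.mem_coe, Option.mem_def, Option.map_eq_some_iff] at hb ⊢
    obtain ⟨c, hc, rfl⟩ := hb
    obtain ⟨t, rfl⟩ := h
    refine ⟨c, ?_, rfl⟩
    rw [List.getElem?_append_left (List.getElem?_eq_some_iff.1 hc).1, hc]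
  iff a b := by
    simp only [Part.mem_coe, Option.mem_def, Option.map_eq_some_iff, Part.mem_some_iff]
    constructor
    · rintro rfl
      exact ⟨a + 1, p a, restrict_getElem? p (Nat.lt_succ_self a), rfl⟩
    · rintro ⟨s, c, hc, rfl⟩
      have ha : a < s := by
        by_contra h
        rw [List.getElem?_eq_none (by simpa using h)] at hc
        simp at hc
      rw [restrict_getElem? p ha] at hc
      simp at hc
      rw [hc]

lemma UseOf.pair {p f g F G} (hf : UseOf p f F) (hg : UseOf p g G) :
    UseOf p (fun n => Nat.pair <$> f n <*> g n) fun c => (F c).bind fun x => (G c).map (Nat.pair x) where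
  partrec := by
    refine hf.partrec.bind ?_
    refine Partrec.map (hg.partrec.comp Computable.fst) ?_
    exact Primrec₂.natPair.to_comp.comp (Computable.snd.comp Computable.fst) Computable.snd
  mono σ τ a b h hb := by
    simp only [Part.mem_bind_iff, Part.mem_map_iff] at hb ⊢
    obtain ⟨x, hx, y, hy, rfl⟩ := hb
    exact ⟨x, hf.mono h hx, y, hg.mono h hy, rfl⟩
  iff a b := by
    have : b ∈ (Nat.pair <$> f a <*> g a) ↔ ∃ x ∈ f a, ∃ y ∈ g a, Nat.pair x y = b := by
      simp [Seq.seq]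
    rw [this]
    simp only [Part.mem_bind_iff, Part.mem_map_iff, hf.iff, hg.iff]
    constructor
    · rintro ⟨x, ⟨s, hx⟩, y, ⟨t, hy⟩, rfl⟩
      exact ⟨max s t, x, hf.lift (le_max_left _ _) hx, y, hg.lift (le_max_right _ _) hy, rfl⟩
    · rintro ⟨s, x, hx, y, hy, rfl⟩
      exact ⟨x, ⟨s, hx⟩, y, ⟨s, hy⟩, rfl⟩

lemma UseOf.comp {p f g F G} (hf : UseOf p f F) (hg : UseOf p g G) :
    UseOf p (fun n => g n >>= f) fun c => (G c).bind fun x => F (c.1, x) where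
  partrec := by
    refine hg.partrec.bind ?_
    exact hf.partrec.comp ((Computable.fst.comp Computable.fst).pair Computable.snd)
  mono σ τ a b h hb := by
    simp only [Part.mem_bind_iff] at hb ⊢
    obtain ⟨x, hx, hy⟩ := hb
    exact ⟨x, hg.mono h hx, hf.mono h hy⟩
  iff a b := by
    have : b ∈ (g a >>= f) ↔ ∃ x ∈ g a, b ∈ f x := Part.mem_bind_iff
    refine this.trans ?_
    simp only [Part.mem_bind_iff, hf.iff, hg.iff]
    constructor
    · rintro ⟨x, ⟨s, hx⟩, t, hy⟩
      exact ⟨max s t, x, hg.lift (le_max_left _ _) hx, hf.lift (le_max_right _ _) hy⟩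
    · rintro ⟨s, x, hx, hy⟩
      exact ⟨x, ⟨s, hx⟩, s, hy⟩

/-- Primitive recursion for partial functions with a parameter. -/
def precPart (f g : ℕ →. ℕ) (a n : ℕ) : Part ℕ :=
  n.rec (f a) fun y IH => IH.bind fun i => g (Nat.pair a (Nat.pair y i))

lemma precPart_mono {f g f' g' : ℕ →. ℕ} (hf : ∀ a, ∀ b ∈ f a, b ∈ f' a)
    (hg : ∀ a, ∀ b ∈ g a, b ∈ g' a) (a n : ℕ) : ∀ b ∈ precPart f g a n, b ∈ precPart f' g' a n := by
  induction n with
  | zero => exact hf a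
  | succ n ih =>
    intro b hb
    simp only [precPart, Part.mem_bind_iff] at hb ⊢
    obtain ⟨i, hi, hb⟩ := hb
    exact ⟨i, ih i hi, hg _ _ hb⟩

lemma UseOf.prec {p f g F G} (hf : UseOf p f F) (hg : UseOf p g G) :
    UseOf p (fun c => precPart f g c.unpair.1 c.unpair.2)
      fun c => precPart (fun a => F (c.1, a)) (fun a => G (c.1, a)) c.2.unpair.1 c.2.unpair.2 where
  partrec := by
    unfold precPart
    refine Partrec.nat_rec (f := fun c : List Bool × ℕ => c.2.unpair.2)
      (g := fun c : List Bool × ℕ => F (c.1, c.2.unpair.1))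
      (h := fun c (z : ℕ × ℕ) => G (c.1, Nat.pair c.2.unpair.1 (Nat.pair z.1 z.2))) ?_ ?_ ?_
    · exact Computable.snd.comp (Computable.unpair.comp Computable.snd)
    · exact hf.partrec.comp
        (Computable.fst.pair (Computable.fst.comp (Computable.unpair.comp Computable.snd)))
    · refine hg.partrec.comp ((Computable.fst.comp Computable.fst).pair ?_)
      refine Primrec₂.natPair.to_comp.comp ?_ ?_
      · exact Computable.fst.comp
          (Computable.unpair.comp (Computable.snd.comp Computable.fst))
      · exact Primrec₂.natPair.to_comp.comp (Computable.fst.comp Computable.snd)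
          (Computable.snd.comp Computable.snd)
  mono σ τ a b h hb := precPart_mono (fun _ _ h' => hf.mono h h') (fun _ _ h' => hg.mono h h') _ _ _ hb
  iff c b := by
    change b ∈ precPart f g c.unpair.1 c.unpair.2 ↔ ∃ s, b ∈ precPart
      (fun a => F (p.restrict s, a)) (fun a => G (p.restrict s, a)) c.unpair.1 c.unpair.2
    generalize c.unpair.1 = a
    generalize c.unpair.2 = n
    constructor
    · intro hb
      induction n generalizing b with
      | zero => exact (hf.iff _ _).1 hb
      | succ n ih =>
        simp only [precPart, Part.mem_bind_iff] at hb
        obtain ⟨i, hi, hb⟩ := hb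
        obtain ⟨s, hs⟩ := ih i hi
        obtain ⟨t, ht⟩ := (hg.iff _ _).1 hb
        refine ⟨max s t, ?_⟩
        refine Part.mem_bind_iff.2 ⟨i, ?_, hg.lift (le_max_right _ _) ht⟩
        exact precPart_mono (fun _ _ h' => hf.lift (le_max_left s t) h')
          (fun _ _ h' => hg.lift (le_max_left s t) h') _ _ _ hs
    · rintro ⟨s, hs⟩
      exact precPart_mono (fun _ _ h' => (hf.iff _ _).2 ⟨s, h'⟩)
        (fun _ _ h' => (hg.iff _ _).2 ⟨s, h'⟩) _ _ _ hs

lemma mem_rfind_map {h : ℕ → Part ℕ} {b : ℕ} :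
    (b ∈ Nat.rfind fun n => (h n).map fun m => decide (m = 0)) ↔
      (∃ x ∈ h b, decide (x = 0) = true) ∧ ∀ m < b, ∃ x ∈ h m, decide (x = 0) = false := by
  refine Nat.mem_rfind.trans (and_congr (Part.mem_map_iff _) ?_)
  exact forall_congr' fun m => imp_congr_right fun _ => Part.mem_map_iff _

lemma UseOf.rfind {p f F} (hf : UseOf p f F) :
    UseOf p (fun a => Nat.rfind fun n => (fun m => decide (m = 0)) <$> f (Nat.pair a n))
      fun c => Nat.rfind fun n => (F (c.1, Nat.pair c.2 n)).map fun m => decide (m = 0) where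
  partrec := by
    refine Partrec.rfind (p := fun (c : List Bool × ℕ) n =>
      (F (c.1, Nat.pair c.2 n)).map fun m => decide (m = 0)) ?_
    refine Partrec.map (f := fun c : (List Bool × ℕ) × ℕ => F (c.1.1, Nat.pair c.1.2 c.2)) ?_ ?_
    · refine hf.partrec.comp ((Computable.fst.comp Computable.fst).pair ?_)
      exact Primrec₂.natPair.to_comp.comp (Computable.snd.comp Computable.fst) Computable.snd
    · exact (Primrec.eq.comp Primrec.snd (Primrec.const 0)).decide.to_comp
  mono σ τ a b h hb := by
    have hb := mem_rfind_map.1 hb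
    refine mem_rfind_map.2 ⟨?_, fun m hm => ?_⟩
    · obtain ⟨x, hx, e⟩ := hb.1
      exact ⟨x, hf.mono h hx, e⟩
    · obtain ⟨x, hx, e⟩ := hb.2 m hm
      exact ⟨x, hf.mono h hx, e⟩
  iff a b := by
    refine mem_rfind_map.trans ?_
    refine Iff.trans ?_ (exists_congr fun s => mem_rfind_map.symm)
    simp only [hf.iff]
    constructor
    · rintro ⟨⟨x, ⟨s, hx⟩, e⟩, h2⟩
      have : ∀ m, ∃ t, m < b → ∃ y ∈ F (p.restrict t, Nat.pair a m), decide (y = 0) = false := by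
        intro m
        by_cases hm : m < b
        · obtain ⟨y, ⟨t, hy⟩, e⟩ := h2 m hm
          exact ⟨t, fun _ => ⟨y, hy, e⟩⟩
        · exact ⟨0, fun h => absurd h hm⟩
      choose t ht using this
      refine ⟨s + ∑ m ∈ Finset.range b, t m, ⟨x, hf.lift (Nat.le_add_right _ _) hx, e⟩, ?_⟩
      intro m hm
      obtain ⟨y, hy, e⟩ := ht m hm
      refine ⟨y, hf.lift ?_ hy, e⟩
      exact (Finset.single_le_sum (f := t) (fun _ _ => Nat.zero_le _) (Finset.mem_range.2 hm)).trans
        (Nat.le_add_left _ _)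
    · rintro ⟨s, ⟨x, hx, e⟩, h2⟩
      refine ⟨⟨x, ⟨s, hx⟩, e⟩, fun m hm => ?_⟩
      obtain ⟨y, hy, e⟩ := h2 m hm
      exact ⟨y, ⟨s, hy⟩, e⟩

lemma exists_useOf {p : Cantor} {f : ℕ →. ℕ} (hf : Nat.RecursiveIn p.oracle f) :
    ∃ F, UseOf p f F := by
  induction hf with
  | zero => exact ⟨_, .of_partrec p .zero⟩
  | succ => exact ⟨_, .of_partrec p .succ⟩
  | left => exact ⟨_, .of_partrec p .left⟩
  | right => exact ⟨_, .of_partrec p .right⟩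
  | oracle g hg =>
    rw [Set.mem_singleton_iff.1 hg]
    exact ⟨_, .oracle p⟩
  | pair _ _ hf hg =>
    obtain ⟨F, hF⟩ := hf
    obtain ⟨G, hG⟩ := hg
    exact ⟨_, hF.pair hG⟩
  | comp _ _ hf hg =>
    obtain ⟨F, hF⟩ := hf
    obtain ⟨G, hG⟩ := hg
    exact ⟨_, hF.comp hG⟩
  | prec _ _ hf hg =>
    obtain ⟨F, hF⟩ := hf
    obtain ⟨G, hG⟩ := hg
    exact ⟨_, hF.prec hG⟩
  | rfind _ hf =>
    obtain ⟨F, hF⟩ := hf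
    exact ⟨_, hF.rfind⟩

open Nat.Partrec (Code)

/-- A predicate that is enumerable in `p` is enumerated by a program that reads initial segments
of `p`. -/
lemma REIn.exists_code {α : Type*} [Primcodable α] {p : Cantor} {A : α → Prop} (hA : REIn p A) :
    ∃ c : Code, ∀ a, A a ↔
      ∃ s k, (Code.evaln k c (Encodable.encode (p.restrict s, a))).isSome = true := by
  obtain ⟨f, hf, H⟩ := hA
  obtain ⟨F, hF⟩ := exists_useOf hf
  have hp : Partrec fun z : List Bool × α => F (z.1, Encodable.encode z.2) :=
    hF.partrec.comp (Computable.fst.pair (Computable.encode.comp Computable.snd))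
  obtain ⟨c, hc⟩ := exists_code_of_partrec hp
  refine ⟨c, fun a => ?_⟩
  simp only [← hc]
  rw [H]
  have h1 := hF.iff (Encodable.encode a)
  simp only [Encodable.encodek, Part.coe_some, Part.bind_some] at h1
  have : (f a).Dom ↔ ∃ b, b ∈ (f a).map Encodable.encode := by
    rw [← Part.dom_iff_mem]; rfl
  rw [this]
  simp only [h1, Part.dom_iff_mem]
  exact exists_comm

/-- The function that maps `n` to the code of the initial segment of length `n`. -/
lemma recursiveIn_restrict (p : Cantor) :
    Nat.RecursiveIn p.oracle fun n => Part.some (Encodable.encode (p.restrict n)) := by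
  let snoc : ℕ → ℕ := fun c => Encodable.encode
    (((Encodable.decode (α := List Bool) c.unpair.1).getD []) ++ [decide (c.unpair.2 = 1)])
  have hsnoc : Primrec snoc := by
    refine Primrec.encode.comp (Primrec.list_concat.comp ?_ ?_)
    · exact Primrec.option_getD.comp
        (Primrec.decode.comp (Primrec.fst.comp Primrec.unpair)) (Primrec.const [])
    · exact (Primrec.eq.comp (Primrec.snd.comp Primrec.unpair) (Primrec.const 1)).decide
  have ho : Nat.RecursiveIn p.oracle fun n => Part.some (p n).toNat := .oracle _ rfl
  have h1 : Nat.RecursiveIn p.oracle fun c : ℕ => Part.some (p c.unpair.2.unpair.1).toNat :=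
    (Nat.RecursiveIn.comp ho (Nat.RecursiveIn.comp .left .right)).of_eq fun c => by
      simp
  have h2 : Nat.RecursiveIn p.oracle fun c : ℕ => Part.some c.unpair.2.unpair.2 :=
    (Nat.RecursiveIn.comp .right .right).of_eq fun c => by simp
  have h3 : Nat.RecursiveIn p.oracle fun c : ℕ =>
      Part.some (snoc (Nat.pair c.unpair.2.unpair.2 (p c.unpair.2.unpair.1).toNat)) :=
    (Nat.RecursiveIn.comp (Nat.Primrec.recursiveIn (Primrec.nat_iff.1 hsnoc)) (h2.pair h1)).of_eq
      fun c => by simp [Seq.seq]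
  have h0 : Nat.RecursiveIn p.oracle fun _ : ℕ => Part.some (Encodable.encode ([] : List Bool)) :=
    Nat.Primrec.recursiveIn (Primrec.nat_iff.1 (Primrec.const _))
  have h4 := Nat.RecursiveIn.prec h0 h3
  have h5 : Nat.RecursiveIn p.oracle fun n : ℕ => Part.some (Nat.pair 0 n) :=
    Nat.Primrec.recursiveIn (Primrec.nat_iff.1 (Primrec₂.natPair.comp (Primrec.const 0) Primrec.id))
  refine (h4.comp h5).of_eq fun n => ?_
  simp only [Part.bind_eq_bind, Part.bind_some, Nat.unpair_pair]
  induction n with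
  | zero => simp [restrict]
  | succ n ih =>
    simp only at ih ⊢
    rw [ih, Part.bind_some, restrict_succ]
    simp only [Nat.unpair_pair, snoc, Encodable.encodek, Option.getD_some]
    cases p n <;> simp

/-- A predicate given by a primitive recursive search through the initial segments of `p` is
enumerable in `p`. -/
lemma reIn_of_primrecPred {α : Type*} [Primcodable α] {p : Cantor} {H : α × List Bool → Prop}
    (hH : PrimrecPred H) : REIn p fun a => ∃ s, H (a, p.restrict s) := by
  classical
  refine ⟨fun a => Part.assert (∃ s, H (a, p.restrict s)) fun _ => Part.some (), ?_,
    fun a => by simp [Part.assert]⟩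
  let T : ℕ → ℕ := fun c =>
    if ∃ a ∈ (Encodable.decode (α := α) c.unpair.1).toList,
      ∃ ρ ∈ (Encodable.decode (α := List Bool) c.unpair.2).toList, H (a, ρ) then 0 else 1
  have hT : Primrec T := by
    refine Primrec.ite ?_ (Primrec.const 0) (Primrec.const 1)
    refine PrimrecPred.bex (R := fun z : ℕ × α =>
      ∃ ρ ∈ (Encodable.decode (α := List Bool) z.1.unpair.2).toList, H (z.2, ρ)) ?_
      (Primrec.optionToList.comp (Primrec.decode.comp (Primrec.fst.comp Primrec.unpair)))
    refine PrimrecPred.bex (R := fun z : (ℕ × α) × List Bool => H (z.1.2, z.2)) ?_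
      (Primrec.optionToList.comp
        (Primrec.decode.comp (Primrec.snd.comp (Primrec.unpair.comp Primrec.fst))))
    exact hH.comp ((Primrec.snd.comp Primrec.fst).pair Primrec.snd)
  have h1 : Nat.RecursiveIn p.oracle fun c : ℕ =>
      Part.some (T (Nat.pair c.unpair.1 (Encodable.encode (p.restrict c.unpair.2)))) := by
    have hr : Nat.RecursiveIn p.oracle fun c : ℕ =>
        Part.some (Encodable.encode (p.restrict c.unpair.2)) :=
      (Nat.RecursiveIn.comp (recursiveIn_restrict p) .right).of_eq fun c => by simp
    exact (Nat.RecursiveIn.comp (Nat.Primrec.recursiveIn (Primrec.nat_iff.1 hT))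
      (Nat.RecursiveIn.pair .left hr)).of_eq fun c => by simp [Seq.seq]
  have h2 := Nat.RecursiveIn.comp (.zero) (Nat.RecursiveIn.rfind h1)
  refine h2.of_eq fun n => Part.ext fun b => ?_
  simp only [Part.bind_eq_bind, Part.mem_bind_iff, Part.map_eq_map, Part.map_some, Nat.unpair_pair,
    Part.mem_map_iff]
  have hz : ∀ c : ℕ, b ∈ (0 : Part ℕ) ↔ b = 0 := fun c => Part.mem_some_iff
  constructor
  · rintro ⟨s, hs, hb⟩
    have := Nat.rfind_spec hs
    simp only [Part.mem_some_iff, T] at this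
    have h3 : ∃ a ∈ (Encodable.decode (α := α) n).toList, H (a, p.restrict s) := by
      by_contra hcon
      simp only [Nat.unpair_pair, Encodable.encodek] at this
      simp only [Option.mem_toList, Option.some.injEq, exists_eq_left'] at this hcon
      rw [if_neg hcon] at this
      simp at this
    obtain ⟨a, ha, h3⟩ := h3
    simp only [Option.mem_toList] at ha
    rw [ha]
    simp only [Part.coe_some, Part.mem_some_iff, exists_eq_left, Part.mem_assert_iff]
    refine ⟨(), ⟨⟨s, h3⟩, trivial⟩, ?_⟩
    exact ((hz 0).1 hb).symm
  · rintro ⟨a, ha, u, hu, rfl⟩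
    simp only [Part.mem_coe, Option.mem_def] at ha
    simp only [Part.mem_assert_iff] at hu
    obtain ⟨⟨s, hs⟩, -⟩ := hu
    have hdom : (Nat.rfind fun s => Part.some
        (decide (T (Nat.pair n (Encodable.encode (p.restrict s))) = 0))).Dom := by
      refine Nat.rfind_dom.2 ⟨s, ?_, fun _ => trivial⟩
      simp only [Part.mem_some_iff, T, Nat.unpair_pair, Encodable.encodek, ha]
      simp [hs]
    exact ⟨_, Part.get_mem hdom, (hz 0).2 rfl⟩

/-! ### Counting strings in the blocks of a code -/

/-- The `i`-th string in the `n`-th block of `p` is compatible with `σ`. -/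
def Hit (p : Cantor) (n i : ℕ) (σ : List Bool) : Prop :=
  ∀ j < σ.length, p (Nat.pair n (Nat.pair i j)) = σ.getD j false

instance (p : Cantor) (n i : ℕ) (σ : List Bool) : Decidable (Hit p n i σ) := by
  unfold Hit; infer_instance

/-- The number of strings in the `n`-th block of `p` that are compatible with `σ`. -/
def cnt (p : Cantor) (n : ℕ) (σ : List Bool) : ℕ :=
  ((Finset.range (4 ^ (n + 2))).filter fun i => Hit p n i σ).card

/-- Every bit of `p` that belongs to no block is `0`. -/
def Tidy (p : Cantor) : Prop :=
  ∀ n i j, 4 ^ (n + 2) ≤ i ∨ n + 2 ≤ j → p (Nat.pair n (Nat.pair i j)) = false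

/-- The counts of `p` are within `D` of those prescribed by `μ`. -/
def Near (D : ℝ) (p : Cantor) (μ : Measure Cantor) : Prop :=
  ∀ n σ, σ.length = n + 2 → |(cnt p n σ : ℝ) - 4 ^ (n + 2) * μ.real (cyl σ)| ≤ D

lemma hit_append (p : Cantor) (n i : ℕ) (σ : List Bool) (b : Bool) :
    Hit p n i (σ ++ [b]) ↔ Hit p n i σ ∧ p (Nat.pair n (Nat.pair i σ.length)) = b := by
  unfold Hit
  constructor
  · intro h
    refine ⟨fun j hj => ?_, ?_⟩
    · rw [h j (by simp; omega), List.getD_append _ _ _ _ hj]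
    · rw [h _ (by simp)]; simp
  · rintro ⟨h1, h2⟩ j hj
    simp only [List.length_append, List.length_singleton] at hj
    rcases Nat.lt_succ_iff_lt_or_eq.1 hj with h | rfl
    · rw [h1 j h, List.getD_append _ _ _ _ h]
    · rw [h2]; simp

lemma cnt_split (p : Cantor) (n : ℕ) (σ : List Bool) :
    cnt p n σ = cnt p n (σ ++ [false]) + cnt p n (σ ++ [true]) := by
  unfold cnt
  rw [← Finset.card_union_of_disjoint]
  · congr 1
    ext i
    simp only [Finset.mem_filter, Finset.mem_union, hit_append]
    cases p (Nat.pair n (Nat.pair i σ.length)) <;> simp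
  · rw [Finset.disjoint_left]
    intro i h1 h2
    simp only [Finset.mem_filter, hit_append] at h1 h2
    rw [h1.2.2] at h2
    simp at h2

/-- Bits from this position on are irrelevant to the counts in block `n` for strings of
length `l`. -/
def bitBound (n l : ℕ) : ℕ := Nat.pair n (Nat.pair (4 ^ (n + 2)) l)

lemma pair_lt_bitBound {n i j l : ℕ} (hi : i < 4 ^ (n + 2)) (hj : j < l) :
    Nat.pair n (Nat.pair i j) < bitBound n l :=
  Nat.pair_lt_pair_right _ ((Nat.pair_lt_pair_left _ hi).trans (Nat.pair_lt_pair_right _ hj))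

lemma cnt_congr {p q : Cantor} {n : ℕ} {σ : List Bool}
    (h : ∀ k < bitBound n σ.length, p k = q k) : cnt p n σ = cnt q n σ := by
  unfold cnt
  congr 1
  refine Finset.filter_congr fun i hi => ?_
  unfold Hit
  refine forall₂_congr fun j hj => ?_
  rw [h _ (pair_lt_bitBound (Finset.mem_range.1 hi) hj)]

lemma cnt_padZero_restrict {p : Cantor} {n s : ℕ} {σ : List Bool}
    (h : bitBound n σ.length ≤ s) : cnt (padZero (p.restrict s)) n σ = cnt p n σ :=
  cnt_congr fun k hk => by
    unfold padZero
    exact restrict_getD p (hk.trans_le h)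

lemma isClopen_cnt (n : ℕ) (σ : List Bool) (G : ℕ → Prop) : IsClopen {p : Cantor | G (cnt p n σ)} := by
  have : {p : Cantor | G (cnt p n σ)} =
      {p | G (cnt (padZero (p.restrict (bitBound n σ.length))) n σ)} := by
    ext p; simp [cnt_padZero_restrict le_rfl]
  rw [this]
  exact isClopen_restrict _ fun ρ => G (cnt (padZero ρ) n σ)

lemma continuous_cnt (n : ℕ) (σ : List Bool) : Continuous fun p : Cantor => cnt p n σ := by
  rw [continuous_discrete_rng]
  intro k
  exact (isClopen_cnt n σ (fun x => x = k)).2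

/-! ### Measures of cylinders -/

lemma measurableSet_cyl (σ : List Bool) : MeasurableSet (cyl σ) :=
  (isClopen_cyl σ).1.measurableSet

lemma mem_cyl_append {x : Cantor} {σ : List Bool} {b : Bool} :
    x ∈ cyl (σ ++ [b]) ↔ x ∈ cyl σ ∧ x σ.length = b := by
  simp only [cyl, Set.mem_ofPred_eq, List.length_append, List.length_singleton, restrict_succ]
  constructor
  · intro h
    have := List.append_inj h (by simp)
    exact ⟨this.1, by simpa using this.2⟩
  · rintro ⟨h1, h2⟩
    rw [h1, h2]

lemma measureReal_cyl_split (μ : Measure Cantor) [IsFiniteMeasure μ] (σ : List Bool) :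
    μ.real (cyl σ) = μ.real (cyl (σ ++ [false])) + μ.real (cyl (σ ++ [true])) := by
  rw [← measureReal_union _ (measurableSet_cyl _)]
  · congr 1
    ext x
    simp only [Set.mem_union, mem_cyl_append]
    cases x σ.length <;> simp
  · rw [Set.disjoint_left]
    intro x h1 h2
    rw [mem_cyl_append] at h1 h2
    rw [h1.2] at h2
    simp at h2

lemma cyl_nil : cyl [] = Set.univ := by
  ext x; simp [cyl, restrict]

/-- An additive function on strings that is small on all strings of length `N`. -/
lemma abs_le_of_additive {e : List Bool → ℝ} (he : ∀ σ, e σ = e (σ ++ [false]) + e (σ ++ [true]))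
    {N : ℕ} {D : ℝ} (hN : ∀ σ, σ.length = N → |e σ| ≤ D) (σ : List Bool) (hσ : σ.length ≤ N) :
    |e σ| ≤ D * 2 ^ (N - σ.length) := by
  generalize hd : N - σ.length = d
  induction d generalizing σ with
  | zero => simpa using hN σ (by omega)
  | succ d ih =>
    rw [he]
    refine (abs_add_le _ _).trans ?_
    have h1 := ih (σ ++ [false]) (by simp; omega) (by simp; omega)
    have h2 := ih (σ ++ [true]) (by simp; omega) (by simp; omega)
    rw [pow_succ]
    linarith

lemma Near.abs_le {D : ℝ} {p : Cantor} {μ : Measure Cantor} [IsFiniteMeasure μ] (h : Near D p μ)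
    {n : ℕ} {σ : List Bool} (hσ : σ.length ≤ n + 2) :
    |(cnt p n σ : ℝ) - 4 ^ (n + 2) * μ.real (cyl σ)| ≤ D * 2 ^ (n + 2 - σ.length) :=
  abs_le_of_additive (e := fun σ => (cnt p n σ : ℝ) - 4 ^ (n + 2) * μ.real (cyl σ))
    (fun σ => by
      rw [cnt_split p n σ, measureReal_cyl_split μ σ]
      push_cast
      ring) (h n) σ hσ

lemma Near.tendsto {D : ℝ} {p : Cantor} {μ : Measure Cantor} [IsFiniteMeasure μ] (h : Near D p μ)
    (σ : List Bool) : Tendsto (fun n => (cnt p n σ : ℝ) / 4 ^ (n + 2)) atTop (𝓝 (μ.real (cyl σ))) := by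
  have hD : 0 ≤ D := (abs_nonneg _).trans (h 0 [false, false] rfl)
  have hlim : Tendsto (fun n : ℕ => D * (1 / 2 : ℝ) ^ (n + 2)) atTop (𝓝 0) := by
    have := ((tendsto_pow_atTop_nhds_zero_of_lt_one (r := (1 / 2 : ℝ)) (by norm_num)
      (by norm_num)).comp (tendsto_add_atTop_nat 2)).const_mul D
    simpa using this
  rw [tendsto_iff_norm_sub_tendsto_zero]
  refine squeeze_zero' (Eventually.of_forall fun _ => norm_nonneg _) ?_ hlim
  filter_upwards [eventually_ge_atTop σ.length] with n hn
  have h4 : (0 : ℝ) < 4 ^ (n + 2) := by positivity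
  have : (cnt p n σ : ℝ) / 4 ^ (n + 2) - μ.real (cyl σ) =
      ((cnt p n σ : ℝ) - 4 ^ (n + 2) * μ.real (cyl σ)) / 4 ^ (n + 2) := by
    field_simp
  rw [this, Real.norm_eq_abs, abs_div, abs_of_pos h4, div_le_iff₀ h4]
  refine (h.abs_le (by omega)).trans ?_
  have : D * (1 / 2 : ℝ) ^ (n + 2) * 4 ^ (n + 2) = D * 2 ^ (n + 2) := by
    rw [mul_assoc, ← mul_pow]; norm_num
  rw [this]
  gcongr
  · norm_num
  · omega

lemma Near.unique {D D' : ℝ} {p : Cantor} {μ ν : Measure Cantor} [IsFiniteMeasure μ]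
    [IsFiniteMeasure ν] (h : Near D p μ) (h' : Near D' p ν) (σ : List Bool) :
    μ.real (cyl σ) = ν.real (cyl σ) :=
  tendsto_nhds_unique (h.tendsto σ) (h'.tendsto σ)

/-! ### The approximations coded by `p` -/

lemma padZero_blockString {p : Cantor} (hp : Tidy p) {n i : ℕ} (j : ℕ) :
    padZero (blockString p n i) j = p (Nat.pair n (Nat.pair i j)) := by
  unfold padZero blockString
  by_cases h : j < n + 2
  · simp [h]
  · rw [hp n i j (Or.inr (by omega))]
    rw [List.getD_eq_default _ _ (by simpa using h)]

lemma padZero_blockString_mem_cyl {p : Cantor} (hp : Tidy p) {n i : ℕ} {σ : List Bool} :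
    padZero (blockString p n i) ∈ cyl σ ↔ Hit p n i σ := by
  simp only [cyl, Set.mem_ofPred_eq, restrict_eq_iff_getD, padZero_blockString hp, Hit]

instance (p : Cantor) (n : ℕ) : IsProbabilityMeasure (approx p n) := by
  constructor
  unfold approx
  simp only [Measure.smul_apply, Measure.coe_finsetSum, Finset.sum_apply, measure_univ,
    Finset.sum_const, Finset.card_range, smul_eq_mul, nsmul_eq_mul, mul_one, Nat.cast_pow]
  exact ENNReal.inv_mul_cancel (by simp) (by simp)

lemma approx_real_cyl {p : Cantor} (hp : Tidy p) (n : ℕ) (σ : List Bool) :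
    (approx p n).real (cyl σ) = cnt p n σ / 4 ^ (n + 2) := by
  have : approx p n (cyl σ) = ((4 : ℝ≥0∞) ^ (n + 2))⁻¹ * cnt p n σ := by
    unfold approx cnt
    simp only [Measure.smul_apply, Measure.coe_finsetSum, Finset.sum_apply, smul_eq_mul]
    congr 1
    rw [Finset.card_filter, Nat.cast_sum]
    refine Finset.sum_congr rfl fun i _ => ?_
    rw [Measure.dirac_apply' _ (measurableSet_cyl σ)]
    by_cases h : Hit p n i σ
    · rw [if_pos h, Set.indicator_of_mem ((padZero_blockString_mem_cyl hp).2 h)]; simp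
    · rw [if_neg h, Set.indicator_of_notMem (fun h' => h ((padZero_blockString_mem_cyl hp).1 h'))]
      simp
  rw [Measure.real, this, ENNReal.toReal_mul, ENNReal.toReal_inv]
  simp [div_eq_inv_mul]

/-- Codes of measures whose blocks agree with each other as closely as rounding permits. -/
def Good (p : Cantor) : Prop :=
  Tidy p ∧ ∀ n k σ, σ.length = n + 2 →
    cnt p (n + k) σ ≤ 4 ^ k * cnt p n σ + 2 * 4 ^ k ∧
      4 ^ k * cnt p n σ ≤ cnt p (n + k) σ + 2 * 4 ^ k

lemma Near.good {p : Cantor} {μ : Measure Cantor} [IsFiniteMeasure μ] (ht : Tidy p)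
    (h : Near 1 p μ) : Good p := by
  refine ⟨ht, fun n k σ hσ => ?_⟩
  have h1 := _root_.abs_le.1 (h n σ hσ)
  have h2 := _root_.abs_le.1 (h.abs_le (n := n + k) (σ := σ) (by omega))
  have h3 : n + k + 2 - σ.length = k := by omega
  rw [h3, show n + k + 2 = k + (n + 2) by ring, pow_add] at h2
  have h4 : (2 : ℝ) ^ k ≤ 4 ^ k := by gcongr; norm_num
  have h5 : (0 : ℝ) < 4 ^ k := by positivity
  set m := (4 : ℝ) ^ (n + 2) * μ.real (cyl σ)
  have h6 : (4 : ℝ) ^ k * 4 ^ (n + 2) * μ.real (cyl σ) = 4 ^ k * m := by ring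
  rw [h6] at h2
  constructor
  · have : (cnt p (n + k) σ : ℝ) ≤ 4 ^ k * cnt p n σ + 2 * 4 ^ k := by nlinarith
    exact_mod_cast this
  · have : (4 : ℝ) ^ k * cnt p n σ ≤ cnt p (n + k) σ + 2 * 4 ^ k := by nlinarith
    exact_mod_cast this

/-- Every good code has a limit measure. -/
lemma Good.exists_near {p : Cantor} (hp : Good p) : ∃ μ : ProbabilityMeasure Cantor, Near 2 p μ := by
  let ν : ℕ → ProbabilityMeasure Cantor := fun n => ⟨approx p n, inferInstance⟩
  let U : Ultrafilter ℕ := Ultrafilter.of atTop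
  have hU : (U : Filter ℕ) ≤ atTop := Ultrafilter.of_le atTop
  obtain ⟨μ, -, hμ⟩ := (isCompact_univ (X := ProbabilityMeasure Cantor)).ultrafilter_le_nhds
    (U.map ν) (by simp)
  have hμ : Tendsto ν U (𝓝 μ) := hμ
  refine ⟨μ, fun n σ hσ => ?_⟩
  have h1 : Tendsto (fun m => (approx p m).real (cyl σ)) U (𝓝 ((μ : Measure Cantor).real (cyl σ))) := by
    have hfr : (μ : Measure Cantor) (frontier (cyl σ)) = 0 := by
      rw [(isClopen_cyl σ).frontier_eq]; simp
    have := ProbabilityMeasure.tendsto_measure_of_null_frontier_of_tendsto' hμ hfr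
    exact (ENNReal.tendsto_toReal (measure_ne_top _ _)).comp this
  have h2 : Tendsto (fun m => |(cnt p n σ : ℝ) - 4 ^ (n + 2) * (approx p m).real (cyl σ)|) U
      (𝓝 |(cnt p n σ : ℝ) - 4 ^ (n + 2) * (μ : Measure Cantor).real (cyl σ)|) :=
    ((h1.const_mul _).const_sub _).abs
  refine le_of_tendsto h2 (hU ?_)
  filter_upwards [eventually_ge_atTop n] with m hm
  obtain ⟨k, rfl⟩ := Nat.exists_eq_add_of_le hm
  rw [approx_real_cyl hp.1]
  obtain ⟨h3, h4⟩ := hp.2 n k σ hσ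
  have h3 : (cnt p (n + k) σ : ℝ) ≤ 4 ^ k * cnt p n σ + 2 * 4 ^ k := by exact_mod_cast h3
  have h4 : (4 : ℝ) ^ k * cnt p n σ ≤ cnt p (n + k) σ + 2 * 4 ^ k := by exact_mod_cast h4
  have h5 : (0 : ℝ) < 4 ^ k := by positivity
  have h6 : (4 : ℝ) ^ (n + 2) * (cnt p (n + k) σ / 4 ^ (n + k + 2)) = cnt p (n + k) σ / 4 ^ k := by
    rw [show n + k + 2 = k + (n + 2) by ring, pow_add 4 k (n + 2)]
    have h7 : (0 : ℝ) < 4 ^ (n + 2) := by positivity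
    generalize (4 : ℝ) ^ (n + 2) = u at *
    field_simp
  rw [h6, abs_le]
  constructor
  · have : (cnt p (n + k) σ : ℝ) / 4 ^ k ≤ cnt p n σ + 2 := by
      rw [div_le_iff₀ h5]; linarith
    linarith
  · have : (cnt p n σ : ℝ) - 2 ≤ cnt p (n + k) σ / 4 ^ k := by
      rw [le_div_iff₀ h5]; linarith
    linarith

/-! ### Rounding -/

/-- Nonnegative reals with integral sum can be rounded so as to preserve the sum. -/
lemma exists_rounding {ι : Type*} [Fintype ι] [DecidableEq ι] (w : ι → ℝ) (hw : ∀ i, 0 ≤ w i)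
    (M : ℕ) (hM : ∑ i, w i = M) : ∃ k : ι → ℕ, ∑ i, k i = M ∧ ∀ i, |(k i : ℝ) - w i| ≤ 1 := by
  have h1 : ∑ i, ⌊w i⌋₊ ≤ M := by
    have : ((∑ i, ⌊w i⌋₊ : ℕ) : ℝ) ≤ M := by
      rw [← hM]; push_cast
      exact Finset.sum_le_sum fun i _ => Nat.floor_le (hw i)
    exact_mod_cast this
  have h2 : M - ∑ i, ⌊w i⌋₊ ≤ (Finset.univ : Finset ι).card := by
    have : (M : ℝ) ≤ ((∑ i, ⌊w i⌋₊ : ℕ) : ℝ) + (Finset.univ : Finset ι).card := by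
      rw [← hM]; push_cast
      rw [Finset.card_eq_sum_ones, Nat.cast_sum, ← Finset.sum_add_distrib]
      exact Finset.sum_le_sum fun i _ => by simpa using (Nat.lt_floor_add_one (w i)).le
    have : M ≤ ∑ i, ⌊w i⌋₊ + (Finset.univ : Finset ι).card := by exact_mod_cast this
    omega
  obtain ⟨S, -, hS⟩ := Finset.exists_subset_card_eq h2
  refine ⟨fun i => ⌊w i⌋₊ + if i ∈ S then 1 else 0, ?_, fun i => ?_⟩
  · rw [Finset.sum_add_distrib]
    simp [hS]
    omega
  · have h3 := Nat.floor_le (hw i)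
    have h4 := Nat.lt_floor_add_one (w i)
    push_cast
    rw [abs_le]
    split_ifs <;> constructor <;> simp <;> linarith

lemma exists_fun_of_card {ι : Type*} [Fintype ι] [DecidableEq ι] (k : ι → ℕ) (M : ℕ)
    (hM : ∑ i, k i = M) :
    ∃ f : Fin M → ι, ∀ i, (Finset.univ.filter fun x => f x = i).card = k i := by
  have : Fintype.card (Σ i, Fin (k i)) = M := by simp [hM]
  let e : Fin M ≃ Σ i, Fin (k i) := (Fintype.equivFinOfCardEq this).symm
  refine ⟨fun x => (e x).1, fun i => ?_⟩
  have h1 : (Finset.univ.filter fun x => (e x).1 = i).card =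
      (Finset.univ.filter fun y : Σ i, Fin (k i) => y.1 = i).card := by
    refine Finset.card_bij (fun x _ => e x) ?_ ?_ ?_
    · intro x hx; simpa using hx
    · intro x _ y _ h; exact e.injective h
    · intro y hy; exact ⟨e.symm y, by simpa using hy, by simp⟩
  rw [h1]
  have h2 : (Finset.univ.filter fun y : Σ i, Fin (k i) => y.1 = i) =
      Finset.univ.map ⟨fun x : Fin (k i) => (⟨i, x⟩ : Σ i, Fin (k i)),
        fun x y h => by simpa using h⟩ := by
    ext ⟨j, x⟩
    simp only [Finset.mem_filter, Finset.mem_univ, true_and, Finset.mem_map]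
    constructor
    · rintro rfl; exact ⟨x, rfl⟩
    · rintro ⟨y, hy⟩; exact (congrArg Sigma.fst hy).symm
  rw [h2]
  simp

lemma getD_ofFn {n : ℕ} (v : Fin n → Bool) {j : ℕ} (hj : j < n) :
    (List.ofFn v).getD j false = v ⟨j, hj⟩ := by
  simp [hj]

lemma exists_eq_ofFn {n : ℕ} {σ : List Bool} (hσ : σ.length = n) :
    ∃ v : Fin n → Bool, σ = List.ofFn v := by
  subst hσ
  exact ⟨σ.get, by simp⟩

lemma mem_cyl_ofFn {n : ℕ} {v : Fin n → Bool} {x : Cantor} :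
    x ∈ cyl (List.ofFn v) ↔ ∀ i : Fin n, x i = v i := by
  simp only [cyl, Set.mem_ofPred_eq, restrict_eq_iff_getD]
  constructor
  · intro h i
    rw [h i (by simp), getD_ofFn]
  · intro h i hi
    rw [List.length_ofFn] at hi
    rw [h ⟨i, hi⟩, getD_ofFn v hi]

lemma pairwise_disjoint_cyl_ofFn (n : ℕ) :
    Pairwise (Function.onFun Disjoint fun v : Fin n → Bool => cyl (List.ofFn v)) := by
  intro v w hvw
  simp only [Function.onFun]
  rw [Set.disjoint_left]
  intro x h1 h2
  rw [mem_cyl_ofFn] at h1 h2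
  exact hvw (funext fun i => (h1 i).symm.trans (h2 i))

lemma sum_measureReal_cyl (μ : Measure Cantor) [IsProbabilityMeasure μ] (n : ℕ) :
    ∑ v : Fin n → Bool, μ.real (cyl (List.ofFn v)) = 1 := by
  rw [← measureReal_biUnion_finset (fun v _ w _ h => pairwise_disjoint_cyl_ofFn n h)
    (fun v _ => measurableSet_cyl _)]
  have : (⋃ v ∈ (Finset.univ : Finset (Fin n → Bool)), cyl (List.ofFn v)) = Set.univ := by
    ext x
    simp only [Set.mem_iUnion, Set.mem_univ, iff_true]
    exact ⟨fun i => x i, Finset.mem_univ _, mem_cyl_ofFn.2 fun _ => rfl⟩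
  rw [this]; simp

/-- Every measure has a good code. -/
lemma exists_tidy_near (μ : Measure Cantor) [IsProbabilityMeasure μ] : ∃ p, Tidy p ∧ Near 1 p μ := by
  have h : ∀ n : ℕ, ∃ f : Fin (4 ^ (n + 2)) → (Fin (n + 2) → Bool), ∀ v,
      |(((Finset.univ.filter fun x => f x = v).card : ℕ) : ℝ) -
        4 ^ (n + 2) * μ.real (cyl (List.ofFn v))| ≤ 1 := by
    intro n
    obtain ⟨k, hk, hk'⟩ := exists_rounding
      (fun v : Fin (n + 2) → Bool => 4 ^ (n + 2) * μ.real (cyl (List.ofFn v)))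
      (fun v => by positivity) (4 ^ (n + 2)) (by rw [← Finset.mul_sum, sum_measureReal_cyl]; simp)
    obtain ⟨f, hf⟩ := exists_fun_of_card k _ hk
    exact ⟨f, fun v => by rw [hf]; exact hk' v⟩
  choose f hf using h
  let p : Cantor := fun c =>
    if h : c.unpair.2.unpair.1 < 4 ^ (c.unpair.1 + 2) ∧ c.unpair.2.unpair.2 < c.unpair.1 + 2 then
      f c.unpair.1 ⟨_, h.1⟩ ⟨_, h.2⟩ else false
  have hp : ∀ n i j, p (Nat.pair n (Nat.pair i j)) =
      if h : i < 4 ^ (n + 2) ∧ j < n + 2 then f n ⟨i, h.1⟩ ⟨j, h.2⟩ else false := by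
    intro n i j
    simp only [p]
    congr! <;> simp
  refine ⟨p, fun n i j hij => ?_, fun n σ hσ => ?_⟩
  · rw [hp, dif_neg (by omega)]
  · obtain ⟨v, rfl⟩ := exists_eq_ofFn hσ
    have : cnt p n (List.ofFn v) = (Finset.univ.filter fun x => f n x = v).card := by
      unfold cnt
      symm
      refine Finset.card_bij (fun x _ => (x : ℕ)) ?_ ?_ ?_
      · intro x hx
        simp only [Finset.mem_filter, Finset.mem_univ, true_and] at hx
        simp only [Finset.mem_filter, Finset.mem_range, x.2, true_and, Hit, List.length_ofFn]
        intro j hj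
        rw [hp, dif_pos ⟨x.2, hj⟩, ← hx, getD_ofFn _ hj]
      · intro x _ y _ h; exact Fin.ext h
      · intro i hi
        simp only [Finset.mem_filter, Finset.mem_range, Hit, List.length_ofFn] at hi
        refine ⟨⟨i, hi.1⟩, ?_, rfl⟩
        simp only [Finset.mem_filter, Finset.mem_univ, true_and]
        funext j
        have := hi.2 j j.2
        rwa [hp, dif_pos ⟨hi.1, j.2⟩, getD_ofFn _ j.2] at this
    rw [this]
    exact hf n v

/-! ### The metric on measures -/

lemma levelDist_nonneg (μ ν : Measure Cantor) (n : ℕ) : 0 ≤ levelDist n μ ν := by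
  unfold levelDist; positivity

lemma measDist_comm (μ ν : Measure Cantor) : measDist μ ν = measDist ν μ := by
  unfold measDist levelDist
  simp only [abs_sub_comm]

lemma measDist_nonneg (μ ν : Measure Cantor) : 0 ≤ measDist μ ν :=
  tsum_nonneg fun n => mul_nonneg (by positivity) (levelDist_nonneg _ _ _)

section Dist

variable (μ ν ξ : Measure Cantor) [IsProbabilityMeasure μ] [IsProbabilityMeasure ν]
  [IsProbabilityMeasure ξ]

lemma levelDist_le_one (n : ℕ) : levelDist n μ ν ≤ 1 := by
  unfold levelDist
  have : ∑ σ : Fin n → Bool, |μ.real (cyl (List.ofFn σ)) - ν.real (cyl (List.ofFn σ))| ≤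
      ∑ σ : Fin n → Bool, (μ.real (cyl (List.ofFn σ)) + ν.real (cyl (List.ofFn σ))) := by
    refine Finset.sum_le_sum fun σ _ => ?_
    have h1 : 0 ≤ μ.real (cyl (List.ofFn σ)) := measureReal_nonneg
    have h2 : 0 ≤ ν.real (cyl (List.ofFn σ)) := measureReal_nonneg
    rw [abs_le]; constructor <;> linarith
  rw [Finset.sum_add_distrib, sum_measureReal_cyl, sum_measureReal_cyl] at this
  linarith

lemma summable_levelDist : Summable fun n : ℕ => (1 / 2 : ℝ) ^ (n + 1) * levelDist (n + 1) μ ν := by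
  refine Summable.of_nonneg_of_le (f := fun n : ℕ => (1 / 2 : ℝ) ^ (n + 1))
    (fun n => mul_nonneg (by positivity) (levelDist_nonneg _ _ _))
    (fun n => mul_le_of_le_one_right (by positivity) (levelDist_le_one _ _ _)) ?_
  exact (summable_nat_add_iff 1).2 summable_geometric_two

lemma measDist_triangle : measDist μ ξ ≤ measDist μ ν + measDist ν ξ := by
  unfold measDist
  rw [← (summable_levelDist μ ν).tsum_add (summable_levelDist ν ξ)]
  refine (summable_levelDist μ ξ).tsum_le_tsum (fun n => ?_)
    ((summable_levelDist μ ν).add (summable_levelDist ν ξ))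
  rw [← mul_add]
  gcongr
  unfold levelDist
  rw [← mul_add, ← Finset.sum_add_distrib]
  gcongr
  exact abs_sub_le _ _ _

lemma abs_sub_le_measDist (σ : List Bool) :
    |μ.real (cyl σ) - ν.real (cyl σ)| ≤ 2 ^ (σ.length + 1) * measDist μ ν := by
  rcases hl : σ.length with _ | n
  · rw [List.length_eq_zero_iff.1 hl, cyl_nil]
    have := measDist_nonneg μ ν
    simpa using this
  · obtain ⟨v, rfl⟩ := exists_eq_ofFn hl
    have h1 : (1 / 2 : ℝ) ^ (n + 1) * levelDist (n + 1) μ ν ≤ measDist μ ν :=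
      (summable_levelDist μ ν).le_tsum n
        (fun m _ => mul_nonneg (by positivity) (levelDist_nonneg _ _ _))
    have h2 : (1 / 2) * |μ.real (cyl (List.ofFn v)) - ν.real (cyl (List.ofFn v))| ≤
        levelDist (n + 1) μ ν := by
      unfold levelDist
      gcongr
      exact Finset.single_le_sum
        (f := fun σ : Fin (n + 1) → Bool =>
          |μ.real (cyl (List.ofFn σ)) - ν.real (cyl (List.ofFn σ))|)
        (fun _ _ => abs_nonneg _) (Finset.mem_univ v)
    have h3 : levelDist (n + 1) μ ν ≤ 2 ^ (n + 1) * measDist μ ν := by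
      have : (2 : ℝ) ^ (n + 1) * ((1 / 2 : ℝ) ^ (n + 1) * levelDist (n + 1) μ ν) =
          levelDist (n + 1) μ ν := by
        rw [← mul_assoc, ← mul_pow]; norm_num
      rw [← this]
      gcongr
    rw [pow_succ]
    linarith

/-- Measures that are close on all levels up to `N` are close. -/
lemma measDist_le (N : ℕ) (h : ∀ k ≤ N, levelDist k μ ν ≤ (1 / 2) ^ N) :
    measDist μ ν ≤ (1 / 2) ^ N + (1 / 2) ^ N := by
  unfold measDist
  have hs : Summable fun n : ℕ => (1 / 2 : ℝ) ^ (n + 1) :=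
    (summable_nat_add_iff 1).2 summable_geometric_two
  have ht : ∑' n : ℕ, (1 / 2 : ℝ) ^ (n + 1) = 1 := by
    have := tsum_geometric_two
    simp only [pow_succ]
    rw [tsum_mul_right, this]; norm_num
  rw [← (summable_levelDist μ ν).sum_add_tsum_nat_add N]
  refine add_le_add ?_ ?_
  · calc ∑ n ∈ Finset.range N, (1 / 2 : ℝ) ^ (n + 1) * levelDist (n + 1) μ ν
        ≤ ∑ n ∈ Finset.range N, (1 / 2 : ℝ) ^ (n + 1) * (1 / 2) ^ N := by
          refine Finset.sum_le_sum fun n hn => ?_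
          have := h (n + 1) (Finset.mem_range.1 hn)
          gcongr
      _ = (∑ n ∈ Finset.range N, (1 / 2 : ℝ) ^ (n + 1)) * (1 / 2) ^ N := by
          rw [Finset.sum_mul]
      _ ≤ 1 * (1 / 2) ^ N := by
          gcongr
          exact (hs.sum_le_tsum _ (fun _ _ => by positivity)).trans ht.le
      _ = (1 / 2) ^ N := one_mul _
  · calc ∑' n : ℕ, (1 / 2 : ℝ) ^ (n + N + 1) * levelDist (n + N + 1) μ ν
        ≤ ∑' n : ℕ, (1 / 2 : ℝ) ^ N * (1 / 2 : ℝ) ^ (n + 1) := by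
          refine Summable.tsum_le_tsum (fun n => ?_)
            ((summable_nat_add_iff N).2 (summable_levelDist μ ν)) (hs.mul_left _)
          rw [← pow_add, show N + (n + 1) = n + N + 1 by ring]
          exact mul_le_of_le_one_right (by positivity) (levelDist_le_one _ _ _)
      _ = (1 / 2) ^ N := by rw [tsum_mul_left, ht, mul_one]

end Dist

lemma Near.measDist_le {p : Cantor} (ht : Tidy p) {μ : Measure Cantor} [IsProbabilityMeasure μ]
    (h : Near 2 p μ) (n : ℕ) : measDist (approx p n) μ ≤ (1 / 2) ^ (n + 1) := by
  have h1 : ∀ k ≤ n + 2, levelDist k (approx p n) μ ≤ (1 / 2) ^ (n + 2) := by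
    intro k hk
    unfold levelDist
    have h4 : (0 : ℝ) < 4 ^ (n + 2) := by positivity
    have : ∀ v : Fin k → Bool, |(approx p n).real (cyl (List.ofFn v)) - μ.real (cyl (List.ofFn v))| ≤
        2 * 2 ^ (n + 2 - k) / 4 ^ (n + 2) := by
      intro v
      have h2 := h.abs_le (n := n) (σ := List.ofFn v) (by simpa using hk)
      rw [List.length_ofFn] at h2
      rw [approx_real_cyl ht]
      have : (cnt p n (List.ofFn v) : ℝ) / 4 ^ (n + 2) - μ.real (cyl (List.ofFn v)) =
          ((cnt p n (List.ofFn v) : ℝ) - 4 ^ (n + 2) * μ.real (cyl (List.ofFn v))) / 4 ^ (n + 2) := by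
        field_simp
      rw [this, abs_div, abs_of_pos h4]
      gcongr
    calc (1 / 2 : ℝ) * ∑ v : Fin k → Bool,
          |(approx p n).real (cyl (List.ofFn v)) - μ.real (cyl (List.ofFn v))|
        ≤ (1 / 2) * ∑ v : Fin k → Bool, (2 * 2 ^ (n + 2 - k) / 4 ^ (n + 2) : ℝ) := by
          gcongr with v
          exact this v
      _ = (2 ^ k * 2 ^ (n + 2 - k)) / 4 ^ (n + 2) := by
          simp; ring
      _ = (1 / 2) ^ (n + 2) := by
          rw [← pow_add, Nat.add_sub_cancel' hk, ← div_pow]; norm_num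
  refine (Cantor.measDist_le _ _ _ h1).trans (le_of_eq ?_)
  rw [pow_succ _ (n + 1)]; ring

lemma Near.represents {p : Cantor} (ht : Tidy p) {μ : ProbabilityMeasure Cantor}
    (h : Near 2 p μ) : Represents p μ := by
  refine ⟨⟨ht, fun n m hnm => ?_⟩, ?_⟩
  · refine (measDist_triangle _ (μ : Measure Cantor) _).trans ?_
    rw [measDist_comm (μ : Measure Cantor)]
    have h1 := h.measDist_le ht n
    have h2 := h.measDist_le ht m
    have h3 : (1 / 2 : ℝ) ^ (m + 1) ≤ (1 / 2) ^ (n + 1) :=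
      pow_le_pow_of_le_one (by norm_num) (by norm_num) (by omega)
    have h4 : (1 / 2 : ℝ) ^ n = (1 / 2) ^ (n + 1) + (1 / 2) ^ (n + 1) := by rw [pow_succ]; ring
    linarith
  · refine squeeze_zero (fun n => measDist_nonneg _ _) (fun n => h.measDist_le ht n) ?_
    exact (tendsto_pow_atTop_nhds_zero_of_lt_one (by norm_num) (by norm_num)).comp
      (tendsto_add_atTop_nat 1)

lemma Represents.abs_sub_le {p : Cantor} {μ : ProbabilityMeasure Cantor} (h : Represents p μ)
    (n : ℕ) (σ : List Bool) :
    |(cnt p n σ : ℝ) / 4 ^ (n + 2) - (μ : Measure Cantor).real (cyl σ)| ≤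
      2 ^ (σ.length + 1) * (1 / 2) ^ n := by
  rw [← approx_real_cyl h.1.1]
  refine (abs_sub_le_measDist _ _ σ).trans ?_
  gcongr
  have h1 : Tendsto (fun m => (1 / 2 : ℝ) ^ n + measDist (approx p m) (μ : Measure Cantor)) atTop
      (𝓝 ((1 / 2 : ℝ) ^ n + 0)) := h.2.const_add _
  rw [add_zero] at h1
  refine ge_of_tendsto h1 ?_
  filter_upwards [eventually_ge_atTop n] with m hm
  refine (measDist_triangle _ (approx p m) _).trans ?_
  linarith [h.1.2 n m hm]

end Cantor

/-! ### Effectivity of the counts -/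

lemma primrec_pow (b : ℕ) : Primrec fun n : ℕ => b ^ n := by
  have : Primrec fun n : ℕ => (Nat.rec 1 (fun _ x => x * b) n : ℕ) :=
    Primrec.nat_rec₁ 1 (Primrec.nat_mul.comp Primrec.snd (Primrec.const b))
  refine this.of_eq fun n => ?_
  induction n with
  | zero => rfl
  | succ n ih => rw [pow_succ, ← ih]

lemma primrec_sum_map {α β : Type*} [Primcodable α] [Primcodable β] {L : α → List β}
    {f : α → β → ℕ} (hL : Primrec L) (hf : Primrec₂ f) : Primrec fun a => ((L a).map (f a)).sum := by
  have : Primrec fun l : List ℕ => l.foldr (fun b s => b + s) 0 := by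
    refine Primrec.list_foldr (f := fun l : List ℕ => l) (g := fun _ => 0)
      (h := fun _ (z : ℕ × ℕ) => z.1 + z.2) Primrec.id (Primrec.const 0) ?_
    exact Primrec.nat_add.comp (Primrec.fst.comp Primrec.snd) (Primrec.snd.comp Primrec.snd)
  exact (this.comp (Primrec.list_map hL hf)).of_eq fun a => rfl

namespace Cantor

variable {α : Type*} [Primcodable α]

lemma primrec_padZero : Primrec₂ padZero :=
  (Primrec.list_getD false)

lemma primrec_pair₃ {f g h : α → ℕ} (hf : Primrec f) (hg : Primrec g) (hh : Primrec h) :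
    Primrec fun a => Nat.pair (f a) (Nat.pair (g a) (h a)) :=
  Primrec₂.natPair.comp hf (Primrec₂.natPair.comp hg hh)

lemma primrec_four_pow {f : α → ℕ} (hf : Primrec f) : Primrec fun a => 4 ^ (f a + 2) :=
  (primrec_pow 4).comp (Primrec.nat_add.comp hf (Primrec.const 2))

lemma primrec_bitBound {f g : α → ℕ} (hf : Primrec f) (hg : Primrec g) :
    Primrec fun a => bitBound (f a) (g a) :=
  primrec_pair₃ hf (primrec_four_pow hf) hg

lemma primrecRel_hit : PrimrecRel fun (i : ℕ) (a : List Bool × ℕ × List Bool) =>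
    Hit (padZero a.1) a.2.1 i a.2.2 := by
  refine PrimrecPred.ball_lt (α := ℕ × List Bool × ℕ × List Bool)
    (R := fun c => padZero c.1.2.1 (Nat.pair c.1.2.2.1 (Nat.pair c.1.1 c.2)) =
      c.1.2.2.2.getD c.2 false) (f := fun c => c.2.2.2.length) ?_ ?_
  · have h := Primrec.fst (α := ℕ × List Bool × ℕ × List Bool) (β := ℕ)
    have h2 := Primrec.snd.comp h
    have h22 := Primrec.snd.comp h2
    refine Primrec.eq.comp (primrec_padZero.comp (Primrec.fst.comp h2) ?_)
      ((Primrec.list_getD false).comp (Primrec.snd.comp h22) Primrec.snd)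
    exact primrec_pair₃ (Primrec.fst.comp h22) (Primrec.fst.comp h) Primrec.snd
  · exact Primrec.list_length.comp (Primrec.snd.comp (Primrec.snd.comp Primrec.snd))

lemma primrec_cnt {ρ σ : α → List Bool} {n : α → ℕ} (hρ : Primrec ρ) (hn : Primrec n)
    (hσ : Primrec σ) : Primrec fun a => cnt (padZero (ρ a)) (n a) (σ a) := by
  have h1 := Primrec.list_length.comp (primrecRel_hit.listFilter.comp
    (Primrec.list_range.comp (primrec_four_pow hn)) (hρ.pair (hn.pair hσ)))
  refine h1.of_eq fun a => ?_
  unfold cnt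
  rfl

/-! ### Effectively closed conditions on codes -/

/-- The string `ρ` shows that no extension of it is tidy. -/
def BadTidy (c : List Bool × ℕ × ℕ × ℕ) : Prop :=
  (4 ^ (c.2.1 + 2) ≤ c.2.2.1 ∨ c.2.1 + 2 ≤ c.2.2.2) ∧
    padZero c.1 (Nat.pair c.2.1 (Nat.pair c.2.2.1 c.2.2.2)) = true

lemma primrecPred_badTidy : PrimrecPred BadTidy := by
  have h2 := Primrec.snd (α := List Bool) (β := ℕ × ℕ × ℕ)
  have hn := Primrec.fst.comp h2
  have hi := Primrec.fst.comp (Primrec.snd.comp h2)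
  have hj := Primrec.snd.comp (Primrec.snd.comp h2)
  refine PrimrecPred.and (PrimrecPred.or ?_ ?_) ?_
  · exact Primrec.nat_le.comp (primrec_four_pow hn) hi
  · exact Primrec.nat_le.comp (Primrec.nat_add.comp hn (Primrec.const 2)) hj
  · exact Primrec.eq.comp (primrec_padZero.comp Primrec.fst (primrec_pair₃ hn hi hj))
      (Primrec.const true)

/-- The string `ρ` shows that the counts of its extensions violate the requirements on good
codes. -/
def BadCnt (c : List Bool × ℕ × ℕ × List Bool) : Prop :=
  (c.2.2.2.length = c.2.1 + 2 ∧ bitBound (c.2.1 + c.2.2.1) c.2.2.2.length ≤ c.1.length ∧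
    bitBound c.2.1 c.2.2.2.length ≤ c.1.length) ∧
  ¬ (cnt (padZero c.1) (c.2.1 + c.2.2.1) c.2.2.2 ≤
        4 ^ c.2.2.1 * cnt (padZero c.1) c.2.1 c.2.2.2 + 2 * 4 ^ c.2.2.1 ∧
      4 ^ c.2.2.1 * cnt (padZero c.1) c.2.1 c.2.2.2 ≤
        cnt (padZero c.1) (c.2.1 + c.2.2.1) c.2.2.2 + 2 * 4 ^ c.2.2.1)

lemma primrecPred_badCnt : PrimrecPred BadCnt := by
  have h2 := Primrec.snd (α := List Bool) (β := ℕ × ℕ × List Bool)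
  have hρ := Primrec.fst (α := List Bool) (β := ℕ × ℕ × List Bool)
  have hn := Primrec.fst.comp h2
  have hk := Primrec.fst.comp (Primrec.snd.comp h2)
  have hσ := Primrec.snd.comp (Primrec.snd.comp h2)
  have hl := Primrec.list_length.comp hσ
  have hnk := Primrec.nat_add.comp hn hk
  have h4 := (primrec_pow 4).comp hk
  have h24 := Primrec.nat_mul.comp (Primrec.const 2) h4
  have hc := primrec_cnt hρ hn hσ
  have hc' := primrec_cnt hρ hnk hσ
  have hm := Primrec.nat_mul.comp h4 hc
  have hρl := Primrec.list_length.comp hρ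
  refine PrimrecPred.and (PrimrecPred.and ?_ (PrimrecPred.and ?_ ?_))
    (PrimrecPred.not (PrimrecPred.and ?_ ?_))
  · exact Primrec.eq.comp hl (Primrec.nat_add.comp hn (Primrec.const 2))
  · exact Primrec.nat_le.comp (primrec_bitBound hnk hl) hρl
  · exact Primrec.nat_le.comp (primrec_bitBound hn hl) hρl
  · exact Primrec.nat_le.comp hc' (Primrec.nat_add.comp hm h24)
  · exact Primrec.nat_le.comp hm (Primrec.nat_add.comp hc' h24)

/-- No extension of the string is a good code. -/
def BadCode (ρ : List Bool) : Prop := (∃ t, BadTidy (ρ, t)) ∨ ∃ t, BadCnt (ρ, t)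

lemma sig_badCode : Sig BadCode :=
  primrecPred_badTidy.sig.ex.or primrecPred_badCnt.sig.ex

lemma padZero_restrict_eq_true {p : Cantor} {s k : ℕ} (h : padZero (p.restrict s) k = true) :
    p k = true := by
  unfold padZero at h
  by_cases hk : k < s
  · rwa [restrict_getD p hk] at h
  · rw [List.getD_eq_default _ _ (by simpa using hk)] at h
    simp at h

lemma good_iff {p : Cantor} : Good p ↔ ∀ s, ¬ BadCode (p.restrict s) := by
  constructor
  · rintro hp s (⟨⟨n, i, j⟩, h1, h2⟩ | ⟨⟨n, k, σ⟩, ⟨h1, h2, h3⟩, h4⟩)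
    · have := padZero_restrict_eq_true h2
      rw [hp.1 n i j h1] at this
      simp at this
    · simp only [length_restrict] at h1 h2 h3 h4
      rw [cnt_padZero_restrict h2, cnt_padZero_restrict h3] at h4
      exact h4 (hp.2 n k σ h1)
  · intro h
    refine ⟨fun n i j hij => ?_, fun n k σ hσ => ?_⟩
    · by_contra hb
      rw [Bool.not_eq_false] at hb
      refine h (Nat.pair n (Nat.pair i j) + 1) (Or.inl ⟨(n, i, j), hij, ?_⟩)
      unfold padZero
      simp only
      rw [restrict_getD p (Nat.lt_succ_self _)]
      exact hb
    · by_contra hb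
      refine h (max (bitBound (n + k) σ.length) (bitBound n σ.length))
        (Or.inr ⟨(n, k, σ), ⟨hσ, by simp, by simp⟩, ?_⟩)
      simp only
      rwa [cnt_padZero_restrict (le_max_left _ _), cnt_padZero_restrict (le_max_right _ _)]

/-- Two codes have close counts; for good codes this means that they code the same measure. -/
def Sim (p q : Cantor) : Prop :=
  ∀ n σ, σ.length = n + 2 → cnt p n σ ≤ cnt q n σ + 4 ∧ cnt q n σ ≤ cnt p n σ + 4

/-- Extensions of the two strings have counts that are not close. -/
def Differ (ρ η : List Bool) : Prop :=
  ∃ t : ℕ × List Bool, (t.2.length = t.1 + 2 ∧ bitBound t.1 t.2.length ≤ ρ.length ∧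
    bitBound t.1 t.2.length ≤ η.length) ∧
    ¬ (cnt (padZero ρ) t.1 t.2 ≤ cnt (padZero η) t.1 t.2 + 4 ∧
      cnt (padZero η) t.1 t.2 ≤ cnt (padZero ρ) t.1 t.2 + 4)

lemma sig_differ : Sig fun a : List Bool × List Bool => Differ a.1 a.2 := by
  refine Sig.ex (A := fun c : (List Bool × List Bool) × ℕ × List Bool =>
    (c.2.2.length = c.2.1 + 2 ∧ bitBound c.2.1 c.2.2.length ≤ c.1.1.length ∧
      bitBound c.2.1 c.2.2.length ≤ c.1.2.length) ∧
    ¬ (cnt (padZero c.1.1) c.2.1 c.2.2 ≤ cnt (padZero c.1.2) c.2.1 c.2.2 + 4 ∧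
      cnt (padZero c.1.2) c.2.1 c.2.2 ≤ cnt (padZero c.1.1) c.2.1 c.2.2 + 4))
    (PrimrecPred.sig ?_)
  have h1 := Primrec.fst (α := List Bool × List Bool) (β := ℕ × List Bool)
  have h2 := Primrec.snd (α := List Bool × List Bool) (β := ℕ × List Bool)
  have hρ := Primrec.fst.comp h1
  have hη := Primrec.snd.comp h1
  have hn := Primrec.fst.comp h2
  have hσ := Primrec.snd.comp h2
  have hl := Primrec.list_length.comp hσ
  have hb := primrec_bitBound hn hl
  have hc := primrec_cnt hρ hn hσ
  have hc' := primrec_cnt hη hn hσ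
  refine PrimrecPred.and (PrimrecPred.and ?_ (PrimrecPred.and ?_ ?_))
    (PrimrecPred.not (PrimrecPred.and ?_ ?_))
  · exact Primrec.eq.comp hl (Primrec.nat_add.comp hn (Primrec.const 2))
  · exact Primrec.nat_le.comp hb (Primrec.list_length.comp hρ)
  · exact Primrec.nat_le.comp hb (Primrec.list_length.comp hη)
  · exact Primrec.nat_le.comp hc (Primrec.nat_add.comp hc' (Primrec.const 4))
  · exact Primrec.nat_le.comp hc' (Primrec.nat_add.comp hc (Primrec.const 4))

lemma Sim.not_differ {p q : Cantor} (h : Sim p q) (s t : ℕ) :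
    ¬ Differ (p.restrict s) (q.restrict t) := by
  rintro ⟨⟨n, σ⟩, ⟨h1, h2, h3⟩, h4⟩
  simp only [length_restrict] at h1 h2 h3 h4
  rw [cnt_padZero_restrict h2, cnt_padZero_restrict h3] at h4
  exact h4 (h n σ h1)

lemma Differ.mono {ρ : List Bool} {q : Cantor} {s t : ℕ} (h : Differ ρ (q.restrict s)) (hst : s ≤ t) :
    Differ ρ (q.restrict t) := by
  obtain ⟨⟨n, σ⟩, ⟨h1, h2, h3⟩, h4⟩ := h
  simp only [length_restrict] at h1 h2 h3 h4
  refine ⟨(n, σ), ⟨h1, h2, by simpa using h3.trans hst⟩, ?_⟩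
  simp only
  rw [cnt_padZero_restrict h3] at h4
  rwa [cnt_padZero_restrict (h3.trans hst)]

lemma exists_differ {p q : Cantor} (h : ¬ Sim p q) :
    ∃ s, Differ (p.restrict s) (q.restrict s) := by
  unfold Sim at h
  push Not at h
  obtain ⟨n, σ, hσ, h⟩ := h
  refine ⟨bitBound n σ.length, (n, σ), ⟨hσ, by simp, by simp⟩, ?_⟩
  simp only
  rw [cnt_padZero_restrict le_rfl, cnt_padZero_restrict le_rfl]
  intro hcon
  exact absurd (h hcon.1) (not_lt.2 hcon.2)

lemma Near.sim {p q : Cantor} {μ : Measure Cantor} (hp : Near 2 p μ) (hq : Near 2 q μ) : Sim p q := by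
  intro n σ hσ
  have h1 := _root_.abs_le.1 (hp n σ hσ)
  have h2 := _root_.abs_le.1 (hq n σ hσ)
  constructor
  · have : (cnt p n σ : ℝ) ≤ cnt q n σ + 4 := by linarith
    exact_mod_cast this
  · have : (cnt q n σ : ℝ) ≤ cnt p n σ + 4 := by linarith
    exact_mod_cast this

lemma Sim.near {p q : Cantor} (h : Sim p q) (hp : Good p) {μ : Measure Cantor} [IsFiniteMeasure μ]
    (hq : Near 2 q μ) : Near 2 p μ := by
  obtain ⟨ν, hν⟩ := hp.exists_near
  have h6 : Near 6 p μ := by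
    intro n σ hσ
    have h1 := _root_.abs_le.1 (hq n σ hσ)
    obtain ⟨h2, h3⟩ := h n σ hσ
    have h2 : (cnt p n σ : ℝ) ≤ cnt q n σ + 4 := by exact_mod_cast h2
    have h3 : (cnt q n σ : ℝ) ≤ cnt p n σ + 4 := by exact_mod_cast h3
    rw [_root_.abs_le]
    constructor <;> linarith
  intro n σ hσ
  rw [← hν.unique h6]
  exact hν n σ hσ

/-- Every extension of `ρ` that is a good code assigns to `σ` a measure greater than `B / 2 ^ k`. -/
def Exceeds (B k : ℕ) (σ ρ : List Bool) : Prop :=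
  ∃ t : ℕ, (σ.length ≤ t + 2 ∧ bitBound t σ.length ≤ ρ.length) ∧
    B * 4 ^ (t + 2) + 2 ^ k * 2 ^ (t + 3) < 2 ^ k * cnt (padZero ρ) t σ

lemma sig_exceeds (B k : ℕ) : Sig fun a : List Bool × List Bool => Exceeds B k a.1 a.2 := by
  refine Sig.ex (A := fun c : (List Bool × List Bool) × ℕ =>
    (c.1.1.length ≤ c.2 + 2 ∧ bitBound c.2 c.1.1.length ≤ c.1.2.length) ∧
      B * 4 ^ (c.2 + 2) + 2 ^ k * 2 ^ (c.2 + 3) < 2 ^ k * cnt (padZero c.1.2) c.2 c.1.1)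
    (PrimrecPred.sig ?_)
  have h1 := Primrec.fst (α := List Bool × List Bool) (β := ℕ)
  have ht := Primrec.snd (α := List Bool × List Bool) (β := ℕ)
  have hσ := Primrec.fst.comp h1
  have hρ := Primrec.snd.comp h1
  have hl := Primrec.list_length.comp hσ
  refine PrimrecPred.and (PrimrecPred.and ?_ ?_) ?_
  · exact Primrec.nat_le.comp hl (Primrec.nat_add.comp ht (Primrec.const 2))
  · exact Primrec.nat_le.comp (primrec_bitBound ht hl) (Primrec.list_length.comp hρ)
  · refine Primrec.nat_lt.comp (Primrec.nat_add.comp ?_ ?_) ?_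
    · exact Primrec.nat_mul.comp (Primrec.const B) (primrec_four_pow ht)
    · exact Primrec.nat_mul.comp (Primrec.const _)
        ((primrec_pow 2).comp (Primrec.nat_add.comp ht (Primrec.const 3)))
    · exact Primrec.nat_mul.comp (Primrec.const _) (primrec_cnt hρ ht hσ)

lemma Near.abs_le_pow {p : Cantor} {μ : Measure Cantor} [IsFiniteMeasure μ] (h : Near 2 p μ)
    {n : ℕ} {σ : List Bool} (hσ : σ.length ≤ n + 2) :
    |(cnt p n σ : ℝ) - 4 ^ (n + 2) * μ.real (cyl σ)| ≤ 2 ^ (n + 3) := by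
  refine (h.abs_le hσ).trans ?_
  rw [show n + 3 = (n + 2) + 1 by ring, pow_succ']
  gcongr
  · norm_num
  · omega

lemma tendsto_two_pow_div_four_pow :
    Tendsto (fun t : ℕ => (2 : ℝ) ^ (t + 3) / 4 ^ (t + 2)) atTop (𝓝 0) := by
  have h1 : Tendsto (fun t : ℕ => (1 / 2 : ℝ) ^ (t + 1)) atTop (𝓝 0) :=
    (tendsto_pow_atTop_nhds_zero_of_lt_one (by norm_num) (by norm_num)).comp
      (tendsto_add_atTop_nat 1)
  refine h1.congr fun t => ?_
  rw [show (4 : ℝ) = 2 * 2 by norm_num, mul_pow, show t + 3 = (t + 2) + 1 by ring, pow_succ 2 (t + 2),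
    show t + 2 = (t + 1) + 1 by ring, pow_succ 2 (t + 1), one_div, inv_pow]
  field_simp

lemma Near.exceeds_iff {p : Cantor} {μ : Measure Cantor} [IsFiniteMeasure μ] (h : Near 2 p μ)
    {B k : ℕ} {σ : List Bool} :
    (∃ s, Exceeds B k σ (p.restrict s)) ↔ (B : ℝ) < 2 ^ k * μ.real (cyl σ) := by
  constructor
  · rintro ⟨s, t, ⟨h1, h2⟩, h3⟩
    rw [length_restrict] at h2
    rw [cnt_padZero_restrict h2] at h3
    have h3 : (B : ℝ) * 4 ^ (t + 2) + 2 ^ k * 2 ^ (t + 3) < 2 ^ k * cnt p t σ := by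
      exact_mod_cast h3
    have h4 := (_root_.abs_le.1 (h.abs_le_pow h1)).2
    have h5 : (2 : ℝ) ^ k * cnt p t σ ≤ 2 ^ k * (4 ^ (t + 2) * μ.real (cyl σ) + 2 ^ (t + 3)) := by
      gcongr; linarith
    have h6 : (B : ℝ) * 4 ^ (t + 2) < (2 ^ k * μ.real (cyl σ)) * 4 ^ (t + 2) := by nlinarith
    exact lt_of_mul_lt_mul_right h6 (by positivity)
  · intro hB
    have h1 : Tendsto (fun t : ℕ => (2 : ℝ) ^ k * (cnt p t σ / 4 ^ (t + 2)) -
        2 ^ k * (2 ^ (t + 3) / 4 ^ (t + 2))) atTop (𝓝 (2 ^ k * μ.real (cyl σ) - 2 ^ k * 0)) :=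
      ((h.tendsto σ).const_mul _).sub (tendsto_two_pow_div_four_pow.const_mul _)
    rw [mul_zero, sub_zero] at h1
    obtain ⟨t, h2, h3⟩ := ((h1.eventually (lt_mem_nhds hB)).and
      (eventually_ge_atTop σ.length)).exists
    refine ⟨bitBound t σ.length, t, ⟨by omega, by simp⟩, ?_⟩
    rw [cnt_padZero_restrict le_rfl]
    have h4 : (0 : ℝ) < 4 ^ (t + 2) := by positivity
    have h5 : (B : ℝ) * 4 ^ (t + 2) + 2 ^ k * 2 ^ (t + 3) < 2 ^ k * cnt p t σ := by
      have h6 : (2 : ℝ) ^ k * (cnt p t σ / 4 ^ (t + 2)) - 2 ^ k * (2 ^ (t + 3) / 4 ^ (t + 2)) =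
          (2 ^ k * cnt p t σ - 2 ^ k * 2 ^ (t + 3)) / 4 ^ (t + 2) := by ring
      rw [h6, lt_div_iff₀ h4] at h2
      linarith
    exact_mod_cast h5

open Nat.Partrec (Code)

/-! ### Capturing: a universal uniform test -/

/-- The level of the test enumerated by `c` that is used. -/
def level (c : Code) : ℕ := Encodable.encode c + 3

/-- The program `c` enumerates `σ` into the chosen level of its test within `j` steps. -/
def Enters (c : Code) (j : ℕ) (ρ σ : List Bool) : Prop :=
  ∃ s < j, ∃ k < j,
    (Code.evaln k c (Encodable.encode (ρ.take s, (level c, σ)))).isSome = true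

lemma primrecPred_enters :
    PrimrecPred fun a : List Bool × Code × ℕ × List Bool => Enters a.2.1 a.2.2.1 a.2.2.2 a.1 := by
  let T := List Bool × Code × ℕ × List Bool
  refine PrimrecPred.bex_lt (α := T) (R := fun z : T × ℕ => ∃ k < z.1.2.2.1,
    (Code.evaln k z.1.2.1 (Encodable.encode
      (z.1.2.2.2.take z.2, (level z.1.2.1, z.1.1)))).isSome = true)
    (f := fun a => a.2.2.1) ?_ (Primrec.fst.comp (Primrec.snd.comp Primrec.snd))
  refine PrimrecPred.bex_lt (α := T × ℕ) (R := fun z : (T × ℕ) × ℕ =>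
    (Code.evaln z.2 z.1.1.2.1 (Encodable.encode
      (z.1.1.2.2.2.take z.1.2, (level z.1.1.2.1, z.1.1.1)))).isSome = true)
    (f := fun z => z.1.2.2.1) ?_
    (Primrec.fst.comp (Primrec.snd.comp (Primrec.snd.comp Primrec.fst)))
  have ha : Primrec fun z : (T × ℕ) × ℕ => z.1.1 := Primrec.fst.comp Primrec.fst
  have hc : Primrec fun z : (T × ℕ) × ℕ => z.1.1.2.1 := Primrec.fst.comp (Primrec.snd.comp ha)
  have hρ : Primrec fun z : (T × ℕ) × ℕ => z.1.1.2.2.2 :=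
    Primrec.snd.comp (Primrec.snd.comp (Primrec.snd.comp ha))
  have hs : Primrec fun z : (T × ℕ) × ℕ => z.1.2 := Primrec.snd.comp Primrec.fst
  have hlev : Primrec fun z : (T × ℕ) × ℕ => level z.1.1.2.1 :=
    Primrec.nat_add.comp (Primrec.encode.comp hc) (Primrec.const 3)
  refine primrecPred_evaln.comp (f := fun z : (T × ℕ) × ℕ => ((z.2, z.1.1.2.1), Encodable.encode
      (z.1.1.2.2.2.take z.1.2, (level z.1.1.2.1, z.1.1.1)))) ?_
  refine (Primrec.snd.pair hc).pair (Primrec.encode.comp ?_)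
  exact (Primrec.list_take.comp hs hρ).pair (hlev.pair (Primrec.fst.comp ha))

open Classical in
/-- The finite list of strings enumerated by `c` within `j` steps. -/
def enumList (c : Code) (j : ℕ) (ρ : List Bool) : List (List Bool) :=
  ((List.range j).filterMap (Encodable.decode₂ (List Bool))).filter
    fun σ => Enters c j ρ σ

lemma primrec_enumList : Primrec fun a : Code × ℕ × List Bool => enumList a.1 a.2.1 a.2.2 := by
  classical
  have h1 : PrimrecRel fun (σ : List Bool) (a : Code × ℕ × List Bool) => Enters a.1 a.2.1 a.2.2 σ :=
    primrecPred_enters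
  have h2 : Primrec fun a : Code × ℕ × List Bool =>
      (List.range a.2.1).filterMap (Encodable.decode₂ (List Bool)) :=
    Primrec.listFilterMap (Primrec.list_range.comp (Primrec.fst.comp Primrec.snd))
      (Primrec.decode₂.comp Primrec.snd)
  refine (h1.listFilter.comp h2 Primrec.id).of_eq fun a => ?_
  unfold enumList
  congr!

lemma mem_enumList {c : Code} {j : ℕ} {ρ σ : List Bool} :
    σ ∈ enumList c j ρ ↔ Encodable.encode σ < j ∧ Enters c j ρ σ := by
  unfold enumList
  simp only [List.mem_filter, List.mem_filterMap, List.mem_range, decide_eq_true_eq]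
  refine and_congr_left fun _ => ?_
  constructor
  · rintro ⟨i, hi, h⟩
    rwa [Encodable.mem_decode₂.1 h]
  · intro h
    exact ⟨_, h, Encodable.encodek₂ σ⟩

lemma nodup_enumList (c : Code) (j : ℕ) (ρ : List Bool) : (enumList c j ρ).Nodup := by
  unfold enumList
  refine List.Nodup.filter _ (List.Nodup.filterMap ?_ List.nodup_range)
  intro i i' σ h h'
  rw [← Encodable.mem_decode₂.1 h, ← Encodable.mem_decode₂.1 h']

lemma enumList_restrict {c : Code} {j s : ℕ} {p : Cantor} (h : j ≤ s) :
    enumList c j (p.restrict s) = enumList c j (p.restrict j) := by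
  have : ∀ σ, Enters c j (p.restrict s) σ ↔ Enters c j (p.restrict j) σ := by
    intro σ
    unfold Enters
    refine exists_congr fun t => and_congr_right fun ht => ?_
    rw [take_restrict p (by omega), take_restrict p (by omega)]
  unfold enumList
  exact List.filter_congr fun σ _ => decide_eq_decide.2 (this σ)

lemma enumList_mono {c : Code} {j j' : ℕ} {p : Cantor} (h : j ≤ j') :
    enumList c j (p.restrict j) ⊆ enumList c j' (p.restrict j') := by
  intro σ hσ
  rw [mem_enumList] at hσ ⊢
  obtain ⟨h1, s, hs, k, hk, h2⟩ := hσ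
  refine ⟨h1.trans_le h, s, hs.trans_le h, k, hk.trans_le h, ?_⟩
  rw [take_restrict p (by omega)] at h2 ⊢
  exact h2

/-- The strings enumerated by `c` within `j` steps have small total measure, as is verified by
the counts in block `t`. -/
def Light (c : Code) (j t : ℕ) (ρ : List Bool) : Prop :=
  (j ≤ ρ.length ∧ ∀ τ ∈ enumList c j ρ, τ.length ≤ t + 2 ∧ bitBound t τ.length ≤ ρ.length) ∧
    2 ^ level c * ((enumList c j ρ).map fun τ => cnt (padZero ρ) t τ + 2 ^ (t + 3)).sum ≤
      2 * 4 ^ (t + 2)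

/-- The code `c` captures the cylinder of `σ` with oracle `ρ`. -/
def CaptureAt (c : Code) (σ ρ : List Bool) : Prop :=
  ∃ jt : ℕ × ℕ, Light c jt.1 jt.2 ρ ∧ ∃ τ ∈ enumList c jt.1 ρ, τ <+: σ

/-- The cylinder of `σ` is captured with oracle `ρ`. -/
def Capture (σ ρ : List Bool) : Prop := ∃ c, CaptureAt c σ ρ

lemma sig_capture : Sig fun a : List Bool × List Bool => Capture a.1 a.2 := by
  let T := (((List Bool × List Bool) × Code) × ℕ × ℕ)
  have key : PrimrecPred fun z : T => Light z.1.2 z.2.1 z.2.2 z.1.1.2 ∧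
      ∃ τ ∈ enumList z.1.2 z.2.1 z.1.1.2, τ <+: z.1.1.1 := by
    have hσ : Primrec fun z : T => z.1.1.1 := Primrec.fst.comp (Primrec.fst.comp Primrec.fst)
    have hρ : Primrec fun z : T => z.1.1.2 := Primrec.snd.comp (Primrec.fst.comp Primrec.fst)
    have hc : Primrec fun z : T => z.1.2 := Primrec.snd.comp Primrec.fst
    have hj : Primrec fun z : T => z.2.1 := Primrec.fst.comp Primrec.snd
    have ht : Primrec fun z : T => z.2.2 := Primrec.snd.comp Primrec.snd
    have hE : Primrec fun z : T => enumList z.1.2 z.2.1 z.1.1.2 :=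
      primrec_enumList.comp (hc.pair (hj.pair hρ))
    have hρl := Primrec.list_length.comp hρ
    have ht3 : Primrec fun z : T => 2 ^ (z.2.2 + 3) :=
      (primrec_pow 2).comp (Primrec.nat_add.comp ht (Primrec.const 3))
    refine PrimrecPred.and (PrimrecPred.and (PrimrecPred.and ?_ ?_) ?_) ?_
    · exact Primrec.nat_le.comp hj hρl
    · refine PrimrecPred.ball (R := fun y : T × List Bool => y.2.length ≤ y.1.2.2 + 2 ∧
        bitBound y.1.2.2 y.2.length ≤ y.1.1.1.2.length) ?_ hE
      have hl := Primrec.list_length.comp (Primrec.snd (α := T) (β := List Bool))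
      exact PrimrecPred.and
        (Primrec.nat_le.comp hl (Primrec.nat_add.comp (ht.comp Primrec.fst) (Primrec.const 2)))
        (Primrec.nat_le.comp (primrec_bitBound (ht.comp Primrec.fst) hl) (hρl.comp Primrec.fst))
    · refine Primrec.nat_le.comp (Primrec.nat_mul.comp ?_ ?_)
        (Primrec.nat_mul.comp (Primrec.const 2) (primrec_four_pow ht))
      · exact (primrec_pow 2).comp (Primrec.nat_add.comp (Primrec.encode.comp hc) (Primrec.const 3))
      · refine primrec_sum_map (f := fun (z : T) τ => cnt (padZero z.1.1.2) z.2.2 τ + 2 ^ (z.2.2 + 3))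
          hE ?_
        exact Primrec.nat_add.comp
          (primrec_cnt (hρ.comp Primrec.fst) (ht.comp Primrec.fst) Primrec.snd)
          (ht3.comp Primrec.fst)
    · refine PrimrecPred.bex (R := fun y : T × List Bool => y.2 <+: y.1.1.1.1) ?_ hE
      refine PrimrecPred.of_eq (p := fun y : T × List Bool =>
        y.2 = y.1.1.1.1.take y.2.length) ?_ fun y => List.prefix_iff_eq_take.symm
      exact Primrec.eq.comp Primrec.snd (Primrec.list_take.comp
        (Primrec.list_length.comp Primrec.snd) (hσ.comp Primrec.fst))
  exact key.sig.ex.ex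

lemma Capture.mono {σ σ' ρ : List Bool} (h : σ <+: σ') (hc : Capture σ ρ) : Capture σ' ρ := by
  obtain ⟨c, jt, h1, τ, h2, h3⟩ := hc
  exact ⟨c, jt, h1, τ, h2, h3.trans h⟩

/-- The real `y` is captured by the code `c` with oracle `p`. -/
def CapturedBy (c : Code) (p y : Cantor) : Prop := ∃ s n, CaptureAt c (y.restrict n) (p.restrict s)

/-- The real `y` is captured with oracle `p`. -/
def Captured (p y : Cantor) : Prop := ∃ s n, Capture (y.restrict n) (p.restrict s)

lemma captured_iff {p y : Cantor} : Captured p y ↔ ∃ c, CapturedBy c p y := by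
  unfold Captured CapturedBy Capture
  constructor
  · rintro ⟨s, n, c, h⟩; exact ⟨c, s, n, h⟩
  · rintro ⟨c, s, n, h⟩; exact ⟨s, n, c, h⟩

/-- The total measure of the strings enumerated by `c` within `j` steps is small. -/
def Small (μ : Measure Cantor) (c : Code) (p : Cantor) (j : ℕ) : Prop :=
  ((enumList c j (p.restrict j)).map fun τ => μ.real (cyl τ)).sum ≤ 2 * (1 / 2) ^ level c

lemma Near.small {p : Cantor} {μ : Measure Cantor} [IsFiniteMeasure μ] (h : Near 2 p μ) {c : Code}
    {j t s : ℕ} (hL : Light c j t (p.restrict s)) : Small μ c p j := by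
  obtain ⟨⟨h1, h2⟩, h3⟩ := hL
  rw [length_restrict] at h1
  rw [enumList_restrict h1] at h2 h3
  unfold Small
  set L := enumList c j (p.restrict j)
  have h4 : (4 : ℝ) ^ (t + 2) * (L.map fun τ => μ.real (cyl τ)).sum ≤
      ((L.map fun τ => cnt (padZero (p.restrict s)) t τ + 2 ^ (t + 3)).sum : ℕ) := by
    clear_value L
    clear h3
    induction L with
    | nil => simp
    | cons τ L ih =>
      have h5 := ih fun τ' hτ' => h2 τ' (List.mem_cons_of_mem _ hτ')
      obtain ⟨h6, h7⟩ := h2 τ List.mem_cons_self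
      rw [length_restrict] at h7
      have h8 := (_root_.abs_le.1 (h.abs_le_pow h6)).1
      simp only [List.map_cons, List.sum_cons, Nat.cast_add, mul_add]
      rw [cnt_padZero_restrict h7]
      push_cast at h5 ⊢
      linarith
  have h5 : (2 : ℝ) ^ level c *
      ((L.map fun τ => cnt (padZero (p.restrict s)) t τ + 2 ^ (t + 3)).sum : ℕ) ≤ 2 * 4 ^ (t + 2) := by
    exact_mod_cast h3
  have h6 : (0 : ℝ) < 4 ^ (t + 2) := by positivity
  have h7 : (0 : ℝ) < 2 ^ level c := by positivity
  have h8 : (2 : ℝ) ^ level c * (4 ^ (t + 2) * (L.map fun τ => μ.real (cyl τ)).sum) ≤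
      2 * 4 ^ (t + 2) := le_trans (by gcongr) h5
  have h9 : (2 : ℝ) ^ level c * (L.map fun τ => μ.real (cyl τ)).sum ≤ 2 := by
    refine le_of_mul_le_mul_right ?_ h6
    linarith
  rw [one_div, inv_pow, ← div_eq_mul_inv, le_div_iff₀ h7]
  linarith

lemma measure_openOf_list_le (μ : Measure Cantor) [IsFiniteMeasure μ] (L : List (List Bool)) :
    μ {y | ∃ τ ∈ L, y ∈ cyl τ} ≤ ENNReal.ofReal (L.map fun τ => μ.real (cyl τ)).sum := by
  induction L with
  | nil => simp
  | cons τ L ih =>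
    have h1 : {y | ∃ τ' ∈ τ :: L, y ∈ cyl τ'} = cyl τ ∪ {y | ∃ τ ∈ L, y ∈ cyl τ} := by
      ext y; simp
    rw [h1, List.map_cons, List.sum_cons, ENNReal.ofReal_add measureReal_nonneg
      (List.sum_nonneg (by simp))]
    refine (measure_union_le _ _).trans (add_le_add ?_ ih)
    rw [ofReal_measureReal]

lemma Near.measure_capturedBy_le {p : Cantor} {μ : Measure Cantor} [IsFiniteMeasure μ]
    (h : Near 2 p μ) (c : Code) :
    μ {y | CapturedBy c p y} ≤ ENNReal.ofReal (2 * (1 / 2) ^ level c) := by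
  let S : ℕ → Set Cantor := fun m => {y | ∃ j ≤ m, Small μ c p j ∧
    ∃ τ ∈ enumList c j (p.restrict j), y ∈ cyl τ}
  have hS : Monotone S := by
    rintro m m' hm y ⟨j, hj, h1⟩
    exact ⟨j, hj.trans hm, h1⟩
  have hsub : {y | CapturedBy c p y} ⊆ ⋃ m, S m := by
    rintro y ⟨s, n, ⟨j, t⟩, hL, τ, hτ, hp⟩
    refine Set.mem_iUnion.2 ⟨j, j, le_rfl, h.small hL, τ, ?_, mem_cyl_of_prefix hp⟩
    have : j ≤ s := by simpa using hL.1.1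
    rwa [enumList_restrict this] at hτ
  refine (measure_mono hsub).trans ?_
  rw [hS.measure_iUnion]
  refine iSup_le fun m => ?_
  induction m with
  | zero =>
    by_cases hm : Small μ c p 0
    · refine (measure_mono ?_).trans ((measure_openOf_list_le μ _).trans (ENNReal.ofReal_le_ofReal hm))
      rintro y ⟨j, hj, -, h1⟩
      obtain rfl : j = 0 := by omega
      exact h1
    · have : S 0 = ∅ := by
        refine Set.eq_empty_of_forall_notMem ?_
        rintro y ⟨j, hj, h1, -⟩
        obtain rfl : j = 0 := by omega
        exact hm h1
      rw [this]; simp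
  | succ m ih =>
    by_cases hm : Small μ c p (m + 1)
    · refine (measure_mono ?_).trans ((measure_openOf_list_le μ _).trans (ENNReal.ofReal_le_ofReal hm))
      rintro y ⟨j, hj, -, τ, hτ, hy⟩
      exact ⟨τ, enumList_mono hj hτ, hy⟩
    · have : S (m + 1) ⊆ S m := by
        rintro y ⟨j, hj, h1, h2⟩
        rcases Nat.le_succ_iff.1 hj with hj | rfl
        · exact ⟨j, hj, h1, h2⟩
        · exact absurd h1 hm
      exact (measure_mono this).trans ih

lemma Near.measure_captured_le {p : Cantor} {μ : Measure Cantor} [IsFiniteMeasure μ]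
    (h : Near 2 p μ) : μ {y | Captured p y} ≤ 1 / 2 := by
  have h1 : {y | Captured p y} = ⋃ c, {y | CapturedBy c p y} := by
    ext y; simp [captured_iff]
  rw [h1]
  refine (measure_iUnion_le _).trans ?_
  calc ∑' c : Code, μ {y | CapturedBy c p y}
      ≤ ∑' c : Code, (2⁻¹ : ℝ≥0∞) ^ (Encodable.encode c + 2) := by
        refine ENNReal.tsum_le_tsum fun c => (h.measure_capturedBy_le c).trans (le_of_eq ?_)
        have : (2 : ℝ) * (1 / 2) ^ level c = (1 / 2) ^ (Encodable.encode c + 2) := by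
          unfold level
          rw [pow_succ _ (Encodable.encode c + 2)]; ring
        rw [this, ENNReal.ofReal_pow (by norm_num), one_div, ENNReal.ofReal_inv_of_pos (by norm_num)]
        norm_num
    _ ≤ ∑' n : ℕ, (2⁻¹ : ℝ≥0∞) ^ (n + 2) :=
        ENNReal.tsum_comp_le_tsum_of_injective Encodable.encode_injective
          fun n => (2⁻¹ : ℝ≥0∞) ^ (n + 2)
    _ = 1 / 2 := by
        simp only [pow_add]
        rw [ENNReal.tsum_mul_right, ENNReal.tsum_geometric, ENNReal.one_sub_inv_two, inv_inv, pow_two,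
          ← mul_assoc, ENNReal.mul_inv_cancel (by norm_num) (by norm_num)]
        simp

/-! ### Neutral measures -/

lemma isClosed_good : IsClosed {p : Cantor | Good p} := by
  simp only [good_iff]
  exact isClosed_forall_restrict fun ρ => ¬ BadCode ρ

lemma isClosed_not_captured (y : Cantor) : IsClosed {p : Cantor | ¬ Captured p y} := by
  have : {p : Cantor | ¬ Captured p y} =
      {p : Cantor | ∀ s, ∀ n, ¬ Capture (y.restrict n) (p.restrict s)} := by
    ext p; simp [Captured]
  rw [this]
  exact isClosed_forall_restrict fun ρ => ∀ n, ¬ Capture (y.restrict n) ρ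

section Simplex

variable {N : ℕ} (y : Fin N → Cantor)

/-- The measure with mass `a i` at `y i`. -/
def pointMeasure (a : Fin N → ℝ) : Measure Cantor :=
  ∑ i, ENNReal.ofReal (a i) • Measure.dirac (y i)

lemma isProbabilityMeasure_pointMeasure {a : Fin N → ℝ} (ha : a ∈ stdSimplex ℝ (Fin N)) :
    IsProbabilityMeasure (pointMeasure y a) := by
  constructor
  unfold pointMeasure
  simp only [Measure.coe_finsetSum, Finset.sum_apply, Measure.smul_apply, measure_univ, smul_eq_mul,
    mul_one]
  rw [← ENNReal.ofReal_sum_of_nonneg fun i _ => ha.1 i, ha.2]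
  simp

open Classical in
lemma pointMeasure_real {a : Fin N → ℝ} (ha : a ∈ stdSimplex ℝ (Fin N)) (σ : List Bool) :
    (pointMeasure y a).real (cyl σ) = ∑ i, a i * if y i ∈ cyl σ then 1 else 0 := by
  unfold pointMeasure Measure.real
  simp only [Measure.coe_finsetSum, Finset.sum_apply, Measure.smul_apply, smul_eq_mul]
  rw [ENNReal.toReal_sum]
  · refine Finset.sum_congr rfl fun i _ => ?_
    rw [ENNReal.toReal_mul, ENNReal.toReal_ofReal (ha.1 i),
      Measure.dirac_apply' _ (measurableSet_cyl σ)]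
    by_cases h : y i ∈ cyl σ <;> simp [h]
  · intro i _
    exact ENNReal.mul_ne_top ENNReal.ofReal_ne_top (measure_ne_top _ _)

open Classical in
/-- For finitely many points there are a measure and codes for it such that each of the points is
not captured by one of the codes. -/
lemma exists_neutral_points (hN : 0 < N) :
    ∃ q, Good q ∧ ∀ i, ∃ p, Good p ∧ Sim p q ∧ ¬ Captured p (y i) := by
  let m : (Fin N → ℝ) → List Bool → ℝ := fun a σ => ∑ i, a i * if y i ∈ cyl σ then 1 else 0
  let R : Fin N → Set ((Fin N → ℝ) × Cantor) := fun i => {z | Good z.2 ∧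
    (∀ n σ, σ.length = n + 2 → |(cnt z.2 n σ : ℝ) - 4 ^ (n + 2) * m z.1 σ| ≤ 2) ∧
      ¬ Captured z.2 (y i)}
  have hm : ∀ σ, Continuous fun a => m a σ := fun σ =>
    continuous_finsetSum _ fun i _ => (continuous_apply i).mul continuous_const
  have hR : ∀ i, IsClosed (R i) := by
    intro i
    have hclose : IsClosed {z : (Fin N → ℝ) × Cantor | ∀ n σ, σ.length = n + 2 →
        |(cnt z.2 n σ : ℝ) - 4 ^ (n + 2) * m z.1 σ| ≤ 2} := ?_
    · exact (isClosed_good.preimage continuous_snd).inter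
        (hclose.inter ((isClosed_not_captured (y i)).preimage continuous_snd))
    simp only [Set.ofPred_forall]
    refine isClosed_iInter fun n => isClosed_iInter fun σ => isClosed_iInter fun _ => ?_
    refine isClosed_le (Continuous.abs ?_) continuous_const
    have hc : Continuous fun z : (Fin N → ℝ) × Cantor => (cnt z.2 n σ : ℝ) :=
      continuous_of_discreteTopology.comp ((continuous_cnt n σ).comp continuous_snd)
    exact hc.sub (continuous_const.mul ((hm σ).comp continuous_fst))
  have hF : ∀ i, IsClosed (Prod.fst '' R i) := fun i =>
    isClosedMap_fst_of_compactSpace _ (hR i)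
  have hnear : ∀ a ∈ stdSimplex ℝ (Fin N), ∀ p,
      (∀ n σ, σ.length = n + 2 → |(cnt p n σ : ℝ) - 4 ^ (n + 2) * m a σ| ≤ 2) ↔
        Near 2 p (pointMeasure y a) := by
    intro a ha p
    unfold Near
    simp only [pointMeasure_real y ha, m]
  have hex : ∀ a ∈ stdSimplex ℝ (Fin N), ∃ q, Good q ∧ Near 2 q (pointMeasure y a) := by
    intro a ha
    have := isProbabilityMeasure_pointMeasure y ha
    obtain ⟨q, hq1, hq2⟩ := exists_tidy_near (pointMeasure y a)
    exact ⟨q, hq2.good hq1, fun n σ hσ => (hq2 n σ hσ).trans (by norm_num)⟩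
  obtain ⟨a, ha, hmem⟩ := KKM.exists_common_point hN (fun i => Prod.fst '' R i) hF fun a ha => by
    have := isProbabilityMeasure_pointMeasure y ha
    obtain ⟨q, hq, hqn⟩ := hex a ha
    by_contra! hcon
    have h1 : ∀ i, 0 < a i → Captured q (y i) := by
      intro i hi
      by_contra hc
      exact hcon i hi ⟨(a, q), ⟨hq, (hnear a ha q).2 hqn, hc⟩, rfl⟩
    have h2 : (1 : ℝ≥0∞) ≤ pointMeasure y a {x | Captured q x} := by
      have : ∀ i, ENNReal.ofReal (a i) ≤
          ENNReal.ofReal (a i) * Measure.dirac (y i) {x | Captured q x} := by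
        intro i
        rcases (ha.1 i).eq_or_lt with h | h
        · rw [← h]; simp
        · rw [Measure.dirac_apply_of_mem (show y i ∈ {x | Captured q x} from h1 i h), mul_one]
      calc (1 : ℝ≥0∞) = ∑ i, ENNReal.ofReal (a i) := by
            rw [← ENNReal.ofReal_sum_of_nonneg fun i _ => ha.1 i, ha.2]; simp
        _ ≤ ∑ i, ENNReal.ofReal (a i) * Measure.dirac (y i) {x | Captured q x} :=
            Finset.sum_le_sum fun i _ => this i
        _ = pointMeasure y a {x | Captured q x} := by
            simp [pointMeasure, Measure.coe_finsetSum]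
    have h3 := h2.trans hqn.measure_captured_le
    norm_num at h3
  obtain ⟨q, hq, hqn⟩ := hex a ha
  refine ⟨q, hq, fun i => ?_⟩
  obtain ⟨⟨a', p⟩, ⟨h1, h2, h3⟩, rfl⟩ := hmem i
  exact ⟨p, h1, ((hnear _ ha p).1 h2).sim hqn, h3⟩

end Simplex

lemma exists_neutral_strings (k : ℕ) :
    ∃ q, Good q ∧ ∀ σ : List Bool, σ.length = k →
      ∃ p, Good p ∧ Sim p q ∧ ¬ Captured p (padZero σ) := by
  have h0 : 0 < (allStrings k).length :=
    List.length_pos_of_mem ((mem_allStrings (σ := List.replicate k false)).2 (by simp))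
  obtain ⟨q, hq, h⟩ := exists_neutral_points
    (fun i : Fin (allStrings k).length => padZero ((allStrings k).get i)) h0
  refine ⟨q, hq, fun σ hσ => ?_⟩
  obtain ⟨i, hi⟩ := List.get_of_mem (mem_allStrings.2 hσ)
  have := h i
  rwa [hi] at this

/-- Every good code for the measure coded by an extension of `η` captures the cylinder of `σ`. -/
def AllCapture (σ η : List Bool) : Prop :=
  ∀ p : Cantor, ∃ s, BadCode (p.restrict s) ∨ Differ (p.restrict s) η ∨ Capture σ (p.restrict s)

lemma sig_allCapture : Sig fun a : List Bool × List Bool => AllCapture a.1 a.2 := by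
  have hσ : Primrec fun c : (List Bool × List Bool) × List Bool => c.1.1 :=
    Primrec.fst.comp Primrec.fst
  have hη : Primrec fun c : (List Bool × List Bool) × List Bool => c.1.2 :=
    Primrec.snd.comp Primrec.fst
  have hρ := Primrec.snd (α := List Bool × List Bool) (β := List Bool)
  exact ((sig_badCode.comp hρ).or
    ((sig_differ.comp (hρ.pair hη)).or (sig_capture.comp (hσ.pair hρ)))).forall_cantor

/-- No extension of `η` codes a neutral measure. -/
def NotNeutral (η : List Bool) : Prop := BadCode η ∨ ∃ σ, AllCapture σ η

lemma sig_notNeutral : Sig NotNeutral :=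
  sig_badCode.or (sig_allCapture.comp (f := fun a : List Bool × List Bool => (a.2, a.1))
    (Primrec.snd.pair Primrec.fst)).ex

/-- The code `q` codes a neutral measure. -/
def Neutral (q : Cantor) : Prop := ∀ s, ¬ NotNeutral (q.restrict s)

lemma Neutral.good {q : Cantor} (hq : Neutral q) : Good q :=
  good_iff.2 fun s h => hq s (Or.inl h)

lemma exists_neutral : ∃ q, Neutral q := by
  by_contra! hcon
  unfold Neutral at hcon
  push Not at hcon
  obtain ⟨k, hk⟩ := exists_uniform_bound
    (G := fun k q => ∃ s, BadCode (q.restrict s) ∨ ∃ σ, σ.length ≤ k ∧ AllCapture σ (q.restrict s))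
    (fun k => by
      have : {q : Cantor | ∃ s, BadCode (q.restrict s) ∨
            ∃ σ, σ.length ≤ k ∧ AllCapture σ (q.restrict s)} =
          ⋃ s, {q : Cantor | BadCode (q.restrict s) ∨
            ∃ σ, σ.length ≤ k ∧ AllCapture σ (q.restrict s)} := by
        ext q; simp
      rw [this]
      exact isOpen_iUnion fun s => (isClopen_restrict s fun η =>
        BadCode η ∨ ∃ σ, σ.length ≤ k ∧ AllCapture σ η).2)
    (fun q => by
      obtain ⟨s, h | ⟨σ, h⟩⟩ := hcon q
      · exact ⟨0, s, Or.inl h⟩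
      · exact ⟨σ.length, s, Or.inr ⟨σ, le_rfl, h⟩⟩)
  obtain ⟨q, hq, h⟩ := exists_neutral_strings k
  obtain ⟨k', hk', s, h1 | ⟨σ, hσ, h1⟩⟩ := hk q
  · exact good_iff.1 hq s h1
  · obtain ⟨p, hp, hpq, hc⟩ := h ((padZero σ).restrict k) (by simp)
    obtain ⟨t, h2 | h2 | h2⟩ := h1 p
    · exact good_iff.1 hp t h2
    · exact hpq.not_differ _ _ h2
    · refine hc ⟨t, k, h2.mono ?_⟩
      have : (padZero ((padZero σ).restrict k)).restrict k = (padZero σ).restrict k := by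
        have := padZero_restrict ((padZero σ).restrict k)
        rwa [length_restrict] at this
      rw [this]
      exact prefix_of_mem_cyl (padZero_restrict σ) (hσ.trans hk')

lemma Neutral.exists_not_captured {q : Cantor} (hq : Neutral q) (x : Cantor) :
    ∃ p, Good p ∧ Sim p q ∧ ¬ Captured p x := by
  by_contra! hcon
  obtain ⟨n, hn⟩ := exists_uniform_bound
    (G := fun t p => ∃ s ≤ t, BadCode (p.restrict s) ∨ Differ (p.restrict s) (q.restrict t) ∨
      Capture (x.restrict t) (p.restrict s))
    (fun t => by
      have : {p : Cantor | ∃ s ≤ t, BadCode (p.restrict s) ∨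
            Differ (p.restrict s) (q.restrict t) ∨ Capture (x.restrict t) (p.restrict s)} =
          ⋃ s, ⋃ (_ : s ≤ t), {p : Cantor | BadCode (p.restrict s) ∨
            Differ (p.restrict s) (q.restrict t) ∨ Capture (x.restrict t) (p.restrict s)} := by
        ext p; simp
      rw [this]
      exact isOpen_iUnion fun s => isOpen_iUnion fun _ => (isClopen_restrict s fun ρ =>
        BadCode ρ ∨ Differ ρ (q.restrict t) ∨ Capture (x.restrict t) ρ).2)
    (fun p => by
      by_cases hp : Good p
      · by_cases hs : Sim p q
        · obtain ⟨s, n, h⟩ := hcon p hp hs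
          exact ⟨max s n, s, le_max_left _ _, Or.inr (Or.inr
            (h.mono (restrict_prefix x (le_max_right _ _))))⟩
        · obtain ⟨s, hs⟩ := exists_differ hs
          exact ⟨s, s, le_rfl, Or.inr (Or.inl hs)⟩
      · rw [good_iff] at hp
        push Not at hp
        obtain ⟨s, hs⟩ := hp
        exact ⟨s, s, le_rfl, Or.inl hs⟩)
  refine hq n (Or.inr ⟨x.restrict n, fun p => ?_⟩)
  obtain ⟨t, ht, s, hs, h | h | h⟩ := hn p
  · exact ⟨s, Or.inl h⟩
  · exact ⟨s, Or.inr (Or.inl (h.mono ht))⟩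
  · exact ⟨s, Or.inr (Or.inr (h.mono (restrict_prefix x ht)))⟩

/-! ### Avoiding atoms -/

lemma eq_of_mem_cyl {x : Cantor} {σ : List Bool} {n : ℕ} (hσ : σ.length = n) (hx : x ∈ cyl σ) :
    σ = x.restrict n := by
  rw [← hσ]; exact hx.symm

lemma cyl_subset_of_prefix {σ τ : List Bool} (h : σ <+: τ) : cyl τ ⊆ cyl σ := by
  intro x hx
  have hx : x.restrict τ.length = τ := hx
  rw [← hx] at h
  exact mem_cyl_of_prefix h

lemma disjoint_cyl {σ τ : List Bool} (hl : σ.length = τ.length) (hne : σ ≠ τ) :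
    Disjoint (cyl σ) (cyl τ) := by
  rw [Set.disjoint_left]
  intro x h1 h2
  exact hne ((eq_of_mem_cyl hl h1).trans (eq_of_mem_cyl rfl h2).symm)

/-- In a nonempty effectively closed set of good codes the measure of a neighbourhood of a given
noncomputable real is arbitrarily small. -/
lemma exists_small_cylinder {B : List Bool → Prop} (hB : Sig B)
    (hgood : ∀ p : Cantor, (∀ s, ¬ B (p.restrict s)) → Good p)
    (hne : ∃ p : Cantor, ∀ s, ¬ B (p.restrict s)) {x : Cantor} (hx : ¬ Computable x) {ε : ℝ}
    (hε : 0 < ε) :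
    ∃ p : Cantor, (∀ s, ¬ B (p.restrict s)) ∧ ∃ μ : ProbabilityMeasure Cantor, Near 2 p μ ∧
      ∃ m, (μ : Measure Cantor).real (cyl (x.restrict m)) < ε := by
  by_contra! hcon
  refine hx ?_
  let I : Set ℝ := {v | ∃ p : Cantor, (∀ s, ¬ B (p.restrict s)) ∧ ∃ μ : ProbabilityMeasure Cantor,
    Near 2 p μ ∧ ∃ m, v = (μ : Measure Cantor).real (cyl (x.restrict m))}
  have hIne : I.Nonempty := by
    obtain ⟨p, hp⟩ := hne
    obtain ⟨μ, hμ⟩ := (hgood p hp).exists_near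
    exact ⟨_, p, hp, μ, hμ, 0, rfl⟩
  have hIb : ∀ v ∈ I, ε ≤ v := by
    rintro v ⟨p, hp, μ, hμ, m, rfl⟩
    exact hcon p hp μ hμ m
  have hbdd : BddBelow I := ⟨ε, hIb⟩
  set a := sInf I with ha
  have ha0 : 0 < a := hε.trans_le (le_csInf hIne hIb)
  obtain ⟨v, ⟨p₀, hp₀, μ₀, hμ₀, m₀, rfl⟩, hv⟩ := exists_lt_of_csInf_lt hIne
    (show sInf I < 5 / 4 * a by rw [← ha]; linarith)
  obtain ⟨k, hk⟩ := pow_unbounded_of_one_lt (4 / a) (one_lt_two)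
  rw [div_lt_iff₀ ha0] at hk
  obtain ⟨C, hC1, hC2⟩ : ∃ C : ℕ, (C : ℝ) < 2 ^ k * a ∧ (2 : ℝ) ^ k * a ≤ C + 1 := by
    have h1 : 0 < ⌈(2 : ℝ) ^ k * a⌉₊ := Nat.ceil_pos.2 (by positivity)
    refine ⟨⌈(2 : ℝ) ^ k * a⌉₊ - 1, ?_, ?_⟩
    · rw [Nat.cast_sub h1]
      have := Nat.ceil_lt_add_one (show 0 ≤ (2 : ℝ) ^ k * a by positivity)
      push_cast; linarith
    · rw [Nat.cast_sub h1]
      have := Nat.le_ceil ((2 : ℝ) ^ k * a)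
      push_cast; linarith
  have h2k : (0 : ℝ) < 2 ^ k := by positivity
  have hp₀' : ¬ ∃ s, Exceeds (2 * C) k (x.restrict m₀) (p₀.restrict s) := by
    rw [hμ₀.exceeds_iff]
    push_cast
    have : (2 : ℝ) ^ k * (μ₀ : Measure Cantor).real (cyl (x.restrict m₀)) ≤ 2 ^ k * (5 / 4 * a) := by
      gcongr
    linarith
  let T : List Bool → Prop := fun σ => ∀ p : Cantor, ∃ s, B (p.restrict s) ∨
    Exceeds (2 * C) k (x.restrict m₀) (p.restrict s) ∨ Exceeds C k σ (p.restrict s)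
  have hTsig : Sig T := by
    have hσ := Primrec.fst (α := List Bool) (β := List Bool)
    have hρ := Primrec.snd (α := List Bool) (β := List Bool)
    exact ((hB.comp hρ).or (((sig_exceeds (2 * C) k).comp
      ((Primrec.const (x.restrict m₀)).pair hρ)).or
        ((sig_exceeds C k).comp (hσ.pair hρ)))).forall_cantor
  have hCx : ∀ p : Cantor, (∀ s, ¬ B (p.restrict s)) → ∀ μ : ProbabilityMeasure Cantor,
      Near 2 p μ → ∀ m, (C : ℝ) < 2 ^ k * (μ : Measure Cantor).real (cyl (x.restrict m)) := by
    intro p hp μ hμ m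
    refine hC1.trans_le ?_
    have := csInf_le hbdd (show (μ : Measure Cantor).real (cyl (x.restrict m)) ∈ I from
      ⟨p, hp, μ, hμ, m, rfl⟩)
    gcongr
  have hTx : ∀ m, T (x.restrict m) := by
    intro m p
    by_cases hp : ∀ s, ¬ B (p.restrict s)
    · obtain ⟨μ, hμ⟩ := (hgood p hp).exists_near
      obtain ⟨s, hs⟩ := hμ.exceeds_iff.2 (hCx p hp μ hμ m)
      exact ⟨s, Or.inr (Or.inr hs)⟩
    · push Not at hp
      obtain ⟨s, hs⟩ := hp
      exact ⟨s, Or.inl hs⟩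
  have hTu : ∀ σ, T σ → x.restrict m₀ <+: σ → σ = x.restrict σ.length := by
    intro σ hσ hpre
    by_contra hne
    obtain ⟨s, h | h | h⟩ := hσ p₀
    · exact hp₀ s h
    · exact hp₀' ⟨s, h⟩
    · have h1 := hμ₀.exceeds_iff.1 ⟨s, h⟩
      have h2 := hCx p₀ hp₀ μ₀ hμ₀ σ.length
      have hl : m₀ ≤ σ.length := by simpa using hpre.length_le
      have h3 : (μ₀ : Measure Cantor).real (cyl σ) +
          (μ₀ : Measure Cantor).real (cyl (x.restrict σ.length)) ≤
            (μ₀ : Measure Cantor).real (cyl (x.restrict m₀)) := by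
        rw [← measureReal_union (disjoint_cyl (by simp) hne) (measurableSet_cyl _)]
        exact measureReal_mono (Set.union_subset (cyl_subset_of_prefix hpre)
          (cyl_subset_of_prefix (restrict_prefix x hl)))
      refine hp₀' (hμ₀.exceeds_iff.2 ?_)
      have h4 : (2 : ℝ) ^ k * ((μ₀ : Measure Cantor).real (cyl σ) +
          (μ₀ : Measure Cantor).real (cyl (x.restrict σ.length))) ≤
            2 ^ k * (μ₀ : Measure Cantor).real (cyl (x.restrict m₀)) := by gcongr
      push_cast
      linarith
  refine Sig.computable ?_
  have hsig : Sig fun c : ℕ × Bool => ∃ σ : List Bool,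
      T σ ∧ ((m₀ ≤ σ.length ∧ x.restrict m₀ = σ.take m₀) ∧
        (c.1 < σ.length ∧ σ.getD c.1 false = c.2)) := by
    have hσ := Primrec.snd (α := ℕ × Bool) (β := List Bool)
    have hc := Primrec.fst (α := ℕ × Bool) (β := List Bool)
    have hl := Primrec.list_length.comp hσ
    refine Sig.ex (A := fun z : (ℕ × Bool) × List Bool =>
      T z.2 ∧ ((m₀ ≤ z.2.length ∧ x.restrict m₀ = z.2.take m₀) ∧
        (z.1.1 < z.2.length ∧ z.2.getD z.1.1 false = z.1.2))) ((hTsig.comp hσ).and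
          (PrimrecPred.sig ?_))
    refine ((Primrec.nat_le.comp (Primrec.const m₀) hl).and ?_).and (PrimrecPred.and ?_ ?_)
    · exact Primrec.eq.comp (Primrec.const _) (Primrec.list_take.comp (Primrec.const m₀) hσ)
    · exact Primrec.nat_lt.comp (Primrec.fst.comp hc) hl
    · exact Primrec.eq.comp ((Primrec.list_getD false).comp hσ (Primrec.fst.comp hc))
        (Primrec.snd.comp hc)
  refine hsig.of_eq fun c => ?_
  constructor
  · rintro ⟨σ, hσ, ⟨h1, h2⟩, h3, h4⟩
    have := hTu σ hσ (by rw [h2]; exact List.take_prefix _ _)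
    rw [this, restrict_getD x h3] at h4
    exact h4
  · intro h
    refine ⟨x.restrict (m₀ + c.1 + 1), hTx _, ⟨by simp; omega, ?_⟩, by simp, ?_⟩
    · rw [take_restrict x (by omega)]
    · rw [restrict_getD x (by omega), h]

/-- A nonempty effectively closed set of good codes, given by the set of strings it avoids. -/
structure GoodClass where
  /-- The strings that are avoided. -/
  B : List Bool → Prop
  sig : Sig B
  good : ∀ p : Cantor, (∀ s, ¬ B (p.restrict s)) → Good p
  nonempty : ∃ p : Cantor, ∀ s, ¬ B (p.restrict s)

/-- The set of members of a class. -/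
def GoodClass.carrier (S : GoodClass) : Set Cantor := {p | ∀ s, ¬ S.B (p.restrict s)}

lemma GoodClass.isClosed_carrier (S : GoodClass) : IsClosed S.carrier :=
  isClosed_forall_restrict fun ρ => ¬ S.B ρ

lemma GoodClass.exists_refine (S : GoodClass) {x : Cantor} (hx : ¬ Computable x) (i : ℕ) :
    ∃ S' : GoodClass, S'.carrier ⊆ S.carrier ∧
      ∃ m, ∀ p ∈ S'.carrier, ∀ s, ¬ Exceeds 1 i (x.restrict m) (p.restrict s) := by
  obtain ⟨p, hp, μ, hμ, m, hm⟩ := exists_small_cylinder S.sig S.good S.nonempty hx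
    (show (0 : ℝ) < 1 / 2 ^ i by positivity)
  refine ⟨⟨fun ρ => S.B ρ ∨ Exceeds 1 i (x.restrict m) ρ, ?_, ?_, p, ?_⟩, ?_, m, ?_⟩
  · exact S.sig.or ((sig_exceeds 1 i).comp ((Primrec.const (x.restrict m)).pair Primrec.id))
  · exact fun p hp => S.good p fun s h => hp s (Or.inl h)
  · rintro s (h | h)
    · exact hp s h
    · have := hμ.exceeds_iff.1 ⟨s, h⟩
      rw [lt_div_iff₀ (by positivity)] at hm
      push_cast at this
      linarith
  · exact fun p hp s h => hp s (Or.inl h)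
  · exact fun p hp s h => hp s (Or.inr h)

/-- A noncomputable real is a non-atom of some neutral measure. -/
lemma exists_neutral_nonatom {x : Cantor} (hx : ¬ Computable x) :
    ∃ q, Neutral q ∧ ∃ μ : ProbabilityMeasure Cantor, Near 2 q μ ∧ (μ : Measure Cantor) {x} = 0 := by
  let S₀ : GoodClass := ⟨NotNeutral, sig_notNeutral, fun _ hp => Neutral.good hp, exists_neutral⟩
  choose next hnext hm using fun (S : GoodClass) (i : ℕ) => S.exists_refine hx i
  let S : ℕ → GoodClass := fun n => Nat.rec S₀ (fun i T => next T i) n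
  have hS : ∀ i, (S (i + 1)).carrier ⊆ (S i).carrier := fun i => hnext (S i) i
  obtain ⟨q, hq⟩ := IsCompact.nonempty_iInter_of_sequence_nonempty_isCompact_isClosed
    (fun i => (S i).carrier) hS (fun i => (S i).nonempty)
    (S 0).isClosed_carrier.isCompact (fun i => (S i).isClosed_carrier)
  rw [Set.mem_iInter] at hq
  have hN : Neutral q := hq 0
  obtain ⟨μ, hμ⟩ := hN.good.exists_near
  refine ⟨q, hN, μ, hμ, ?_⟩
  have h1 : ∀ i : ℕ, (μ : Measure Cantor).real {x} ≤ (1 / 2) ^ i := by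
    intro i
    obtain ⟨m, hm⟩ := hm (S i) i
    have h2 : ¬ ∃ s, Exceeds 1 i (x.restrict m) (q.restrict s) := by
      push Not
      exact hm q (hq (i + 1))
    rw [hμ.exceeds_iff] at h2
    push Not at h2
    have h3 : (μ : Measure Cantor).real {x} ≤ (μ : Measure Cantor).real (cyl (x.restrict m)) :=
      measureReal_mono (Set.singleton_subset_iff.2 (restrict_mem_cyl x m))
    rw [one_div, inv_pow, ← one_div, le_div_iff₀ (by positivity)]
    push_cast at h2
    have h5 : (μ : Measure Cantor).real {x} * 2 ^ i ≤
      (μ : Measure Cantor).real (cyl (x.restrict m)) * 2 ^ i := by gcongr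
    linarith
  have h2 : (μ : Measure Cantor).real {x} ≤ 0 :=
    ge_of_tendsto' (tendsto_pow_atTop_nhds_zero_of_lt_one (by norm_num) (by norm_num)) h1
  exact (measureReal_eq_zero_iff (by finiteness)).1 (le_antisymm h2 measureReal_nonneg)

/-! ### Uncaptured reals are random -/

lemma tendsto_list_sum {f : List Bool → ℕ → ℝ} {g : List Bool → ℝ} (L : List (List Bool))
    (h : ∀ τ, Tendsto (f τ) atTop (𝓝 (g τ))) :
    Tendsto (fun t => (L.map fun τ => f τ t).sum) atTop (𝓝 (L.map g).sum) := by
  induction L with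
  | nil => simp
  | cons τ L ih => simpa using (h τ).add ih

/-- Lists of small measure are recognized as such. -/
lemma Near.exists_light {p : Cantor} {μ : Measure Cantor} [IsFiniteMeasure μ] (h : Near 2 p μ)
    {c : Code} {j : ℕ}
    (hL : ((enumList c j (p.restrict j)).map fun τ => μ.real (cyl τ)).sum ≤ (1 / 2) ^ level c) :
    ∃ t s, j ≤ s ∧ Light c j t (p.restrict s) := by
  set L := enumList c j (p.restrict j) with hLdef
  have h1 : Tendsto (fun t => (L.map fun τ =>
      (cnt p t τ : ℝ) / 4 ^ (t + 2) + 2 ^ (t + 3) / 4 ^ (t + 2)).sum) atTop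
      (𝓝 (L.map fun τ => μ.real (cyl τ)).sum) := by
    refine tendsto_list_sum L fun τ => ?_
    simpa using (h.tendsto τ).add tendsto_two_pow_div_four_pow
  have hlt : (L.map fun τ => μ.real (cyl τ)).sum < 2 * (1 / 2) ^ level c := by
    have : (0 : ℝ) < (1 / 2) ^ level c := by positivity
    linarith
  obtain ⟨t, ht1, ht2⟩ := ((h1.eventually (gt_mem_nhds hlt)).and
    (eventually_ge_atTop ((L.map List.length).sum))).exists
  have hlen : ∀ τ ∈ L, τ.length ≤ t := fun τ hτ =>
    (List.single_le_sum (by simp) _ (List.mem_map_of_mem hτ)).trans ht2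
  let s := j + (L.map fun τ => bitBound t τ.length).sum
  have hbb : ∀ τ ∈ L, bitBound t τ.length ≤ s := fun τ hτ =>
    (List.single_le_sum (by simp) _
      (List.mem_map_of_mem (f := fun τ : List Bool => bitBound t τ.length) hτ)).trans
      (Nat.le_add_left _ _)
  have hjs : j ≤ s := Nat.le_add_right _ _
  refine ⟨t, s, hjs, ⟨by simpa using hjs, ?_⟩, ?_⟩
  · rw [enumList_restrict hjs, ← hLdef]
    intro τ hτ
    exact ⟨(hlen τ hτ).trans (by omega), by simpa using hbb τ hτ⟩
  · rw [enumList_restrict hjs, ← hLdef]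
    have h4 : (0 : ℝ) < 4 ^ (t + 2) := by positivity
    have h2 : ((L.map fun τ => cnt (padZero (p.restrict s)) t τ + 2 ^ (t + 3)).sum : ℕ) =
        4 ^ (t + 2) * (L.map fun τ =>
          (cnt p t τ : ℝ) / 4 ^ (t + 2) + 2 ^ (t + 3) / 4 ^ (t + 2)).sum := by
      rw [List.map_congr_left (g := fun τ => cnt p t τ + 2 ^ (t + 3))
        (fun τ hτ => by rw [cnt_padZero_restrict (hbb τ hτ)])]
      clear_value L
      clear * - h4
      induction L with
      | nil => simp
      | cons τ L ih =>
        simp only [List.map_cons, List.sum_cons, Nat.cast_add, mul_add, ih]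
        field_simp
        push_cast
        ring
    have h3 : (2 : ℝ) ^ level c *
        ((L.map fun τ => cnt (padZero (p.restrict s)) t τ + 2 ^ (t + 3)).sum : ℕ) ≤
          2 * 4 ^ (t + 2) := by
      rw [h2]
      calc (2 : ℝ) ^ level c * (4 ^ (t + 2) * (L.map fun τ =>
            (cnt p t τ : ℝ) / 4 ^ (t + 2) + 2 ^ (t + 3) / 4 ^ (t + 2)).sum)
          ≤ 2 ^ level c * (4 ^ (t + 2) * (2 * (1 / 2) ^ level c)) := by gcongr
        _ = (2 ^ level c * (1 / 2) ^ level c) * (2 * 4 ^ (t + 2)) := by ring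
        _ = 2 * 4 ^ (t + 2) := by rw [← mul_pow]; norm_num
    exact_mod_cast h3

lemma sum_measureReal_le_of_subset (μ : Measure Cantor) [IsFiniteMeasure μ] {L : List (List Bool)}
    (hL : L.Nodup) {U : Set (List Bool)} (hU : ∀ τ ∈ L, τ ∈ U) {r : ℝ} (hr : 0 ≤ r)
    (h : ∑' σ : U, μ (cyl σ) ≤ ENNReal.ofReal r) : (L.map fun τ => μ.real (cyl τ)).sum ≤ r := by
  classical
  rw [← List.sum_toFinset _ hL]
  have h1 : ∑ τ ∈ L.toFinset, μ (cyl τ) ≤ ∑' σ : U, μ (cyl σ) := by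
    have : ∑ τ ∈ L.toFinset, μ (cyl τ) =
        ∑ τ ∈ L.toFinset.attach.map ⟨fun τ : {τ // τ ∈ L.toFinset} =>
          (⟨τ.1, hU _ (List.mem_toFinset.1 τ.2)⟩ : U),
          fun a b hab => Subtype.ext (congrArg (fun z : U => z.1) hab)⟩, μ (cyl (τ : U)) := by
      rw [Finset.sum_map, ← Finset.sum_attach]
      rfl
    rw [this]
    exact ENNReal.sum_le_tsum _
  have h2 : ∑ τ ∈ L.toFinset, μ.real (cyl τ) = (∑ τ ∈ L.toFinset, μ (cyl τ)).toReal := by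
    rw [ENNReal.toReal_sum fun τ _ => measure_ne_top _ _]
    rfl
  rw [h2]
  exact ENNReal.toReal_le_of_le_ofReal hr (h1.trans h)

/-- A real that is not captured passes every test. -/
lemma Near.not_mem_of_not_captured {p : Cantor} {μ : ProbabilityMeasure Cantor} (h : Near 2 p μ)
    {x : Cantor} (hx : ¬ Captured p x) {U : ℕ → Set (List Bool)} (hU : IsTest p μ U) :
    x ∉ ⋂ n, openOf (U n) := by
  intro hmem
  obtain ⟨c, hc⟩ := hU.1.exists_code
  have h1 : x ∈ openOf (U (level c)) := Set.mem_iInter.1 hmem _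
  simp only [openOf, Set.mem_iUnion] at h1
  obtain ⟨σ, hσ, hxσ⟩ := h1
  obtain ⟨s, k, hsk⟩ := (hc (level c, σ)).1 hσ
  let j := s + k + Encodable.encode σ + 1
  have hsub : ∀ τ ∈ enumList c j (p.restrict j), τ ∈ U (level c) := by
    intro τ hτ
    obtain ⟨-, s', hs', k', hk', h2⟩ := mem_enumList.1 hτ
    rw [take_restrict p hs'.le] at h2
    exact (hc (level c, τ)).2 ⟨s', k', h2⟩
  have hmemσ : σ ∈ enumList c j (p.restrict j) := by
    refine mem_enumList.2 ⟨by omega, s, by omega, k, by omega, ?_⟩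
    rw [take_restrict p (by omega)]
    exact hsk
  have hsum := sum_measureReal_le_of_subset (μ : Measure Cantor) (nodup_enumList c j (p.restrict j))
    hsub (r := (1 / 2) ^ level c) (by positivity) ((hU.2 (level c)).trans_eq (by
      rw [ENNReal.ofReal_pow (by norm_num), one_div, ENNReal.ofReal_inv_of_pos (by norm_num)]
      norm_num))
  obtain ⟨t, s', hjs, hlight⟩ := h.exists_light hsum
  refine hx ⟨s', σ.length, c, (j, t), hlight, σ, ?_, prefix_of_mem_cyl hxσ le_rfl⟩
  rw [enumList_restrict hjs]
  exact hmemσ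

/-- A noncomputable real is random for a measure of which it is not an atom. -/
theorem exists_isRandom_of_not_computable {x : Cantor} (hx : ¬ Computable x) :
    ∃ μ : ProbabilityMeasure Cantor, ¬ IsAtom μ x ∧ IsRandom μ x := by
  obtain ⟨q, hq, μ, hμ, hzero⟩ := exists_neutral_nonatom hx
  obtain ⟨p, hp, hpq, hcap⟩ := hq.exists_not_captured x
  have hnear : Near 2 p μ := hpq.near hp hμ
  refine ⟨μ, by simp [IsAtom, hzero], p, hnear.represents hp.1, fun U hU => ?_⟩
  exact hnear.not_mem_of_not_captured hcap hU

/-! ### Computable reals -/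

lemma iInter_cyl_restrict (x : Cantor) : ⋂ m, cyl (x.restrict m) = {x} := by
  ext y
  simp only [Set.mem_iInter, Set.mem_singleton_iff]
  refine ⟨fun h => ?_, fun h => h ▸ restrict_mem_cyl x⟩
  funext i
  have h1 := eq_of_mem_cyl (length_restrict x (i + 1)) (h (i + 1))
  exact (restrict_eq_iff.1 h1 i (by omega)).symm

lemma tendsto_measureReal_cyl_restrict (μ : Measure Cantor) [IsFiniteMeasure μ] {x : Cantor}
    (hx : μ {x} = 0) : Tendsto (fun m => μ.real (cyl (x.restrict m))) atTop (𝓝 0) := by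
  have h1 := tendsto_measure_iInter_atTop (μ := μ) (s := fun m => cyl (x.restrict m))
    (fun m => (measurableSet_cyl _).nullMeasurableSet)
    (fun _ _ h => cyl_subset_of_prefix (restrict_prefix x h)) ⟨0, measure_ne_top _ _⟩
  rw [iInter_cyl_restrict, hx] at h1
  exact (ENNReal.tendsto_toReal ENNReal.zero_ne_top).comp h1

/-- The code `ρ` certifies, at stage `t`, that the cylinder of `σ` has measure at most `2⁻ⁿ`. -/
def RecognizedSmall (n t : ℕ) (σ ρ : List Bool) : Prop :=
  2 ^ n * (cnt (padZero ρ) t σ + 2 ^ (σ.length + 1) * 2 ^ (t + 4)) ≤ 4 ^ (t + 2)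

lemma primrecPred_small {α : Type*} [Primcodable α] {n t : α → ℕ} {σ ρ : α → List Bool}
    (hn : Primrec n) (ht : Primrec t) (hσ : Primrec σ) (hρ : Primrec ρ) :
    PrimrecPred fun a => RecognizedSmall (n a) (t a) (σ a) (ρ a) := by
  refine Primrec.nat_le.comp (Primrec.nat_mul.comp ((primrec_pow 2).comp hn)
    (Primrec.nat_add.comp (primrec_cnt hρ ht hσ) (Primrec.nat_mul.comp ?_ ?_))) (primrec_four_pow ht)
  · exact (primrec_pow 2).comp (Primrec.succ.comp (Primrec.list_length.comp hσ))
  · exact (primrec_pow 2).comp (Primrec.nat_add.comp ht (Primrec.const 4))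

lemma small_restrict_iff {p : Cantor} {n t s : ℕ} {σ : List Bool}
    (h : bitBound t σ.length ≤ s) : RecognizedSmall n t σ (p.restrict s) ↔
      2 ^ n * ((cnt p t σ : ℝ) / 4 ^ (t + 2) + 2 ^ (σ.length + 1) * (1 / 2) ^ t) ≤ 1 := by
  have h4 : (0 : ℝ) < 4 ^ (t + 2) := by positivity
  rw [RecognizedSmall, cnt_padZero_restrict h, ← mul_le_mul_iff_of_pos_right h4, ← Nat.cast_le (α := ℝ)]
  have h5 : (2 : ℝ) ^ (t + 4) = (1 / 2) ^ t * 4 ^ (t + 2) := by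
    have : (4 : ℝ) ^ t = 2 ^ t * 2 ^ t := by rw [← mul_pow]; norm_num
    rw [pow_add, pow_add, this, one_div, inv_pow]
    field_simp
    norm_num
  push_cast
  rw [h5, one_mul]
  refine iff_of_eq (congrArg (· ≤ _) ?_)
  field_simp

lemma Represents.small_of_small {p : Cantor} {μ : ProbabilityMeasure Cantor} (hp : Represents p μ)
    {n t s : ℕ} {σ : List Bool} (h : bitBound t σ.length ≤ s) (hs : RecognizedSmall n t σ (p.restrict s)) :
    (μ : Measure Cantor) (cyl σ) ≤ (2 : ℝ≥0∞)⁻¹ ^ n := by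
  rw [small_restrict_iff h] at hs
  have h1 := neg_le_of_abs_le (hp.abs_sub_le t σ)
  have h2 : (μ : Measure Cantor).real (cyl σ) ≤ 1 / 2 ^ n := by
    rw [le_div_iff₀ (by positivity), mul_comm]
    refine le_trans ?_ hs
    gcongr
    linarith
  rw [← ENNReal.ofReal_toReal (measure_ne_top (μ : Measure Cantor) (cyl σ))]
  refine (ENNReal.ofReal_le_ofReal h2).trans_eq ?_
  rw [← inv_eq_one_div, ENNReal.ofReal_inv_of_pos (by positivity), ENNReal.ofReal_pow (by norm_num),
    ENNReal.inv_pow]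
  norm_num

lemma Represents.exists_small {p : Cantor} {μ : ProbabilityMeasure Cantor} (hp : Represents p μ)
    {x : Cantor} (hx : (μ : Measure Cantor) {x} = 0) (n : ℕ) :
    ∃ m t, ∀ s, bitBound t m ≤ s → RecognizedSmall n t (x.restrict m) (p.restrict s) := by
  have hpos : (0 : ℝ) < 1 / 2 ^ n := by positivity
  obtain ⟨m, hm⟩ := ((tendsto_measureReal_cyl_restrict (μ : Measure Cantor) hx).eventually
    (gt_mem_nhds hpos)).exists
  have h1 : Tendsto (fun t : ℕ => (μ : Measure Cantor).real (cyl (x.restrict m)) +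
      2 * (2 ^ (m + 1) * (1 / 2 : ℝ) ^ t)) atTop
      (𝓝 ((μ : Measure Cantor).real (cyl (x.restrict m)))) := by
    have := tendsto_pow_atTop_nhds_zero_of_lt_one (r := (1 / 2 : ℝ)) (by norm_num) (by norm_num)
    simpa using ((this.const_mul (2 ^ (m + 1))).const_mul 2).const_add
      ((μ : Measure Cantor).real (cyl (x.restrict m)))
  obtain ⟨t, ht⟩ := (h1.eventually (gt_mem_nhds hm)).exists
  refine ⟨m, t, fun s hs => ?_⟩
  rw [small_restrict_iff (by simpa using hs)]
  have h2 := le_of_abs_le (hp.abs_sub_le t (x.restrict m))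
  rw [lt_div_iff₀ (by positivity), mul_comm] at ht
  refine le_trans ?_ ht.le
  rw [length_restrict] at h2 ⊢
  exact mul_le_mul_of_nonneg_left (by linarith) (by positivity)

/-- The strings, each with two numbers, that are coded by `K`. -/
def decodeTriple (K : ℕ) : List (List Bool × ℕ × ℕ) :=
  (Encodable.decode (α := List Bool × ℕ × ℕ) K).toList

lemma primrec_decodeTriple : Primrec decodeTriple := Primrec.optionToList.comp Primrec.decode

lemma decodeTriple_encode (z : List Bool × ℕ × ℕ) : decodeTriple (Encodable.encode z) = [z] := by
  simp [decodeTriple]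

lemma eq_of_mem_decodeTriple {K : ℕ} {z z' : List Bool × ℕ × ℕ} (h : z ∈ decodeTriple K)
    (h' : z' ∈ decodeTriple K) : z = z' := by
  simp only [decodeTriple, Option.mem_toList] at h h'
  exact Option.mem_unique h h'

/-- The search condition: `z = (σ, t, w)` consists of a string `σ` with a witness `w` for membership
in the projection of `h`, and a stage `t` at which `σ` is recognized to be small. -/
def Search (h : List Bool × ℕ → Prop) (n : ℕ) (z : List Bool × ℕ × ℕ) (ρ : List Bool) : Prop :=
  h (z.1, z.2.2) ∧ RecognizedSmall n z.2.1 z.1 ρ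

/-- The first successful search, at `K`, yields `σ`. -/
def FoundAt (h : List Bool × ℕ → Prop) (n K : ℕ) (σ ρ : List Bool) : Prop :=
  (∀ K' < K + 1, ∀ z ∈ decodeTriple K', bitBound z.2.1 z.1.length ≤ ρ.length) ∧
    (∃ z ∈ decodeTriple K, z.1 = σ ∧ Search h n z ρ) ∧
      ∀ K' < K, ∀ z ∈ decodeTriple K', ¬ Search h n z ρ

lemma primrecPred_search {α : Type*} [Primcodable α] {h : List Bool × ℕ → Prop}
    (hh : PrimrecPred h) {n : α → ℕ} {z : α → List Bool × ℕ × ℕ} {ρ : α → List Bool}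
    (hn : Primrec n) (hz : Primrec z) (hρ : Primrec ρ) :
    PrimrecPred fun a => Search h (n a) (z a) (ρ a) :=
  (hh.comp ((Primrec.fst.comp hz).pair (Primrec.snd.comp (Primrec.snd.comp hz)))).and
    (primrecPred_small hn (Primrec.fst.comp (Primrec.snd.comp hz)) (Primrec.fst.comp hz) hρ)

lemma primrecPred_foundAt {α : Type*} [Primcodable α] {h : List Bool × ℕ → Prop}
    (hh : PrimrecPred h) {n K : α → ℕ} {σ ρ : α → List Bool} (hn : Primrec n) (hK : Primrec K)
    (hσ : Primrec σ) (hρ : Primrec ρ) :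
    PrimrecPred fun a => FoundAt h (n a) (K a) (σ a) (ρ a) := by
  refine PrimrecPred.and ?_ (PrimrecPred.and ?_ ?_)
  · refine PrimrecPred.ball_lt (R := fun c : α × ℕ => ∀ z ∈ decodeTriple c.2,
      bitBound z.2.1 z.1.length ≤ (ρ c.1).length) ?_ (Primrec.succ.comp hK)
    refine PrimrecPred.ball (R := fun c : (α × ℕ) × (List Bool × ℕ × ℕ) =>
      bitBound c.2.2.1 c.2.1.length ≤ (ρ c.1.1).length) ?_
      (primrec_decodeTriple.comp Primrec.snd)
    exact Primrec.nat_le.comp (primrec_bitBound (Primrec.fst.comp (Primrec.snd.comp Primrec.snd))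
      (Primrec.list_length.comp (Primrec.fst.comp Primrec.snd)))
      (Primrec.list_length.comp (hρ.comp (Primrec.fst.comp Primrec.fst)))
  · refine PrimrecPred.bex (R := fun c : α × (List Bool × ℕ × ℕ) =>
      c.2.1 = σ c.1 ∧ Search h (n c.1) c.2 (ρ c.1)) ?_ (primrec_decodeTriple.comp hK)
    exact PrimrecPred.and (Primrec.eq.comp (Primrec.fst.comp Primrec.snd) (hσ.comp Primrec.fst))
      (primrecPred_search hh (hn.comp Primrec.fst) Primrec.snd (hρ.comp Primrec.fst))
  · refine PrimrecPred.ball_lt (R := fun c : α × ℕ => ∀ z ∈ decodeTriple c.2,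
      ¬ Search h (n c.1) z (ρ c.1)) ?_ hK
    refine PrimrecPred.ball (R := fun c : (α × ℕ) × (List Bool × ℕ × ℕ) =>
      ¬ Search h (n c.1.1) c.2 (ρ c.1.1)) ?_ (primrec_decodeTriple.comp Primrec.snd)
    exact (primrecPred_search hh (hn.comp (Primrec.fst.comp Primrec.fst)) Primrec.snd
      (hρ.comp (Primrec.fst.comp Primrec.fst))).not

lemma search_restrict_congr {h : List Bool × ℕ → Prop} {n : ℕ} {z : List Bool × ℕ × ℕ} {p : Cantor}
    {s s' : ℕ} (hs : bitBound z.2.1 z.1.length ≤ s) (hs' : bitBound z.2.1 z.1.length ≤ s') :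
    Search h n z (p.restrict s) ↔ Search h n z (p.restrict s') := by
  rw [Search, Search, small_restrict_iff hs, small_restrict_iff hs']

lemma FoundAt.eq {h : List Bool × ℕ → Prop} {n K K' : ℕ} {σ σ' : List Bool} {p : Cantor}
    {s s' : ℕ} (h1 : FoundAt h n K σ (p.restrict s)) (h2 : FoundAt h n K' σ' (p.restrict s')) :
    σ = σ' := by
  wlog hK : K ≤ K' generalizing K K' σ σ' s s'
  · exact (this h2 h1 (le_of_not_ge hK)).symm
  obtain ⟨hb, ⟨z, hz, hzσ, hzs⟩, -⟩ := h1
  obtain ⟨hb', ⟨z', hz', hzσ', hzs'⟩, hleast⟩ := h2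
  rw [length_restrict] at hb hb'
  rcases hK.eq_or_lt with rfl | hlt
  · rw [← hzσ, ← hzσ', eq_of_mem_decodeTriple hz hz']
  · refine absurd ?_ (hleast _ hlt z hz)
    exact (search_restrict_congr (hb _ (by omega) z hz) (hb' _ (by omega) z hz)).1 hzs

lemma exists_foundAt {h : List Bool × ℕ → Prop} {n : ℕ} {p : Cantor} {z : List Bool × ℕ × ℕ}
    (hz : ∀ s, bitBound z.2.1 z.1.length ≤ s → Search h n z (p.restrict s)) :
    ∃ σ s, ∃ K < s, FoundAt h n K σ (p.restrict s) := by
  classical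
  have hex : ∃ K, ∃ z ∈ decodeTriple K,
      Search h n z (p.restrict (bitBound z.2.1 z.1.length)) :=
    ⟨Encodable.encode z, z, by simp [decodeTriple_encode], hz _ le_rfl⟩
  let K := Nat.find hex
  obtain ⟨z, hzK, hzs⟩ : ∃ z ∈ decodeTriple K, _ := Nat.find_spec hex
  let s := K + 1 + ((List.range (K + 1)).map fun K' =>
    ((decodeTriple K').map fun z => bitBound z.2.1 z.1.length).sum).sum
  have hb : ∀ K' < K + 1, ∀ z ∈ decodeTriple K', bitBound z.2.1 z.1.length ≤ s := by
    intro K' hK' z hz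
    refine le_trans ?_ (Nat.le_add_left _ _)
    refine le_trans ?_ (List.single_le_sum (by simp) _
      (List.mem_map_of_mem (List.mem_range.2 hK')))
    exact List.single_le_sum (by simp) _ (List.mem_map_of_mem
      (f := fun z : List Bool × ℕ × ℕ => bitBound z.2.1 z.1.length) hz)
  refine ⟨z.1, s, K, by simp only [s]; omega, by simpa using hb, ⟨z, hzK, rfl, ?_⟩, ?_⟩
  · exact (search_restrict_congr le_rfl (hb K (by omega) z hzK)).1 hzs
  · intro K' hK' z hz hs
    exact Nat.find_min hex hK'
      ⟨z, hz, (search_restrict_congr (hb K' (by omega) z hz) le_rfl).1 hs⟩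

/-- A computable real is random only for measures of which it is an atom. -/
theorem isAtom_of_isRandom_of_computable {x : Cantor} (hx : Computable x)
    {μ : ProbabilityMeasure Cantor} (hμ : IsRandom μ x) : IsAtom μ x := by
  by_contra hatom
  have hzero : (μ : Measure Cantor) {x} = 0 := by simpa [IsAtom] using hatom
  obtain ⟨p, hp, hrand⟩ := hμ
  obtain ⟨h, hh, hhx⟩ := sig_restrict_of_computable hx
  let U : ℕ → Set (List Bool) := fun n => {σ | ∃ s, ∃ K < (p.restrict s).length,
    FoundAt h n K σ (p.restrict s)}
  have hprim : PrimrecPred fun a : (ℕ × List Bool) × List Bool =>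
      ∃ K < a.2.length, FoundAt h a.1.1 K a.1.2 a.2 :=
    PrimrecPred.bex_lt (R := fun c : ((ℕ × List Bool) × List Bool) × ℕ =>
      FoundAt h c.1.1.1 c.2 c.1.1.2 c.1.2)
      (primrecPred_foundAt hh (Primrec.fst.comp (Primrec.fst.comp Primrec.fst)) Primrec.snd
        (Primrec.snd.comp (Primrec.fst.comp Primrec.fst)) (Primrec.snd.comp Primrec.fst))
      (Primrec.list_length.comp Primrec.snd)
  refine hrand U ⟨reIn_of_primrecPred hprim, fun n => ?_⟩
    (Set.mem_iInter.2 fun n => ?_)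
  · rcases (U n).eq_empty_or_nonempty with hU | ⟨σ, hσ⟩
    · rw [hU]; simp
    · obtain ⟨s, K, -, hK⟩ := id hσ
      have hU : U n = {σ} := Set.eq_singleton_iff_unique_mem.2
        ⟨hσ, fun τ ⟨_, _, _, hτ⟩ => hτ.eq hK⟩
      rw [hU, tsum_singleton (f := fun σ => (μ : Measure Cantor) (cyl σ))]
      obtain ⟨hb, ⟨z, hz, rfl, -, hs⟩, -⟩ := hK
      exact hp.small_of_small (by simpa using hb K (by omega) z hz) hs
  · obtain ⟨m, t, hmt⟩ := hp.exists_small hzero n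
    obtain ⟨w, hw⟩ := (hhx (x.restrict m)).1 (by simp)
    obtain ⟨σ, s, K, hKs, hK⟩ := exists_foundAt (h := h) (n := n) (p := p)
      (z := (x.restrict m, t, w)) fun s hs => ⟨hw, hmt s (by simpa using hs)⟩
    refine Set.mem_biUnion (show σ ∈ U n from ⟨s, K, by simpa using hKs, hK⟩) ?_
    obtain ⟨-, ⟨z, -, rfl, hz, -⟩, -⟩ := hK
    exact (hhx z.1).2 ⟨_, hz⟩

end Cantor

end

theorem mainTheorem1 (x : Cantor) :
    (∃ μ : MeasureTheory.ProbabilityMeasure Cantor,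
      ¬ Cantor.IsAtom μ x ∧ Cantor.IsRandom μ x) ↔ ¬ Computable x :=
  ⟨fun ⟨_, hatom, hrand⟩ hx => hatom (Cantor.isAtom_of_isRandom_of_computable hx hrand),
    Cantor.exists_isRandom_of_not_computable⟩
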